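/- Fix a congestion density $\rho^*>0$ and $\gamma>0$, and let $p(\rho)=\left(\frac1\rho-\frac1{\rho^*}\right)^{-\gamma}$ for $0<\rho<\rho^*$, $p(0)=0$. For $\varepsilon>0$ consider the one-dimensional system $$\partial_t\rho+\partial_xq=0,\qquad \partial_tq+\partial_x\Big(\frac{q^2}{\rho}+\varepsilon p(\rho)\Big)=0 .$$ The solution of the Riemann problem with left state $(\rho_\ell^\varepsilon,q_\ell^\varepsilon)$ and right state $(\rho_r^\varepsilon,q_r^\varepsilon)$ is understood as the self-similar function of $x/t$, $t>0$, made of constant states separated by a (possibly absent) 1-wave and a (possibly absent) 2-wave, each a rarefaction wave or an entropic shock; the intermediate state may be vacuum. Assume that, as $\varepsilon\to0^+$, $(\rho_\ell^\varepsilon,q_\ell^\varepsilon,\varepsilon p(\rho_\ell^\varepsilon))\to(\rho^*,q_\ell,\bar p_\ell)$ with $\rho_\ell^\varepsilon<\rho^*$ and $\bar p_\ell<+\infty$ (the left state is congested), and $(\rho_r^\varepsilon,q_r^\varepsilon)\to(\rho_r,q_r)$ with $0<\rho_r<\rho^*$ (the right state is uncongested, so that $\varepsilon p(\rho_r^\varepsilon)\to0$).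 Put $u_\ell=q_\ell/\rho^*$ and $u_r=q_r/\rho_r$. Then for all small $\varepsilon$ the Riemann problem has a solution, and as $\varepsilon\to0^+$ the triples $(\rho^\varepsilon,q^\varepsilon,\varepsilon p(\rho^\varepsilon))$ of any such solutions converge to the following wave fans $(\rho,q,\bar p)$ of the limit system $\partial_t\rho+\partial_xq=0$, $\partial_tq+\partial_x(q^2/\rho+\bar p)=0$, $(\rho-\rho^*)\bar p=0$. Convergence to a fan means that each wave is concentrated between two speeds that both tend, in $[-\infty,\infty]$, to its limit speed, and that $(\rho^\varepsilon,q^\varepsilon,\varepsilon p(\rho^\varepsilon))$ tends uniformly to the indicated constant state between consecutive waves (and to the left of the first and to the right of the last one). A contact wave has equal pressures on both sides and travels with the velocity of the adjacent states; a finite-speed shock satisfies the Rankine--Hugoniot conditions with decreasing velocity; across a shock of infinite speed between congested states only $\bar p$ may jump; a declustering wave is a shock of infinite speed between two congested states whose pressure is zero for positive time. 1. If $u_\ell<u_r$: one declustering wave (speed $-\infty$) from $(\rho^*,q_\ell,\bar p_\ell)$ to $(\rho^*,q_\ell,0)$, then a contact wave of speed $u_\ell$ from $(\rho^*,q_\ell,0)$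 to vacuum, then a contact wave of speed $u_r$ from vacuum to $(\rho_r,q_r,0)$. In the vacuum, $\rho=q=\bar p=0$. 2. If $u_\ell>u_r$: two shock waves, connecting $(\rho^*,q_\ell,\bar p_\ell)$ to a congested state $(\rho^*,\tilde q,\bar p)$ and $(\rho^*,\tilde q,\bar p)$ to $(\rho_r,q_r,0)$, where $$\tilde q=\rho^*u_\ell,\qquad \bar p=\frac{\rho^*\rho_r}{\rho^*-\rho_r}(u_\ell-u_r)^2,$$ with speeds $$\sigma_-=-\infty,\qquad \sigma_+=u_r+\sqrt{\frac{\rho^*}{\rho_r}}\sqrt{\frac{\bar p}{\rho^*-\rho_r}} .$$ 3. If $u_\ell=u_r$: one declustering wave (speed $-\infty$) from $(\rho^*,q_\ell,\bar p_\ell)$ to $(\rho^*,q_\ell,0)$, then a contact wave of speed $u_\ell=u_r$ from $(\rho^*,q_\ell,0)$ to $(\rho_r,q_r,0)$. A wave whose two limit states coincide (the declustering wave when $\bar p_\ell=0$, the first shock when $\bar p=\bar p_\ell$) is degenerate: there is no jump. -/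

import Mathlib

open Filter Topology Set

noncomputable section

namespace Congestion

/-! ### The rescaled Euler system with congestion, in one space dimension

`∂ₜρ + ∂ₓq = 0`, `∂ₜq + ∂ₓ(q²/ρ + ε p(ρ)) = 0`. A state is a pair `(ρ, q)` of a density and a
momentum; self-similar solutions are functions `U` of `s = x / t`. -/

/-- The congestion pressure `p(ρ) = (1/ρ - 1/ρ*)^(-γ)` for `0 < ρ < ρ*`, with `p = 0` at vacuum. -/
def pressure (ρs γ ρ : ℝ) : ℝ :=
  if ρ ≤ 0 then 0 else 1 / (1 / ρ - 1 / ρs) ^ γ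

/-- The velocity `u = q / ρ` of a state. -/
def vel (A : ℝ × ℝ) : ℝ := A.2 / A.1

/-- The two characteristic families. -/
inductive Family
  | one
  | two

/-- The sign `-` for the first family, `+` for the second one. -/
def Family.sign : Family → ℝ
  | .one => -1
  | .two => 1

/-- The characteristic speeds `λ₋ = u - √(ε p'(ρ))` and `λ₊ = u + √(ε p'(ρ))`. -/
def charSpeed (ρs γ ε : ℝ) (k : Family) (A : ℝ × ℝ) : ℝ :=
  vel A + k.sign * √(ε * deriv (pressure ρs γ) A.1)

/-- Rankine-Hugoniot conditions `[q] = σ[ρ]`, `[q²/ρ + ε p(ρ)] = σ[q]`. -/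
def RankineHugoniot (ρs γ ε : ℝ) (A B : ℝ × ℝ) (σ : ℝ) : Prop :=
  B.2 - A.2 = σ * (B.1 - A.1) ∧
    (B.2 ^ 2 / B.1 + ε * pressure ρs γ B.1) - (A.2 ^ 2 / A.1 + ε * pressure ρs γ A.1)
      = σ * (B.2 - A.2)

/-- An entropic shock of family `k` with left state `A`, right state `B` and speed `σ`: the velocity
decreases, the density increases from left to right across a shock of the first family and
decreases across a shock of the second family. -/
def IsEntropicShock (ρs γ ε : ℝ) (k : Family) (A B : ℝ × ℝ) (σ : ℝ) : Prop :=
  A.1 ∈ Ioo 0 ρs ∧ B.1 ∈ Ioo 0 ρs ∧ RankineHugoniot ρs γ ε A B σ ∧ vel B < vel A ∧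
    match k with
    | .one => A.1 < B.1
    | .two => B.1 < A.1

/-- A rarefaction wave of family `k` from `A` to `B`, occupying `a ≤ x / t ≤ b`: the profile is
continuous, its values lie on one integral curve `u ∓ √ε P(ρ) = const` (where `P` is an
antiderivative of `√(p'(ρ)) / ρ`), and the `k`-th characteristic speed at `s` is `s`.
The density is positive inside the wave; one end may be vacuum. -/
def IsRarefaction (ρs γ ε : ℝ) (k : Family) (A B : ℝ × ℝ) (a b : ℝ) (U : ℝ → ℝ × ℝ) : Prop :=
  a < b ∧ ContinuousOn U (Icc a b) ∧ U a = A ∧ U b = B ∧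
    (∀ s ∈ Ioo a b, (U s).1 ∈ Ioo 0 ρs ∧ charSpeed ρs γ ε k (U s) = s) ∧
    ∀ s ∈ Ioo a b, ∀ s' ∈ Ioo a b,
      vel (U s') - vel (U s) =
        k.sign * √ε * ∫ r in (U s).1..(U s').1, √(deriv (pressure ρs γ) r) / r

/-- The profile `U` has a (possibly absent) wave of family `k` from `A` to `B` on `[a, b]`. -/
def IsElementaryWave (ρs γ ε : ℝ) (k : Family) (A B : ℝ × ℝ) (a b : ℝ) (U : ℝ → ℝ × ℝ) : Prop :=
  (a = b ∧ A = B) ∨ (a = b ∧ IsEntropicShock ρs γ ε k A B a) ∨ IsRarefaction ρs γ ε k A B a b U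

/-- `(ρ, q)(x, t) = U (x / t)` is the solution, for positive times, of the Riemann problem with left
state `L` and right state `R`: a wave of the first family from `L` to an intermediate state `M`
(which may be vacuum), then a wave of the second family from `M` to `R`, separated by constant
states. At a jump the value is the one on the right. -/
def IsRiemannSolution (ρs γ ε : ℝ) (L R : ℝ × ℝ) (U : ℝ → ℝ × ℝ) : Prop :=
  ∃ (M : ℝ × ℝ) (a₁ b₁ a₂ b₂ : ℝ), b₁ ≤ a₂ ∧
    IsElementaryWave ρs γ ε .one L M a₁ b₁ U ∧ IsElementaryWave ρs γ ε .two M R a₂ b₂ U ∧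
    (∀ s, s < a₁ → U s = L) ∧ (∀ s, b₁ ≤ s → s < a₂ → U s = M) ∧ (∀ s, b₂ ≤ s → U s = R)

/-! ### The limit system

`∂ₜρ + ∂ₓq = 0`, `∂ₜq + ∂ₓ(q²/ρ + p̄) = 0`, `(ρ - ρ*) p̄ = 0`. -/

/-- A state `(ρ, q, p̄)` of the limit system. -/
abbrev LimState := ℝ × ℝ × ℝ

/-- The density of a state of the limit system. -/
def LimState.dens (S : LimState) : ℝ := S.1

/-- The momentum of a state of the limit system. -/
def LimState.mom (S : LimState) : ℝ := S.2.1

/-- The limit pressure of a state of the limit system. -/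
def LimState.pres (S : LimState) : ℝ := S.2.2

/-- The constraints on a state: `0 ≤ ρ ≤ ρ*`, `p̄ ≥ 0`, `(ρ - ρ*) p̄ = 0`, no momentum at vacuum. -/
def IsLimState (ρs : ℝ) (S : LimState) : Prop :=
  0 ≤ S.dens ∧ S.dens ≤ ρs ∧ 0 ≤ S.pres ∧ (S.dens - ρs) * S.pres = 0 ∧ (S.dens = 0 → S.mom = 0)

/-- A contact wave: pressures agree, and the wave travels with the velocity of the adjacent
states (one of which may be vacuum). -/
def IsContact (A B : LimState) (σ : EReal) : Prop :=
  ∃ c : ℝ, σ = c ∧ A.pres = B.pres ∧ A.mom = c * A.dens ∧ B.mom = c * B.dens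

/-- A shock of finite speed: Rankine-Hugoniot conditions, and the velocity decreases. -/
def IsFiniteShock (A B : LimState) (σ : EReal) : Prop :=
  ∃ c : ℝ, σ = c ∧ 0 < A.dens ∧ 0 < B.dens ∧
    B.mom - A.mom = c * (B.dens - A.dens) ∧
    (B.mom ^ 2 / B.dens + B.pres) - (A.mom ^ 2 / A.dens + A.pres) = c * (B.mom - A.mom) ∧
    B.mom / B.dens < A.mom / A.dens

/-- A shock of infinite speed between two congested states: only the pressure may jump (this is
what the Rankine-Hugoniot conditions become for `σ = ±∞`). -/
def IsInfiniteShock (ρs : ℝ) (A B : LimState) (σ : EReal) : Prop :=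
  (σ = ⊥ ∨ σ = ⊤) ∧ A.dens = ρs ∧ B.dens = ρs ∧ A.mom = B.mom

/-- A declustering wave: a shock of infinite speed between two congested states such that the state
present at positive times (the one behind the wave) has zero pressure. -/
def IsDeclustering (ρs : ℝ) (A B : LimState) (σ : EReal) : Prop :=
  IsInfiniteShock ρs A B σ ∧ (σ = ⊥ → B.pres = 0) ∧ (σ = ⊤ → A.pres = 0)

/-- The kinds of waves of the limit system. -/
inductive WaveKind
  | declustering
  | contact
  | shock

/-- `A` on the left and `B` on the right are separated by a wave of the given kind and speed. -/
def IsLimWave (ρs : ℝ) (k : WaveKind) (A B : LimState) (σ : EReal) : Prop :=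
  match k with
  | .declustering => IsDeclustering ρs A B σ
  | .contact => IsContact A B σ
  | .shock => IsFiniteShock A B σ ∨ IsInfiniteShock ρs A B σ

/-- A fan of `n` waves: wave number `i` separates the states number `i` and `i + 1`. -/
structure WaveFan (n : ℕ) where
  /-- The constant states, from left to right. -/
  state : Fin (n + 1) → LimState
  /-- The kinds of the waves, from left to right. -/
  kind : Fin n → WaveKind
  /-- The wave speeds, possibly infinite. -/
  speed : Fin n → EReal

/-- The fan is a solution of the limit system made of states satisfying the constraints and waves
of the indicated kinds, with increasing speeds. -/
def WaveFan.IsSolution {n : ℕ} (W : WaveFan n) (ρs : ℝ) : Prop :=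
  (∀ i, IsLimState ρs (W.state i)) ∧ StrictMono W.speed ∧
    ∀ i : Fin n, IsLimWave ρs (W.kind i) (W.state i.castSucc) (W.state i.succ) (W.speed i)

/-- The self-similar functions `F ε` tend to the fan `W` as `ε → 0⁺`: the `i`-th wave is concentrated
in `front i ε ≤ x / t ≤ back i ε`, whose two ends tend in `[-∞, ∞]` to the `i`-th speed, and
between consecutive waves `F ε` tends uniformly to the corresponding state. -/
def ConvergesToFan {n : ℕ} (F : ℝ → ℝ → LimState) (W : WaveFan n) : Prop :=
  ∃ front back : Fin n → ℝ → ℝ,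
    (∀ i, Tendsto (fun ε => (front i ε : EReal)) (𝓝[>] 0) (𝓝 (W.speed i))) ∧
    (∀ i, Tendsto (fun ε => (back i ε : EReal)) (𝓝[>] 0) (𝓝 (W.speed i))) ∧
    (∀ i, ∀ᶠ ε in 𝓝[>] (0 : ℝ), front i ε ≤ back i ε) ∧
    ∀ i : Fin (n + 1), ∀ δ > 0, ∀ᶠ ε in 𝓝[>] (0 : ℝ), ∀ s : ℝ,
      (∀ j : Fin n, j.castSucc < i → back j ε ≤ s) →
      (∀ j : Fin n, i ≤ j.castSucc → s < front j ε) →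
      dist (F ε s) (W.state i) < δ

/-- The triple `(ρ, q, ε p(ρ))` along a profile. -/
def withPressure (ρs γ ε : ℝ) (U : ℝ → ℝ × ℝ) (s : ℝ) : LimState :=
  ((U s).1, (U s).2, ε * pressure ρs γ (U s).1)

/-- The limit as `ε → 0⁺` of the solutions of the Riemann problems with left states `L ε` and right
states `R ε` is the fan `W`: for small `ε` these problems are solvable, every choice of solutions
tends to `W`, and `W` is a solution of the limit system with waves of the indicated kinds. -/
def IsLimitOfRiemannSolutions {n : ℕ} (ρs γ : ℝ) (L R : ℝ → ℝ × ℝ) (W : WaveFan n) : Prop :=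
  (∀ᶠ ε in 𝓝[>] (0 : ℝ), ∃ U, IsRiemannSolution ρs γ ε (L ε) (R ε) U) ∧
    (∀ U : ℝ → ℝ → ℝ × ℝ,
      (∀ᶠ ε in 𝓝[>] (0 : ℝ), IsRiemannSolution ρs γ ε (L ε) (R ε) (U ε)) →
        ConvergesToFan (fun ε => withPressure ρs γ ε (U ε)) W) ∧
    W.IsSolution ρs

end Congestion

end

noncomputable section

namespace Congestion

variable {ρs γ ε : ℝ}

/-! In the excess volume `t = 1/ρ - 1/ρ*` the pressure is `t ^ (-γ)`, and a wave of the first family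
from `t₀` to `t` lowers the velocity by `velDrop γ ε t₀ t`: the root of `ε [p] [t]` for a shock,
minus `√ε` times the integral of the Lagrangian sound speed for a rarefaction. The reflection `x ↦
-x` reduces the second family to the first. Solvability (`exists_isRiemannSolution`) is the
intermediate value theorem for the sum of the two drops; if that sum always exceeds the velocity
difference, the Riemann invariants are bounded and both data rarefy to vacuum.

The limit rests on `TameData`: `√ε` times the variation of the invariant from a datum to any fixed
excess volume tends to zero. On the congested side this holds because the rescaled pressure stays
bounded (`tameData_of_congested`). So rarefactions alter the velocity by `o(1)` as long as the
excess volume stays bounded.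

If `ul ≤ ur`, the pressure of a nonvacuum intermediate state tends to zero
(`FanData.tendsto_pressure_zero`). Along a rarefaction `ε p = t (√ε c)² / γ`, with `c` the sound
speed, and a lower bound on the wave speed bounds `√ε c`; the congestion pressure is therefore
released at speeds tending to `-∞`. If moreover `ul < ur`, a nonvacuum intermediate state must tend
to vacuum (`FanData.tendsto_excess_middle`).

If `ur < ul`, vacuum is excluded. Each drop is at most `√(ε p) √t₀`, so the intermediate pressure is
bounded below (`FanData.exists_le_pressure`), which forces congestion. The left drop vanishes with
the left excess volume, so the right shock carries the whole velocity jump, and this fixes the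
pressure. The first wave, if present, has speed tending to `-∞` (`FanData.eventually_left_speed`).

Uniformity in `x / t` comes from `eventually_forall_of_ultrafilter`: it suffices to follow one point
`s ε` along an ultrafilter, where the kind of each wave and the position of `s ε` among the waves
are decided once and for all. -/

/-- The specific volume in excess of the congested one, `1/ρ - 1/ρ*`. -/
def excess (ρs ρ : ℝ) : ℝ := 1 / ρ - 1 / ρs

/-- The Lagrangian sound speed, as a function of the excess volume. -/
def sound (γ t : ℝ) : ℝ := √γ * t ^ (-(γ + 1) / 2)

/-- The variation of the Riemann invariant between two excess volumes. -/
def riem (γ a b : ℝ) : ℝ := ∫ t in a..b, sound γ t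


/-! ### Calculus in the excess volume: pressure, sound speed, Riemann invariant -/

lemma excess_pos {ρ : ℝ} (h : ρ ∈ Ioo 0 ρs) : 0 < excess ρs ρ :=
  sub_pos.2 (one_div_lt_one_div_of_lt h.1 h.2)

lemma one_div_eq_excess_add (ρs ρ : ℝ) : 1 / ρ = excess ρs ρ + 1 / ρs := by
  simp [excess]

lemma excess_lt_excess {ρ ρ' : ℝ} (h : 0 < ρ) (hρ : ρ < ρ') : excess ρs ρ' < excess ρs ρ :=
  sub_lt_sub_right (one_div_lt_one_div_of_lt h hρ) _

lemma excess_lt_excess_iff {ρ ρ' : ℝ} (h : 0 < ρ) (h' : 0 < ρ') :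
    excess ρs ρ' < excess ρs ρ ↔ ρ < ρ' := by
  rw [excess, excess, sub_lt_sub_iff_right, one_div_lt_one_div h' h]

lemma excess_inv (ρs t : ℝ) : excess ρs (1 / (t + 1 / ρs)) = t := by
  simp [excess]

lemma inv_mem_Ioo (hρs : 0 < ρs) {t : ℝ} (ht : 0 < t) : 1 / (t + 1 / ρs) ∈ Ioo 0 ρs := by
  have h : 0 < 1 / ρs := by positivity
  refine ⟨by positivity, ?_⟩
  rw [div_lt_comm₀ (by positivity) hρs]
  linarith

lemma dens_eq (ρs ρ : ℝ) : ρ = 1 / (excess ρs ρ + 1 / ρs) := by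
  simp [excess]

lemma pressure_eq {ρ : ℝ} (h : ρ ∈ Ioo 0 ρs) :
    pressure ρs γ ρ = excess ρs ρ ^ (-γ) := by
  rw [pressure, if_neg h.1.not_ge, Real.rpow_neg (excess_pos h).le, one_div, excess]

lemma hasDerivAt_excess {ρ : ℝ} (h : ρ ≠ 0) :
    HasDerivAt (excess ρs) (-(1 / ρ ^ 2)) ρ := by
  have h1 := (hasDerivAt_inv h).sub_const (1 / ρs)
  have h2 : excess ρs = fun x => x⁻¹ - 1 / ρs := by funext x; simp [excess]
  rw [h2]
  simpa [one_div] using h1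

lemma hasDerivAt_pressure {ρ : ℝ} (h : ρ ∈ Ioo 0 ρs) :
    HasDerivAt (pressure ρs γ) (γ * excess ρs ρ ^ (-γ - 1) * (1 / ρ ^ 2)) ρ := by
  have h1 := (hasDerivAt_excess (ρs := ρs) h.1.ne').rpow_const (p := -γ)
    (Or.inl (excess_pos h).ne')
  have h2 : HasDerivAt (fun r => excess ρs r ^ (-γ)) (γ * excess ρs ρ ^ (-γ - 1) * (1 / ρ ^ 2)) ρ := by
    convert h1 using 1; ring
  refine h2.congr_of_eventuallyEq ?_
  filter_upwards [isOpen_Ioo.mem_nhds h] with r hr using pressure_eq hr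

lemma sqrt_deriv_pressure (hγ : 0 < γ) {ρ : ℝ} (h : ρ ∈ Ioo 0 ρs) :
    √(deriv (pressure ρs γ) ρ) = sound γ (excess ρs ρ) / ρ := by
  have ht := excess_pos h
  rw [(hasDerivAt_pressure h).deriv, sound, Real.sqrt_eq_iff_mul_self_eq (by have := h.1; positivity)
    (by have := h.1; positivity)]
  have h3 : excess ρs ρ ^ (-γ - 1) = excess ρs ρ ^ (-(γ + 1) / 2) * excess ρs ρ ^ (-(γ + 1) / 2) := by
    rw [← Real.rpow_add ht]; congr 1; ring
  rw [h3]
  have h4 : √γ * √γ = γ := Real.mul_self_sqrt hγ.le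
  field_simp
  rw [Real.sq_sqrt hγ.le]

lemma sound_pos (hγ : 0 < γ) {t : ℝ} (ht : 0 < t) : 0 < sound γ t := by
  unfold sound; positivity

lemma sound_lt_sound (hγ : 0 < γ) {a b : ℝ} (ha : 0 < a) (hab : a < b) :
    sound γ b < sound γ a := by
  unfold sound
  have : 0 < √γ := by positivity
  exact mul_lt_mul_of_pos_left (Real.rpow_lt_rpow_of_neg ha hab (by linarith)) this

lemma sound_le_sound (hγ : 0 < γ) {a b : ℝ} (ha : 0 < a) (hab : a ≤ b) :
    sound γ b ≤ sound γ a := by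
  rcases hab.eq_or_lt with rfl | h
  · exact le_rfl
  · exact (sound_lt_sound hγ ha h).le

lemma sound_sq (hγ : 0 < γ) {t : ℝ} (ht : 0 < t) : sound γ t ^ 2 = γ * t ^ (-γ) / t := by
  unfold sound
  rw [mul_pow, Real.sq_sqrt hγ.le, ← Real.rpow_natCast, ← Real.rpow_mul ht.le, mul_div_assoc,
    ← Real.rpow_sub_one ht.ne']
  congr 2; push_cast; ring

lemma continuousOn_sound : ContinuousOn (sound γ) (Ioi 0) := by
  intro t ht
  exact (continuousAt_const.mul
    (Real.continuousAt_rpow_const _ _ (Or.inl (ne_of_gt ht)))).continuousWithinAt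

lemma uIcc_subset_Ioi {a b : ℝ} (ha : 0 < a) (hb : 0 < b) : uIcc a b ⊆ Ioi 0 :=
  fun _ hx => lt_of_lt_of_le (lt_min ha hb) hx.1

lemma intervalIntegrable_sound {a b : ℝ} (ha : 0 < a) (hb : 0 < b) :
    IntervalIntegrable (sound γ) MeasureTheory.volume a b :=
  (continuousOn_sound.mono (uIcc_subset_Ioi ha hb)).intervalIntegrable

lemma riem_self (a : ℝ) : riem γ a a = 0 := intervalIntegral.integral_same

lemma riem_add {a b c : ℝ} (ha : 0 < a) (hb : 0 < b) (hc : 0 < c) :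
    riem γ a b + riem γ b c = riem γ a c :=
  intervalIntegral.integral_add_adjacent_intervals (intervalIntegrable_sound ha hb)
    (intervalIntegrable_sound hb hc)

/-- The sound speed decreases with the volume, so its least value is at the right end. -/
lemma le_riem (hγ : 0 < γ) {a b : ℝ} (ha : 0 < a) (hab : a ≤ b) :
    sound γ b * (b - a) ≤ riem γ a b := by
  have hb := ha.trans_le hab
  have := intervalIntegral.integral_mono_on (f := fun _ => sound γ b) hab
    (intervalIntegrable_const) (intervalIntegrable_sound ha hb)
    (fun x hx => sound_le_sound hγ (ha.trans_le hx.1) hx.2)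
  simpa [riem, mul_comm] using this

lemma riem_nonneg (hγ : 0 < γ) {a b : ℝ} (ha : 0 < a) (hab : a ≤ b) : 0 ≤ riem γ a b :=
  (mul_nonneg (sound_pos hγ (ha.trans_le hab)).le (sub_nonneg.2 hab)).trans (le_riem hγ ha hab)

lemma riem_le_riem (hγ : 0 < γ) {a b c : ℝ} (ha : 0 < a) (hb : 0 < b) (hbc : b ≤ c) :
    riem γ a b ≤ riem γ a c := by
  rw [← riem_add ha hb (hb.trans_le hbc)]
  linarith [riem_nonneg hγ hb hbc]

lemma hasDerivAt_riem {a b : ℝ} (ha : 0 < a) (hb : 0 < b) :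
    HasDerivAt (riem γ a) (sound γ b) b := by
  refine intervalIntegral.integral_hasDerivAt_right (intervalIntegrable_sound ha hb) ?_
    (continuousOn_sound.continuousAt (Ioi_mem_nhds hb))
  exact continuousOn_sound.stronglyMeasurableAtFilter isOpen_Ioi _ hb

lemma continuousOn_riem {a : ℝ} (ha : 0 < a) : ContinuousOn (riem γ a) (Ioi 0) :=
  fun _ hb => (hasDerivAt_riem ha hb).continuousAt.continuousWithinAt

/-- Change of variable: `√(p') = c / ρ` and `dt = -dρ / ρ²`. From here on the density integral in
the definition of a rarefaction is replaced by `riem`. -/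
lemma integral_sqrt_deriv_pressure (hγ : 0 < γ) {ρ ρ' : ℝ} (h : ρ ∈ Ioo 0 ρs)
    (h' : ρ' ∈ Ioo 0 ρs) :
    ∫ r in ρ..ρ', √(deriv (pressure ρs γ) r) / r
      = -riem γ (excess ρs ρ) (excess ρs ρ') := by
  have hsub : uIcc ρ ρ' ⊆ Ioo 0 ρs := fun x hx =>
    ⟨lt_of_lt_of_le (lt_min h.1 h'.1) hx.1, lt_of_le_of_lt hx.2 (max_lt h.2 h'.2)⟩
  have hcongr : ∫ r in ρ..ρ', √(deriv (pressure ρs γ) r) / r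
      = ∫ r in ρ..ρ', sound γ (excess ρs r) * (1 / r ^ 2) := by
    refine intervalIntegral.integral_congr fun r hr => ?_
    simp only [sqrt_deriv_pressure hγ (hsub hr)]
    have := (hsub hr).1
    field_simp
  have hder : ∀ r ∈ uIcc ρ ρ', HasDerivAt (fun r => -riem γ (excess ρs ρ) (excess ρs r))
      (sound γ (excess ρs r) * (1 / r ^ 2)) r := fun r hr => by
    have h1 := ((hasDerivAt_riem (γ := γ) (excess_pos h) (excess_pos (hsub hr))).comp r
      (hasDerivAt_excess (ρs := ρs) (hsub hr).1.ne')).neg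
    exact h1.congr_deriv (by ring)
  have hcont : ContinuousOn (fun r => sound γ (excess ρs r) * (1 / r ^ 2)) (uIcc ρ ρ') := by
    intro r hr
    have h0 : r ≠ 0 := (hsub hr).1.ne'
    refine ContinuousAt.continuousWithinAt (ContinuousAt.mul ?_ ?_)
    · exact ContinuousAt.comp (g := sound γ) (continuousOn_sound.continuousAt (Ioi_mem_nhds (excess_pos (hsub hr))))
        (hasDerivAt_excess h0).continuousAt
    · exact continuousAt_const.div (by fun_prop) (by positivity)
  rw [hcongr, intervalIntegral.integral_eq_sub_of_hasDerivAt hder hcont.intervalIntegrable,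
    riem_self]
  ring

/-- The characteristic speed decreases with the density along a rarefaction curve. -/
lemma riem_sub_sound_lt (hγ : 0 < γ) (hρs : 0 < ρs) {a t t' : ℝ} (ha : 0 < a) (ht : 0 < t)
    (htt : t < t') :
    riem γ a t - sound γ t * (t + 1 / ρs) < riem γ a t' - sound γ t' * (t' + 1 / ρs) := by
  have h1 := le_riem hγ ht htt.le
  have h2 := riem_add (γ := γ) ha ht (ht.trans htt)
  have h3 := sound_lt_sound hγ ht htt
  have h4 : 0 < t + 1 / ρs := by positivity
  -- The invariant gains at least `c(t') (t' - t)`; what remains is `(c(t) - c(t')) (t + 1/ρ*) > 0`.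
  nlinarith [mul_pos (sub_pos.2 h3) h4]

lemma riem_sub_sound_le (hγ : 0 < γ) (hρs : 0 < ρs) {a t t' : ℝ} (ha : 0 < a) (ht : 0 < t)
    (htt : t ≤ t') :
    riem γ a t - sound γ t * (t + 1 / ρs) ≤ riem γ a t' - sound γ t' * (t' + 1 / ρs) := by
  rcases htt.eq_or_lt with rfl | h
  · exact le_rfl
  · exact (riem_sub_sound_lt hγ hρs ha ht h).le

lemma charSpeed_one (hγ : 0 < γ) (hε : 0 < ε) {A : ℝ × ℝ} (h : A.1 ∈ Ioo 0 ρs) :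
    charSpeed ρs γ ε .one A = vel A - √ε * (sound γ (excess ρs A.1) / A.1) := by
  rw [charSpeed, Real.sqrt_mul hε.le, sqrt_deriv_pressure hγ h, Family.sign]
  ring

/-- Near the congestion density the Riemann invariant is small compared with the root of the
pressure. -/
lemma riem_le (hγ : 0 < γ) {a b : ℝ} (ha : 0 < a) (hab : a ≤ b) :
    riem γ a b ≤ 2 * √γ * a ^ (-γ / 2) * √b := by
  have hb := ha.trans_le hab
  have hint : IntervalIntegrable (fun t : ℝ => √γ * a ^ (-γ / 2) * t ^ (-1 / 2 : ℝ))
      MeasureTheory.volume a b := by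
    refine ContinuousOn.intervalIntegrable fun t ht => ?_
    exact (continuousAt_const.mul (Real.continuousAt_rpow_const _ _
      (Or.inl (uIcc_subset_Ioi ha hb ht).ne'))).continuousWithinAt
  have h1 := intervalIntegral.integral_mono_on hab (intervalIntegrable_sound (γ := γ) ha hb) hint
    -- The integrand is split as `t ^ (-γ/2) * t ^ (-1/2)`: the first factor is bounded by its value
    -- at `a`, the second is integrated exactly.
    (fun t ht => by
      have ht0 := ha.trans_le ht.1
      have : t ^ (-(γ + 1) / 2) = t ^ (-γ / 2) * t ^ (-1 / 2 : ℝ) := by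
        rw [← Real.rpow_add ht0]; congr 1; ring
      rw [sound, this, mul_assoc]
      gcongr √γ * (?_ * _)
      exact Real.rpow_le_rpow_of_nonpos ha ht.1 (by linarith))
  refine h1.trans ?_
  rw [intervalIntegral.integral_const_mul, integral_rpow (Or.inl (by norm_num))]
  have e : (-1 / 2 + 1 : ℝ) = 1 / 2 := by norm_num
  rw [e, ← Real.sqrt_eq_rpow, ← Real.sqrt_eq_rpow]
  have : 0 ≤ √γ * a ^ (-γ / 2) := by positivity
  have h5 := Real.sqrt_nonneg a
  nlinarith [mul_nonneg this h5]

/-! ### Reflection, exchanging the two families -/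

/-- The image of a state under the reflection `x ↦ -x`. -/
def mirror (A : ℝ × ℝ) : ℝ × ℝ := (A.1, -A.2)

/-- The other characteristic family. -/
def Family.swap : Family → Family
  | .one => .two
  | .two => .one

lemma mirror_mirror (A : ℝ × ℝ) : mirror (mirror A) = A := by simp [mirror]

lemma vel_mirror (A : ℝ × ℝ) : vel (mirror A) = -vel A := by simp [vel, mirror, neg_div]

lemma Family.sign_swap (k : Family) : k.swap.sign = -k.sign := by
  cases k <;> simp [Family.swap, Family.sign]

lemma charSpeed_mirror (k : Family) (A : ℝ × ℝ) :
    charSpeed ρs γ ε k.swap (mirror A) = -charSpeed ρs γ ε k A := by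
  simp only [charSpeed, vel_mirror, Family.sign_swap]
  simp only [mirror]
  ring

lemma IsEntropicShock.mirror {k : Family} {A B : ℝ × ℝ} {σ : ℝ}
    (h : IsEntropicShock ρs γ ε k A B σ) :
    IsEntropicShock ρs γ ε k.swap (mirror B) (mirror A) (-σ) := by
  obtain ⟨hA, hB, ⟨h1, h2⟩, h3, h4⟩ := h
  refine ⟨hB, hA, ⟨?_, ?_⟩, ?_, ?_⟩
  · simp only [Congestion.mirror]; linarith
  · simp only [Congestion.mirror, neg_sq]; linarith
  · rw [vel_mirror, vel_mirror]; linarith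
  · cases k <;> exact h4

lemma IsRarefaction.mirror {k : Family} {A B : ℝ × ℝ} {a b : ℝ} {U : ℝ → ℝ × ℝ}
    (h : IsRarefaction ρs γ ε k A B a b U) :
    IsRarefaction ρs γ ε k.swap (mirror B) (mirror A) (-b) (-a)
      (fun s => mirror (U (-s))) := by
  obtain ⟨hab, hU, ha, hb, h1, h2⟩ := h
  have hneg : ∀ s ∈ Ioo (-b) (-a), -s ∈ Ioo a b := fun s hs =>
    ⟨by linarith [hs.2], by linarith [hs.1]⟩
  refine ⟨by linarith, ?_, ?_, ?_, fun s hs => ⟨?_, ?_⟩, fun s hs s' hs' => ?_⟩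
  · have hc : Continuous Congestion.mirror := by unfold Congestion.mirror; fun_prop
    refine hc.comp_continuousOn (hU.comp continuous_neg.continuousOn fun s hs => ?_)
    exact ⟨by linarith [hs.2], by linarith [hs.1]⟩
  · simp [hb]
  · simp [ha]
  · exact (h1 _ (hneg s hs)).1
  · rw [charSpeed_mirror, (h1 _ (hneg s hs)).2, neg_neg]
  · have := h2 _ (hneg s hs) _ (hneg s' hs')
    rw [vel_mirror, vel_mirror, Family.sign_swap]
    simp only [Congestion.mirror]
    linarith

lemma IsElementaryWave.mirror {k : Family} {A B : ℝ × ℝ} {a b : ℝ} {U : ℝ → ℝ × ℝ}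
    (h : IsElementaryWave ρs γ ε k A B a b U) :
    IsElementaryWave ρs γ ε k.swap (mirror B) (mirror A) (-b) (-a)
      (fun s => mirror (U (-s))) := by
  rcases h with ⟨h, h'⟩ | ⟨h, h'⟩ | h
  · exact Or.inl ⟨by rw [h], by rw [h']⟩
  · exact Or.inr (Or.inl ⟨by rw [h], h ▸ h'.mirror⟩)
  · exact Or.inr (Or.inr h.mirror)

/-! ### Waves of the first family in terms of the excess volume -/

/-- `A` is reached from `L` by a rarefaction of the first family, and `s` is its characteristic
speed. -/
structure OnRarefaction (ρs γ ε : ℝ) (L A : ℝ × ℝ) (s : ℝ) : Prop where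
  mem : A.1 ∈ Ioo 0 ρs
  le : excess ρs L.1 ≤ excess ρs A.1
  vel_eq : vel A = vel L + √ε * riem γ (excess ρs L.1) (excess ρs A.1)
  speed_eq : s = vel A - √ε * (sound γ (excess ρs A.1) / A.1)

lemma continuousAt_excess_fst {A : ℝ × ℝ} (h : A.1 ≠ 0) :
    ContinuousAt (fun B : ℝ × ℝ => excess ρs B.1) A :=
  ContinuousAt.comp (g := excess ρs) (hasDerivAt_excess h).continuousAt continuousAt_fst

lemma continuousAt_vel {A : ℝ × ℝ} (h : A.1 ≠ 0) : ContinuousAt vel A :=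
  continuousAt_snd.div continuousAt_fst h

lemma continuousAt_sound_excess {A : ℝ × ℝ} (h : A.1 ∈ Ioo 0 ρs) :
    ContinuousAt (fun B : ℝ × ℝ => sound γ (excess ρs B.1)) A :=
  ContinuousAt.comp (g := sound γ)
    (continuousOn_sound.continuousAt (Ioi_mem_nhds (excess_pos h)))
    (continuousAt_excess_fst h.1.ne')

lemma tendsto_sound_atTop (hγ : 0 < γ) : Tendsto (sound γ) atTop (𝓝 0) := by
  have h := (tendsto_rpow_neg_atTop (y := (γ + 1) / 2) (by linarith)).const_mul √γ
  rw [mul_zero] at h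
  exact h.congr fun t => by rw [sound]; congr 2; ring

lemma OnRarefaction.speed_eq' {L A : ℝ × ℝ} {s : ℝ} (h : OnRarefaction ρs γ ε L A s) :
    s = vel L + √ε * (riem γ (excess ρs L.1) (excess ρs A.1)
      - sound γ (excess ρs A.1) * (excess ρs A.1 + 1 / ρs)) := by
  rw [h.speed_eq, h.vel_eq, ← one_div_eq_excess_add]; ring

/-- This form of the momentum avoids the velocity, for which no bound is at hand near vacuum; it
shows that the momentum vanishes there. -/
lemma OnRarefaction.mom_eq {L A : ℝ × ℝ} {s : ℝ} (h : OnRarefaction ρs γ ε L A s) :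
    A.2 = s * A.1 + √ε * sound γ (excess ρs A.1) := by
  have h0 := h.mem.1.ne'
  rw [h.speed_eq, vel]
  field_simp
  ring

/-- The defining relations are imposed on the open interval only; continuity of the profile carries
them to the ends where the density is positive and subcritical. -/
lemma IsRarefaction.endpoint (hγ : 0 < γ) (hε : 0 < ε) {A B : ℝ × ℝ} {a b : ℝ} {U : ℝ → ℝ × ℝ}
    (h : IsRarefaction ρs γ ε .one A B a b U) {e : ℝ} (he : e ∈ Icc a b)
    (hE : (U e).1 ∈ Ioo 0 ρs) :
    e = vel (U e) - √ε * (sound γ (excess ρs (U e).1) / (U e).1) ∧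
      ∀ s ∈ Ioo a b, vel (U s)
        = vel (U e) + √ε * riem γ (excess ρs (U e).1) (excess ρs (U s).1) := by
  obtain ⟨hab, hU, -, -, h1, h2⟩ := h
  have hne : (𝓝[Ioo a b] e).NeBot := by
    rw [← mem_closure_iff_nhdsWithin_neBot, closure_Ioo hab.ne]; exact he
  have hT : Tendsto U (𝓝[Ioo a b] e) (𝓝 (U e)) :=
    (hU e he).mono_left (nhdsWithin_mono _ Ioo_subset_Icc_self)
  have hv := (continuousAt_vel hE.1.ne').tendsto.comp hT
  constructor
  · have hs := ((continuousAt_sound_excess (γ := γ) hE).div continuousAt_fst hE.1.ne').tendsto.comp hT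
    have h3 := hv.sub (hs.const_mul √ε)
    have h4 : Tendsto (fun s : ℝ => s) (𝓝[Ioo a b] e) (𝓝 e) := nhdsWithin_le_nhds
    refine tendsto_nhds_unique (h4.congr' ?_) h3
    filter_upwards [self_mem_nhdsWithin] with s hs
    have := (h1 s hs).2
    rw [charSpeed_one hγ hε (h1 s hs).1] at this
    exact this.symm
  · intro s hs
    have hr : Tendsto (fun s' => riem γ (excess ρs (U s).1) (excess ρs (U s').1))
        (𝓝[Ioo a b] e) (𝓝 (riem γ (excess ρs (U s).1) (excess ρs (U e).1))) :=
      (((continuousOn_riem (excess_pos (h1 s hs).1)).continuousAt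
        (Ioi_mem_nhds (excess_pos hE))).tendsto.comp
        ((continuousAt_excess_fst hE.1.ne').tendsto)).comp hT
    have h3 := hv.sub (hr.const_mul √ε)
    have h4 : Tendsto (fun _ : ℝ => vel (U s)) (𝓝[Ioo a b] e) (𝓝 (vel (U s))) := tendsto_const_nhds
    have h5 := tendsto_nhds_unique (h4.congr' ?_) h3
    · rw [h5]
      have := riem_add (γ := γ) (excess_pos hE) (excess_pos (h1 s hs).1) (excess_pos hE)
      rw [riem_self] at this
      linear_combination (-√ε) * this
    filter_upwards [self_mem_nhdsWithin] with s' hs'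
    have := h2 s hs s' hs'
    rw [integral_sqrt_deriv_pressure hγ (h1 s hs).1 (h1 s' hs').1, Family.sign] at this
    simp only [Function.comp_apply]
    linarith

lemma IsRarefaction.onRarefaction (hγ : 0 < γ) (hρs : 0 < ρs) (hε : 0 < ε) {L M : ℝ × ℝ} {a b : ℝ}
    {U : ℝ → ℝ × ℝ} (h : IsRarefaction ρs γ ε .one L M a b U) (hL : L.1 ∈ Ioo 0 ρs) :
    ∀ s ∈ Icc a b, (U s).1 ∈ Ioo 0 ρs → OnRarefaction ρs γ ε L (U s) s := by
  have hab := h.1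
  have ha : U a = L := h.2.2.1
  have h1 := h.2.2.2.2.1
  have hS : ∀ s ∈ Icc a b, (U s).1 ∈ Ioo 0 ρs →
      s = vel (U s) - √ε * (sound γ (excess ρs (U s).1) / (U s).1) :=
    fun s hs hs' => (h.endpoint hγ hε hs hs').1
  have hV0 := (h.endpoint hγ hε (left_mem_Icc.2 hab.le) (ha ▸ hL)).2
  have hV : ∀ s ∈ Icc a b, (U s).1 ∈ Ioo 0 ρs →
      vel (U s) = vel L + √ε * riem γ (excess ρs L.1) (excess ρs (U s).1) := by
    -- `endpoint` compares any point with an interior one, so `a` and `s` are compared through an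
    -- interior point `m`.
    intro s hs hs'
    obtain ⟨m, hm⟩ : (Ioo a b).Nonempty := nonempty_Ioo.2 hab
    have e1 := (h.endpoint hγ hε hs hs').2 m hm
    have e2 := hV0 m hm
    rw [ha] at e2
    have := riem_add (γ := γ) (excess_pos hL) (excess_pos hs') (excess_pos (h1 m hm).1)
    linear_combination e2 - e1 - √ε * this
  intro s hs hs'
  refine ⟨hs', ?_, hV s hs hs', hS s hs hs'⟩
  -- If the density exceeded that of `L`, monotonicity would make the characteristic speed at `s`
  -- smaller than the one at `a`, although `a ≤ s`.
  by_contra hlt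
  push Not at hlt
  have e1 := hS s hs hs'
  have e2 := hS a (left_mem_Icc.2 hab.le) (ha ▸ hL)
  rw [hV s hs hs', div_eq_mul_one_div, one_div_eq_excess_add ρs] at e1
  rw [ha, div_eq_mul_one_div, one_div_eq_excess_add ρs] at e2
  have e3 := riem_sub_sound_lt hγ hρs (excess_pos hL) (excess_pos hs') hlt
  rw [riem_self] at e3
  have := mul_lt_mul_of_pos_left e3 (Real.sqrt_pos.2 hε)
  linarith [hs.1]

/-- The density never exceeds that of `L`, so its value at the end is either positive, and the
relations extend to it, or zero. In the latter case the excess volume is unbounded near `b`, and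
`mom_eq` forces zero momentum. -/
lemma IsRarefaction.cases (hγ : 0 < γ) (hρs : 0 < ρs) (hε : 0 < ε) {L M : ℝ × ℝ} {a b : ℝ}
    {U : ℝ → ℝ × ℝ} (h : IsRarefaction ρs γ ε .one L M a b U) (hL : L.1 ∈ Ioo 0 ρs) :
    OnRarefaction ρs γ ε L M b ∨
      M = (0, 0) ∧ ∀ N, ∃ s ∈ Ioo a b, OnRarefaction ρs γ ε L (U s) s ∧ N < excess ρs (U s).1 := by
  have hO := h.onRarefaction hγ hρs hε hL
  obtain ⟨hab, hU, ha, hb, h1, -⟩ := h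
  have hne : (𝓝[Ioo a b] b).NeBot := by
    rw [← mem_closure_iff_nhdsWithin_neBot, closure_Ioo hab.ne]; exact right_mem_Icc.2 hab.le
  have hT : Tendsto U (𝓝[Ioo a b] b) (𝓝 M) :=
    hb ▸ (hU b (right_mem_Icc.2 hab.le)).mono_left (nhdsWithin_mono _ Ioo_subset_Icc_self)
  have hT1 : Tendsto (fun s => (U s).1) (𝓝[Ioo a b] b) (𝓝 M.1) :=
    (continuous_fst.tendsto M).comp hT
  have hle : M.1 ≤ L.1 := by
    refine le_of_tendsto hT1 ?_
    filter_upwards [self_mem_nhdsWithin] with s hs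
    have := (hO s (Ioo_subset_Icc_self hs) (h1 s hs).1).le
    by_contra hlt
    exact absurd (excess_lt_excess (ρs := ρs) hL.1 (not_le.1 hlt)) this.not_gt
  have hge : 0 ≤ M.1 := by
    refine ge_of_tendsto hT1 ?_
    filter_upwards [self_mem_nhdsWithin] with s hs using (h1 s hs).1.1.le
  rcases hge.eq_or_lt with h0 | h0
  · right
    have hexc : Tendsto (fun s => excess ρs (U s).1) (𝓝[Ioo a b] b) atTop := by
      have : Tendsto (fun s => (U s).1) (𝓝[Ioo a b] b) (𝓝[>] 0) := by
        refine tendsto_nhdsWithin_iff.2 ⟨h0 ▸ hT1, ?_⟩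
        filter_upwards [self_mem_nhdsWithin] with s hs using (h1 s hs).1.1
      have h2 := tendsto_atTop_add_const_right _ (-(1 / ρs)) (tendsto_inv_nhdsGT_zero.comp this)
      exact h2.congr fun s => by simp [excess, sub_eq_add_neg]
    refine ⟨Prod.ext h0.symm ?_, fun N => ?_⟩
    · have h2 : Tendsto (fun s => (U s).2) (𝓝[Ioo a b] b) (𝓝 M.2) :=
        (continuous_snd.tendsto M).comp hT
      have h3 : Tendsto (fun s : ℝ => s) (𝓝[Ioo a b] b) (𝓝 b) := nhdsWithin_le_nhds
      have h4 := (h3.mul hT1).add (((tendsto_sound_atTop hγ).comp hexc).const_mul √ε)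
      rw [← h0, mul_zero, mul_zero, add_zero] at h4
      refine tendsto_nhds_unique (h2.congr' ?_) h4
      filter_upwards [self_mem_nhdsWithin] with s hs
      exact (hO s (Ioo_subset_Icc_self hs) (h1 s hs).1).mom_eq
    · obtain ⟨s, hs, hs'⟩ := ((hexc.eventually_gt_atTop N).and self_mem_nhdsWithin).exists
      exact ⟨s, hs', hO s (Ioo_subset_Icc_self hs') (h1 s hs').1, hs⟩
  · left
    have := hO b (right_mem_Icc.2 hab.le) (hb ▸ ⟨h0, hle.trans_lt hL.2⟩)
    rwa [hb] at this

/-- The decrease of velocity across a wave of the first family, from the excess volume `t₀` on the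
left to `t` on the right. -/
def velDrop (γ ε t₀ t : ℝ) : ℝ :=
  if t ≤ t₀ then √(ε * (t ^ (-γ) - t₀ ^ (-γ)) * (t₀ - t)) else -(√ε * riem γ t₀ t)

/-- The mass flux through a shock. -/
def massFlux (γ ε t₀ t : ℝ) : ℝ := √(ε * (t ^ (-γ) - t₀ ^ (-γ)) / (t₀ - t))

lemma massFlux_mul {t₀ t : ℝ} (h : t < t₀) :
    massFlux γ ε t₀ t * (t₀ - t) = velDrop γ ε t₀ t := by
  have h' : 0 < t₀ - t := sub_pos.2 h
  rw [velDrop, if_pos h.le, massFlux]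
  nth_rw 2 [← Real.sqrt_sq h'.le]
  rw [← Real.sqrt_mul' _ (sq_nonneg _)]
  congr 1
  field_simp

lemma velDrop_self (t : ℝ) : velDrop γ ε t t = 0 := by simp [velDrop]

lemma massFlux_pos (hγ : 0 < γ) (hε : 0 < ε) {t₀ t : ℝ} (ht : 0 < t) (h : t < t₀) :
    0 < massFlux γ ε t₀ t :=
  Real.sqrt_pos.2 (div_pos (mul_pos hε (sub_pos.2 (Real.rpow_lt_rpow_of_neg ht h (by linarith))))
    (sub_pos.2 h))

lemma snd_eq_mul_vel {A : ℝ × ℝ} (h : A.1 ≠ 0) : A.2 = A.1 * vel A := by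
  rw [vel]; field_simp

lemma sq_div_eq {A : ℝ × ℝ} (h : A.1 ≠ 0) : A.2 ^ 2 / A.1 = A.1 * vel A ^ 2 := by
  rw [vel]; field_simp

/-- In the frame of the shock the mass flux `j = ρ (u - σ)` is continuous, and the jump conditions
become `[u] = j [1/ρ]` and `ε [p] = -j [u]`. Hence `j²` is `ε` times the absolute secant slope of
the pressure, and the sign of `j` comes from the entropy condition. -/
lemma IsEntropicShock.data {L M : ℝ × ℝ} {σ : ℝ}
    (h : IsEntropicShock ρs γ ε .one L M σ) :
    M.1 ∈ Ioo 0 ρs ∧ excess ρs M.1 < excess ρs L.1 ∧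
      vel M = vel L - velDrop γ ε (excess ρs L.1) (excess ρs M.1) ∧
      σ = vel L - massFlux γ ε (excess ρs L.1) (excess ρs M.1) / L.1 ∧
      σ = vel M - massFlux γ ε (excess ρs L.1) (excess ρs M.1) / M.1 := by
  obtain ⟨hL, hM, ⟨h1, h2⟩, h3, h4⟩ := h
  have hL0 := hL.1.ne'
  have hM0 := hM.1.ne'
  have ht : excess ρs M.1 < excess ρs L.1 := excess_lt_excess hL.1 h4
  have ht' := sub_pos.2 ht
  rw [pressure_eq hL, pressure_eq hM, sq_div_eq hL0, sq_div_eq hM0, snd_eq_mul_vel hL0,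
    snd_eq_mul_vel hM0] at h2
  rw [snd_eq_mul_vel hL0, snd_eq_mul_vel hM0] at h1
  set j := L.1 * (vel L - σ) with hj
  have hj' : j = M.1 * (vel M - σ) := by rw [hj]; linarith
  have e1 : vel L - σ = j / L.1 := by rw [hj]; field_simp
  have e2 : vel M - σ = j / M.1 := by rw [hj']; field_simp
  have e3 : vel L - vel M = j * (excess ρs L.1 - excess ρs M.1) := by
    have : excess ρs L.1 - excess ρs M.1 = 1 / L.1 - 1 / M.1 := by simp [excess]
    rw [this, mul_sub, mul_one_div, mul_one_div, ← e1, ← e2]; ring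
  have hjpos : 0 < j := by
    by_contra hneg
    have := mul_nonpos_of_nonpos_of_nonneg (not_lt.1 hneg) ht'.le
    linarith
  have e4 : ε * (excess ρs M.1 ^ (-γ) - excess ρs L.1 ^ (-γ)) = j * (vel L - vel M) := by
    have : j * (vel L - vel M) = L.1 * (vel L - σ) * vel L - M.1 * (vel M - σ) * vel M := by
      rw [← hj', ← hj]; ring
    rw [this]; linarith
  have e5 : massFlux γ ε (excess ρs L.1) (excess ρs M.1) = j := by
    rw [massFlux, e4, e3, Real.sqrt_eq_iff_mul_self_eq (by positivity) hjpos.le]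
    field_simp
  refine ⟨hM, ht, ?_, ?_, ?_⟩
  · rw [← massFlux_mul ht, e5]; linarith
  · rw [e5]; linarith
  · rw [e5]; linarith

lemma isEntropicShock_of_massFlux (hγ : 0 < γ) (hε : 0 < ε) {L M : ℝ × ℝ}
    (hL : L.1 ∈ Ioo 0 ρs) (hM : M.1 ∈ Ioo 0 ρs)
    (ht : excess ρs M.1 < excess ρs L.1)
    (hv : vel M = vel L - velDrop γ ε (excess ρs L.1) (excess ρs M.1)) :
    IsEntropicShock ρs γ ε .one L M
      (vel L - massFlux γ ε (excess ρs L.1) (excess ρs M.1) / L.1) := by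
  have hL0 := hL.1.ne'
  have hM0 := hM.1.ne'
  have ht' := sub_pos.2 ht
  have hjpos := massFlux_pos hγ hε (excess_pos hM) ht
  rw [← massFlux_mul ht] at hv
  have hsq : massFlux γ ε (excess ρs L.1) (excess ρs M.1) ^ 2 * (excess ρs L.1 - excess ρs M.1)
      = ε * (excess ρs M.1 ^ (-γ) - excess ρs L.1 ^ (-γ)) := by
    rw [massFlux, Real.sq_sqrt]
    · field_simp
    · exact div_nonneg (mul_nonneg hε.le (sub_nonneg.2
        (Real.rpow_lt_rpow_of_neg (excess_pos hM) ht (by linarith)).le)) ht'.le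
  have hd : excess ρs L.1 - excess ρs M.1 = 1 / L.1 - 1 / M.1 := by simp [excess]
  refine ⟨hL, hM, ?_, ?_, (excess_lt_excess_iff hL.1 hM.1).1 ht⟩
  · rw [RankineHugoniot, pressure_eq hL, pressure_eq hM, sq_div_eq hL0, sq_div_eq hM0,
      snd_eq_mul_vel hL0, snd_eq_mul_vel hM0]
    set j := massFlux γ ε (excess ρs L.1) (excess ρs M.1)
    rw [hd] at hv hsq
    constructor
    · rw [hv]; field_simp; ring
    · have e : ε * excess ρs M.1 ^ (-γ)
          = ε * excess ρs L.1 ^ (-γ) + j ^ 2 * (1 / L.1 - 1 / M.1) := by linarith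
      rw [e, hv]; field_simp; ring
  · rw [hv]
    have := mul_pos hjpos ht'
    linarith

/-- A common description of the three kinds of waves. An absent wave can be placed at any speed,
hence the alternative `M = L`. Vacuum has no meaningful velocity; there `b` is bounded below by the
characteristic speed at every excess volume `N`, because that speed increases towards vacuum. -/
lemma IsElementaryWave.vel_eq (hγ : 0 < γ) (hρs : 0 < ρs) (hε : 0 < ε) {L M : ℝ × ℝ} {a b : ℝ}
    {U : ℝ → ℝ × ℝ} (h : IsElementaryWave ρs γ ε .one L M a b U) (hL : L.1 ∈ Ioo 0 ρs) :
    M.1 ∈ Ioo 0 ρs ∧ vel M = vel L - velDrop γ ε (excess ρs L.1) (excess ρs M.1) ∧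
        (M = L ∨ b ≤ vel M) ∨
      M = (0, 0) ∧ ∀ N, 0 < N → vel L + √ε * (riem γ (excess ρs L.1) N
        - sound γ N * (N + 1 / ρs)) ≤ b := by
  rcases h with ⟨-, rfl⟩ | ⟨rfl, h⟩ | h
  · left; exact ⟨hL, by simp [velDrop_self], Or.inl rfl⟩
  · obtain ⟨hM, ht, h1, h2, h3⟩ := h.data
    refine Or.inl ⟨hM, h1, Or.inr ?_⟩
    have := div_nonneg (massFlux_pos hγ hε (excess_pos hM) ht).le hM.1.le
    linarith
  · rcases h.cases hγ hρs hε hL with h' | ⟨h1, h2⟩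
    · left
      refine ⟨h'.mem, ?_, Or.inr ?_⟩
      · rw [h'.vel_eq]
        rcases h'.le.eq_or_lt with e | e
        · rw [← e, velDrop_self, riem_self]; ring
        · rw [velDrop, if_neg e.not_ge]; ring
      · rw [h'.speed_eq]
        have := div_nonneg (sound_pos hγ (excess_pos h'.mem)).le h'.mem.1.le
        have := mul_nonneg (Real.sqrt_nonneg ε) this
        linarith
    · refine Or.inr ⟨h1, fun N hN => ?_⟩
      obtain ⟨s, hs, hO, hlt⟩ := h2 N
      have := riem_sub_sound_le hγ hρs (excess_pos hL) hN hlt.le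
      have := mul_le_mul_of_nonneg_left this (Real.sqrt_nonneg ε)
      have := hO.speed_eq'
      linarith [hs.2]

/-! ### Construction of the waves -/

/-- A rarefaction profile is the inverse of the map from density to characteristic speed. -/
lemma exists_inverse_of_strictAntiOn {h : ℝ → ℝ} {x y : ℝ} (hxy : x < y)
    (hc : ContinuousOn h (Icc x y)) (hm : StrictAntiOn h (Icc x y)) :
    ∃ g : ℝ → ℝ, ContinuousOn g (Icc (h y) (h x)) ∧ MapsTo g (Icc (h y) (h x)) (Icc x y) ∧
      g (h y) = y ∧ g (h x) = x ∧ ∀ s ∈ Ioo (h y) (h x), g s ∈ Ioo x y ∧ h (g s) = s := by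
  have hx : x ∈ Icc x y := left_mem_Icc.2 hxy.le
  have hy : y ∈ Icc x y := right_mem_Icc.2 hxy.le
  have hsurj : SurjOn h (Icc x y) (Icc (h y) (h x)) := intermediate_value_Icc' hxy.le hc
  have hinj := hm.injOn
  set g := Function.invFunOn h (Icc x y)
  have hl : ∀ r ∈ Icc x y, g (h r) = r := fun r hr => hinj.leftInvOn_invFunOn hr
  have hr : ∀ s ∈ Icc (h y) (h x), h (g s) = s := hsurj.rightInvOn_invFunOn
  have hmaps : MapsTo g (Icc (h y) (h x)) (Icc x y) := hsurj.mapsTo_invFunOn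
  refine ⟨g, ?_, hmaps, hl y hy, hl x hx, fun s hs => ?_⟩
  -- The preimage of a closed set under `g` is the image under `h` of a compact set.
  · rw [continuousOn_iff_isClosed]
    intro C hC
    have hK : IsCompact (h '' (Icc x y ∩ C)) :=
      (isCompact_Icc.inter_right hC).image_of_continuousOn (hc.mono inter_subset_left)
    refine ⟨_, hK.isClosed, Set.ext fun s => ⟨fun hs => ?_, fun hs => ?_⟩⟩
    · exact ⟨⟨g s, ⟨hmaps hs.2, hs.1⟩, hr s hs.2⟩, hs.2⟩
    · obtain ⟨⟨r, hr', rfl⟩, hs2⟩ := hs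
      exact ⟨by rw [mem_preimage, hl r hr'.1]; exact hr'.2, hs2⟩
  · have hs' := Ioo_subset_Icc_self hs
    have h1 := hmaps hs'
    have h2 := hr s hs'
    refine ⟨⟨h1.1.lt_of_ne fun e => ?_, h1.2.lt_of_ne fun e => ?_⟩, h2⟩
    · rw [← e] at h2; exact hs.2.ne h2.symm
    · rw [e] at h2; exact hs.1.ne h2

/-- The formulas for speed and momentum are required only off the end `r`, where continuity alone is
assumed; `r = 0` is thereby allowed, and the same construction covers rarefactions to vacuum. -/
lemma exists_isRarefaction (hγ : 0 < γ) (hρs : 0 < ρs) (hε : 0 < ε) {L : ℝ × ℝ}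
    (hL : L.1 ∈ Ioo 0 ρs) {r : ℝ} (hr0 : 0 ≤ r) (hr : r < L.1) {h m : ℝ → ℝ}
    (hc : ContinuousOn h (Icc r L.1)) (mc : ContinuousOn m (Icc r L.1))
    (hh : ∀ x ∈ Ioc r L.1, h x = vel L + √ε * (riem γ (excess ρs L.1) (excess ρs x)
      - sound γ (excess ρs x) * (excess ρs x + 1 / ρs)))
    (hm : ∀ x ∈ Ioc r L.1, m x = x * (vel L + √ε * riem γ (excess ρs L.1) (excess ρs x))) :
    ∃ a V, IsRarefaction ρs γ ε .one L (r, m r) a (h r) V := by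
  have hIoo : ∀ x ∈ Ioc r L.1, x ∈ Ioo 0 ρs := fun x hx =>
    ⟨hr0.trans_lt hx.1, hx.2.trans_lt hL.2⟩
  have hanti' : ∀ x ∈ Ioc r L.1, ∀ y ∈ Ioc r L.1, x < y → h y < h x := by
    intro x hx y hy hxy
    rw [hh x hx, hh y hy]
    have h1 := riem_sub_sound_lt hγ hρs (excess_pos hL) (excess_pos (hIoo y hy))
      (excess_lt_excess (hIoo x hx).1 hxy)
    have := mul_lt_mul_of_pos_left h1 (Real.sqrt_pos.2 hε)
    linarith
  have hanti : StrictAntiOn h (Icc r L.1) := by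
    intro x hx y hy hxy
    have hy' : y ∈ Ioc r L.1 := ⟨hx.1.trans_lt hxy, hy.2⟩
    rcases hx.1.eq_or_lt with rfl | hrx
    -- No formula is available at `r`; the strict inequality is obtained at an intermediate `z`, and
    -- `h z ≤ h r` by letting the argument decrease to `r`.
    · obtain ⟨z, hz1, hz2⟩ := exists_between hxy
      have hz : z ∈ Ioc r L.1 := ⟨hz1, hz2.le.trans hy.2⟩
      refine (hanti' z hz y hy' hz2).trans_le ?_
      have hT : Tendsto h (𝓝[>] r) (𝓝 (h r)) := by
        have := (hc r ⟨le_rfl, hr.le⟩).mono_left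
          (nhdsWithin_mono r (Ioc_subset_Icc_self (a := r) (b := L.1)))
        rwa [nhdsWithin_Ioc_eq_nhdsGT hr] at this
      refine ge_of_tendsto hT ?_
      filter_upwards [Ioo_mem_nhdsGT hz1] with w hw
      exact (hanti' w ⟨hw.1, hw.2.le.trans hz.2⟩ z hz hw.2).le
    · exact hanti' x ⟨hrx, hx.2⟩ y hy' hxy
  obtain ⟨g, hg, hgm, hgy, hgx, hgi⟩ := exists_inverse_of_strictAntiOn hr hc hanti
  have hLmem : L.1 ∈ Ioc r L.1 := ⟨hr, le_rfl⟩
  have hvel : ∀ x ∈ Ioc r L.1, vel (x, m x)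
      = vel L + √ε * riem γ (excess ρs L.1) (excess ρs x) := fun x hx => by
    have := (hIoo x hx).1.ne'
    simp only [vel, hm x hx]
    field_simp
  refine ⟨h L.1, fun s => (g s, m (g s)), hanti (left_mem_Icc.2 hr.le) (right_mem_Icc.2 hr.le) hr,
    hg.prodMk (mc.comp hg hgm), ?_, ?_, fun s hs => ?_, fun s hs s' hs' => ?_⟩
  · simp only [hgy]
    refine Prod.ext rfl ?_
    simp only [hm _ hLmem, riem_self, mul_zero, add_zero]
    exact (snd_eq_mul_vel hL.1.ne').symm
  · simp only [hgx]
  · have hx := Ioo_subset_Ioc_self (hgi s hs).1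
    have h2 := (hgi s hs).2
    refine ⟨hIoo _ hx, ?_⟩
    rw [charSpeed_one hγ hε (hIoo _ hx), hvel _ hx]
    rw [hh _ hx, ← one_div_eq_excess_add] at h2
    rw [div_eq_mul_one_div]
    linarith
  · have hx := Ioo_subset_Ioc_self (hgi s hs).1
    have hx' := Ioo_subset_Ioc_self (hgi s' hs').1
    rw [hvel _ hx, hvel _ hx', integral_sqrt_deriv_pressure hγ (hIoo _ hx) (hIoo _ hx'),
      Family.sign, ← riem_add (excess_pos hL) (excess_pos (hIoo _ hx)) (excess_pos (hIoo _ hx'))]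
    ring

lemma continuousAt_riem_excess {t r : ℝ} (ht : 0 < t) (hr : r ∈ Ioo 0 ρs) :
    ContinuousAt (fun x => riem γ t (excess ρs x)) r :=
  ContinuousAt.comp (g := riem γ t)
    ((continuousOn_riem ht).continuousAt (Ioi_mem_nhds (excess_pos hr)))
    (hasDerivAt_excess hr.1.ne').continuousAt

lemma continuousAt_rarefaction_speed {t r : ℝ} (ht : 0 < t) (hr : r ∈ Ioo 0 ρs) :
    ContinuousAt (fun x => riem γ t (excess ρs x)
      - sound γ (excess ρs x) * (excess ρs x + 1 / ρs)) r := by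
  have h1 := (hasDerivAt_excess (ρs := ρs) hr.1.ne').continuousAt
  exact (continuousAt_riem_excess ht hr).sub
    ((ContinuousAt.comp (g := sound γ)
      (continuousOn_sound.continuousAt (Ioi_mem_nhds (excess_pos hr))) h1).mul
      (h1.add continuousAt_const))

/-- Every excess volume is reached by a wave of the first family. -/
lemma exists_wave_one (hγ : 0 < γ) (hρs : 0 < ρs) (hε : 0 < ε) {L : ℝ × ℝ}
    (hL : L.1 ∈ Ioo 0 ρs) {r : ℝ} (hr : r ∈ Ioo 0 ρs) {u : ℝ}
    (hu : u = vel L - velDrop γ ε (excess ρs L.1) (excess ρs r)) :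
    ∃ a b V, b < u ∧ IsElementaryWave ρs γ ε .one L (r, r * u) a b V := by
  have hv : vel (r, r * u) = u := by
    have := hr.1.ne'
    simp only [vel]; field_simp
  rcases lt_trichotomy r L.1 with h | rfl | h
  · have hlt := excess_lt_excess (ρs := ρs) hr.1 h
    obtain ⟨a, V, hV⟩ := exists_isRarefaction hγ hρs hε hL hr.1.le h
      (h := fun x => vel L + √ε * (riem γ (excess ρs L.1) (excess ρs x)
        - sound γ (excess ρs x) * (excess ρs x + 1 / ρs)))
      (m := fun x => x * (vel L + √ε * riem γ (excess ρs L.1) (excess ρs x)))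
      (fun x hx => (continuousAt_const.add (continuousAt_const.mul
        (continuousAt_rarefaction_speed (excess_pos hL)
          ⟨hr.1.trans_le hx.1, hx.2.trans_lt hL.2⟩))).continuousWithinAt)
      (fun x hx => (continuousAt_id.mul (continuousAt_const.add (continuousAt_const.mul
        (continuousAt_riem_excess (excess_pos hL)
          ⟨hr.1.trans_le hx.1, hx.2.trans_lt hL.2⟩)))).continuousWithinAt)
      (fun _ _ => rfl) (fun _ _ => rfl)
    have hu' : u = vel L + √ε * riem γ (excess ρs L.1) (excess ρs r) := by
      rw [hu, velDrop, if_neg hlt.not_ge]; ring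
    rw [← hu'] at hV
    refine ⟨a, _, V, ?_, Or.inr (Or.inr hV)⟩
    have h1 : 0 < sound γ (excess ρs r) * (excess ρs r + 1 / ρs) := by
      have := sound_pos hγ (excess_pos hr)
      have := excess_pos hr
      positivity
    have := mul_pos (Real.sqrt_pos.2 hε) h1
    simp only [mul_sub]
    linarith
  · rw [velDrop_self, sub_zero] at hu
    -- The position of an absent wave is free; any value below `u` would do.
    refine ⟨u - 1, u - 1, fun _ => L, by linarith, Or.inl ⟨rfl, ?_⟩⟩
    rw [hu, ← snd_eq_mul_vel hr.1.ne']
  · have hlt := excess_lt_excess (ρs := ρs) hL.1 h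
    have hs := isEntropicShock_of_massFlux (M := (r, r * u)) hγ hε hL hr hlt (by rw [hv, hu])
    refine ⟨_, _, fun _ => L, ?_, Or.inr (Or.inl ⟨rfl, hs⟩)⟩
    obtain ⟨-, -, -, -, h5⟩ := hs.data
    rw [h5, hv]
    have : 0 < massFlux γ ε (excess ρs L.1) (excess ρs r) / r :=
      div_pos (massFlux_pos hγ hε (excess_pos hr) hlt) hr.1
    simp only
    linarith

/-- If the Riemann invariant is bounded, there is a rarefaction of the first family to vacuum. -/
lemma exists_rarefaction_to_vacuum (hγ : 0 < γ) (hρs : 0 < ρs) (hε : 0 < ε) {L : ℝ × ℝ}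
    (hL : L.1 ∈ Ioo 0 ρs) {w : ℝ} (hw : Tendsto (riem γ (excess ρs L.1)) atTop (𝓝 w)) :
    ∃ a V, IsRarefaction ρs γ ε .one L (0, 0) a (vel L + √ε * w) V := by
  have hL' := excess_pos hL
  -- Convergence of the invariant makes its variation over `[t/2, t]` small, and that variation is
  -- at least `c(t) t / 2`.
  have hzero : Tendsto (fun t => sound γ t * (t + 1 / ρs)) atTop (𝓝 0) := by
    have h1 : Tendsto (fun t => riem γ (excess ρs L.1) t - riem γ (excess ρs L.1) (t / 2))
        atTop (𝓝 0) := by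
      simpa using hw.sub (hw.comp (tendsto_id.atTop_div_const two_pos))
    have h2 := (h1.const_mul 2).add ((tendsto_sound_atTop hγ).mul_const (1 / ρs))
    rw [mul_zero, zero_mul, add_zero] at h2
    refine squeeze_zero' ?_ ?_ h2
    · filter_upwards [eventually_gt_atTop 0] with t ht
      have := sound_pos hγ ht
      positivity
    · filter_upwards [eventually_gt_atTop 0] with t ht
      have h3 := le_riem hγ (half_pos ht) (half_le_self ht.le)
      rw [← riem_add hL' (half_pos ht) ht]
      linarith
  have hexc : Tendsto (excess ρs) (𝓝[Icc 0 L.1 \ {0}] 0) atTop := by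
    have h1 : Tendsto (excess ρs) (𝓝[>] 0) atTop := by
      refine (tendsto_atTop_add_const_right _ (-(1 / ρs)) tendsto_inv_nhdsGT_zero).congr fun s => ?_
      simp [excess, sub_eq_add_neg]
    exact h1.mono_left (nhdsWithin_mono _ fun x hx => hx.1.1.lt_of_ne fun e => hx.2 e.symm)
  have hcpos : ∀ x ∈ Icc 0 L.1, x ≠ 0 → x ∈ Ioo 0 ρs := fun x hx h0 =>
    ⟨hx.1.lt_of_ne h0.symm, hx.2.trans_lt hL.2⟩
  set f : ℝ → ℝ := fun x => vel L + √ε * (riem γ (excess ρs L.1) (excess ρs x)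
        - sound γ (excess ρs x) * (excess ρs x + 1 / ρs))
  have hc : ContinuousOn (Function.update f 0 (vel L + √ε * w)) (Icc 0 L.1) := by
    intro x hx
    rcases eq_or_ne x 0 with rfl | h0
    · rw [continuousWithinAt_update_same]
      have := ((hw.sub hzero).comp hexc).const_mul √ε
      rw [sub_zero] at this
      exact this.const_add _
    · rw [continuousWithinAt_update_of_ne h0]
      exact (continuousAt_const.add (continuousAt_const.mul
        (continuousAt_rarefaction_speed hL' (hcpos x hx h0)))).continuousWithinAt
  have mc : ContinuousOn (fun x => x * (vel L + √ε * riem γ (excess ρs L.1) (excess ρs x)))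
      (Icc 0 L.1) := by
    intro x hx
    rcases eq_or_ne x 0 with rfl | h0
    · rw [← continuousWithinAt_sdiff_self]
      have h1 := ((hw.comp hexc).const_mul √ε).const_add (vel L)
      have h2 : Tendsto (fun x : ℝ => x) (𝓝[Icc 0 L.1 \ {0}] 0) (𝓝 0) := nhdsWithin_le_nhds
      have h3 := h2.mul h1
      rw [zero_mul] at h3
      rw [ContinuousWithinAt, zero_mul]
      exact h3
    · exact (continuousAt_id.mul (continuousAt_const.add (continuousAt_const.mul
        (continuousAt_riem_excess hL' (hcpos x hx h0))))).continuousWithinAt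
  obtain ⟨a, V, hV⟩ := exists_isRarefaction hγ hρs hε hL le_rfl hL.1 hc mc
    (fun x hx => Function.update_of_ne hx.1.ne' _ _) (fun _ _ => rfl)
  simp only [Function.update_self, zero_mul] at hV
  exact ⟨a, V, hV⟩

/-- Clamping `t` at `t₀` merges the two branches into one formula whose continuity is evident. -/
lemma velDrop_eq {t₀ : ℝ} (t : ℝ) : velDrop γ ε t₀ t
    = √(ε * ((min t t₀) ^ (-γ) - t₀ ^ (-γ)) * (t₀ - min t t₀)) - √ε * riem γ t₀ (max t t₀) := by
  rcases le_or_gt t t₀ with h | h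
  · simp [velDrop, h, riem_self]
  · simp [velDrop, h.not_ge, h.le]

lemma continuousOn_velDrop {t₀ : ℝ} (ht₀ : 0 < t₀) :
    ContinuousOn (velDrop γ ε t₀) (Ioi 0) := by
  rw [show velDrop γ ε t₀ = _ from funext fun t => velDrop_eq t]
  intro t ht
  refine ContinuousAt.continuousWithinAt ?_
  have hmin : ContinuousAt (fun t => min t t₀) t := by fun_prop
  refine ContinuousAt.sub ?_ (continuousAt_const.mul ?_)
  · refine Real.continuous_sqrt.continuousAt.comp ((continuousAt_const.mul
      ((hmin.rpow_const (Or.inl (lt_min ht ht₀).ne')).sub continuousAt_const)).mul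
      (continuousAt_const.sub hmin))
  · exact ContinuousAt.comp (g := riem γ t₀) (f := fun t => max t t₀)
      ((continuousOn_riem ht₀).continuousAt (Ioi_mem_nhds (lt_max_of_lt_left ht)))
      (by fun_prop)

lemma velDrop_ge (hγ : 0 < γ) {t₀ t N : ℝ} (ht₀ : 0 < t₀) (ht : 0 < t) (htN : t ≤ N)
    (h : t₀ ≤ N) : -(√ε * riem γ t₀ N) ≤ velDrop γ ε t₀ t := by
  rw [velDrop]
  split_ifs with h'
  · exact (neg_nonpos.2 (mul_nonneg (Real.sqrt_nonneg _) (riem_nonneg hγ ht₀ h))).trans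
      (Real.sqrt_nonneg _)
  · exact neg_le_neg (mul_le_mul_of_nonneg_left (riem_le_riem hγ ht₀ ht htN) (Real.sqrt_nonneg _))

lemma exists_le_velDrop (hγ : 0 < γ) (hε : 0 < ε) {t₀ : ℝ} (ht₀ : 0 < t₀) (X : ℝ) :
    ∀ᶠ t in 𝓝[>] (0 : ℝ), X ≤ velDrop γ ε t₀ t := by
  -- The threshold is such that, for `t < t₀ / 2`, the quantity under the root is at least `X²`.
  have h1 := (tendsto_rpow_neg_nhdsGT_zero (neg_lt_zero.2 hγ)).eventually_ge_atTop
    (t₀ ^ (-γ) + X ^ 2 * 2 / (t₀ * ε))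
  filter_upwards [h1, Ioo_mem_nhdsGT (half_pos ht₀)] with t ht ht'
  rw [velDrop, if_pos (ht'.2.le.trans (half_le_self ht₀.le))]
  refine Real.le_sqrt_of_sq_le ?_
  have h2 : X ^ 2 = ε * (X ^ 2 * 2 / (t₀ * ε)) * (t₀ / 2) := by field_simp
  rw [h2]
  have h3 : 0 ≤ X ^ 2 * 2 / (t₀ * ε) := by positivity
  gcongr ε * ?_ * ?_
  · exact mul_nonneg hε.le (by linarith)
  · linarith
  · linarith [ht'.2]

lemma IsElementaryWave.le {k : Family} {A B : ℝ × ℝ} {a b : ℝ} {U : ℝ → ℝ × ℝ}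
    (h : IsElementaryWave ρs γ ε k A B a b U) : a ≤ b := by
  rcases h with ⟨h, -⟩ | ⟨h, -⟩ | h
  exacts [h.le, h.le, h.1.le]

lemma IsRarefaction.congr {k : Family} {A B : ℝ × ℝ} {a b : ℝ} {U V : ℝ → ℝ × ℝ}
    (h : IsRarefaction ρs γ ε k A B a b V) (hUV : ∀ s ∈ Icc a b, U s = V s) :
    IsRarefaction ρs γ ε k A B a b U := by
  obtain ⟨hab, hV, ha, hb, h1, h2⟩ := h
  have hIoo : ∀ s ∈ Ioo a b, U s = V s := fun s hs => hUV s (Ioo_subset_Icc_self hs)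
  refine ⟨hab, hV.congr hUV, ?_, ?_, fun s hs => ?_, fun s hs s' hs' => ?_⟩
  · rw [hUV a (left_mem_Icc.2 hab.le), ha]
  · rw [hUV b (right_mem_Icc.2 hab.le), hb]
  · rw [hIoo s hs]; exact h1 s hs
  · rw [hIoo s hs, hIoo s' hs']; exact h2 s hs s' hs'

/-- Where the two waves touch, the glued profile takes its value from the second one; it must equal
`M` there for the first wave to end properly, whence the condition on `V₂ a₂`. -/
lemma exists_isRiemannSolution_of_waves {L M R : ℝ × ℝ} {a₁ b₁ a₂ b₂ : ℝ}
    {V₁ V₂ : ℝ → ℝ × ℝ} (h₁ : IsElementaryWave ρs γ ε .one L M a₁ b₁ V₁)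
    (h₂ : IsElementaryWave ρs γ ε .two M R a₂ b₂ V₂)
    (h : b₁ < a₂ ∨ b₁ = a₂ ∧ a₂ < b₂ ∧ V₂ a₂ = M) :
    ∃ U, IsRiemannSolution ρs γ ε L R U := by
  have hle : b₁ ≤ a₂ := h.elim le_of_lt fun h => h.1.le
  have hab₁ := h₁.le
  have hab₂ := h₂.le
  set U : ℝ → ℝ × ℝ := fun s =>
    if s < a₁ then L else if s < b₁ then V₁ s else if s < a₂ then M else if s < b₂ then V₂ s else R
    with hU
  refine ⟨U, M, a₁, b₁, a₂, b₂, hle, ?_, ?_, fun s hs => ?_, fun s hs hs' => ?_, fun s hs => ?_⟩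
  · rcases h₁ with h₁ | h₁ | h₁
    · exact Or.inl h₁
    · exact Or.inr (Or.inl h₁)
    · refine Or.inr (Or.inr (h₁.congr fun s hs => ?_))
      rcases hs.2.eq_or_lt with rfl | hs'
      · rw [h₁.2.2.2.1, hU]
        simp only [hs.1.not_gt, lt_irrefl, if_false]
        rcases h with h | ⟨rfl, h, h'⟩
        · simp [h]
        · simp [h, h']
      · simp [hU, hs.1.not_gt, hs']
  · rcases h₂ with h₂ | h₂ | h₂
    · exact Or.inl h₂
    · exact Or.inr (Or.inl h₂)
    · refine Or.inr (Or.inr (h₂.congr fun s hs => ?_))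
      have e1 : ¬ s < a₁ := by linarith [hs.1]
      have e2 : ¬ s < b₁ := by linarith [hs.1]
      rcases hs.2.eq_or_lt with rfl | hs'
      · rw [h₂.2.2.2.1]
        simp [hU, e1, e2, hs.1.not_gt]
      · simp [hU, e1, e2, hs.1.not_gt, hs']
  · simp [hU, hs]
  · simp [hU, (hab₁.trans hs).not_gt, hs.not_gt, hs']
  · simp [hU, hs.not_gt, (hab₂.trans hs).not_gt, (hle.trans (hab₂.trans hs)).not_gt,
      (hab₁.trans (hle.trans (hab₂.trans hs))).not_gt]

lemma exists_tendsto_riem (hγ : 0 < γ) {t₀ B : ℝ} (ht₀ : 0 < t₀)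
    (hB : ∀ t, t₀ ≤ t → riem γ t₀ t ≤ B) : ∃ w, Tendsto (riem γ t₀) atTop (𝓝 w) := by
  have hmono : Monotone fun t => riem γ t₀ (max t t₀) := fun t t' h =>
    riem_le_riem hγ ht₀ (lt_max_of_lt_right ht₀) (max_le_max_right _ h)
  have hbdd : BddAbove (range fun t => riem γ t₀ (max t t₀)) :=
    ⟨B, by rintro _ ⟨t, rfl⟩; exact hB _ (le_max_right _ _)⟩
  refine ⟨_, (tendsto_atTop_ciSup hmono hbdd).congr' ?_⟩
  filter_upwards [eventually_ge_atTop t₀] with t ht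
  rw [max_eq_left ht]

/-- The Riemann problem between states with positive subcritical densities is solvable. -/
lemma exists_isRiemannSolution (hγ : 0 < γ) (hρs : 0 < ρs) (hε : 0 < ε) {L R : ℝ × ℝ}
    (hL : L.1 ∈ Ioo 0 ρs) (hR : R.1 ∈ Ioo 0 ρs) : ∃ U, IsRiemannSolution ρs γ ε L R U := by
  have hl := excess_pos hL
  have hr := excess_pos hR
  set tl := excess ρs L.1
  set tr := excess ρs R.1
  have hR' : (mirror R).1 ∈ Ioo 0 ρs := hR
  -- The total drop exceeds any bound as `t → 0`. If it is somewhere at most the required velocity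
  -- difference, the intermediate value theorem applies; otherwise the invariants are bounded and a
  -- vacuum opens.
  by_cases hG : ∃ t, 0 < t ∧ velDrop γ ε tl t + velDrop γ ε tr t ≤ vel L - vel R
  · obtain ⟨t₁, ht₁, h₁⟩ := hG
    obtain ⟨t₂, ht₂, h₂⟩ : ∃ t, 0 < t ∧ vel L - vel R ≤ velDrop γ ε tl t + velDrop γ ε tr t := by
      obtain ⟨t, ht, h, h'⟩ := ((exists_le_velDrop hγ hε hl (vel L - vel R)).and
        ((exists_le_velDrop hγ hε hr 0).and self_mem_nhdsWithin)).exists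
      exact ⟨t, h', by linarith⟩
    obtain ⟨t, ht, e⟩ := isPreconnected_Ioi.intermediate_value (mem_Ioi.2 ht₁) (mem_Ioi.2 ht₂)
      ((continuousOn_velDrop (ε := ε) hl).add (continuousOn_velDrop hr)) ⟨h₁, h₂⟩
    have ht := mem_Ioi.1 ht
    have hmem := inv_mem_Ioo hρs ht
    set r := 1 / (t + 1 / ρs)
    have hrt : excess ρs r = t := excess_inv ρs t
    obtain ⟨a₁, b₁, V₁, hb₁, hw₁⟩ := exists_wave_one hγ hρs hε hL hmem
      (u := vel L - velDrop γ ε tl t) (by rw [hrt])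
    obtain ⟨a₂, b₂, V₂, hb₂, hw₂⟩ := exists_wave_one hγ hρs hε hR' hmem
      (u := -(vel L - velDrop γ ε tl t)) (by
        rw [hrt, vel_mirror, show excess ρs (mirror R).1 = tr from rfl]
        simp only [Pi.add_apply] at e
        linarith)
    have hw₂' := hw₂.mirror
    rw [mirror_mirror] at hw₂'
    have hM : mirror (r, r * -(vel L - velDrop γ ε tl t)) = (r, r * (vel L - velDrop γ ε tl t)) := by
      simp only [mirror]; ring_nf
    rw [hM] at hw₂'
    exact exists_isRiemannSolution_of_waves hw₁ hw₂' (Or.inl (by linarith))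
  · push Not at hG
    have hlarge : ∀ t, tl ≤ t → tr ≤ t → √ε * (riem γ tl t + riem γ tr t) ≤ vel R - vel L := by
      intro t h h'
      have hdrop : ∀ t₀, t₀ ≤ t → velDrop γ ε t₀ t = -(√ε * riem γ t₀ t) := by
        intro t₀ h
        rcases h.eq_or_lt with rfl | h
        · simp [velDrop_self, riem_self]
        · rw [velDrop, if_neg h.not_ge]
      have := hG t (hl.trans_le h)
      rw [hdrop _ h, hdrop _ h'] at this
      linarith
    have hsε := Real.sqrt_pos.2 hε
    obtain ⟨w, hw⟩ : ∃ w, Tendsto (riem γ tl) atTop (𝓝 w) := by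
      refine exists_tendsto_riem hγ hl (B := (vel R - vel L) / √ε) fun t ht => ?_
      refine (riem_le_riem hγ hl (hl.trans_le ht) (le_max_left t tr)).trans ?_
      rw [le_div_iff₀ hsε]
      have h1 := hlarge (max t tr) (ht.trans (le_max_left _ _)) (le_max_right _ _)
      have h2 := mul_nonneg hsε.le (riem_nonneg hγ hr (le_max_right t tr))
      linarith
    have hw' : Tendsto (riem γ tr) atTop (𝓝 (riem γ tr tl + w)) := by
      refine (hw.const_add (riem γ tr tl)).congr' ?_
      filter_upwards [eventually_gt_atTop 0] with t ht using riem_add hr hl ht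
    obtain ⟨a₁, V₁, h₁⟩ := exists_rarefaction_to_vacuum hγ hρs hε hL hw
    obtain ⟨a₂, V₂, h₂⟩ := exists_rarefaction_to_vacuum hγ hρs hε hR' hw'
    have h₂' := h₂.mirror
    rw [mirror_mirror, show mirror (0, 0) = (0, 0) by simp [mirror]] at h₂'
    -- The standing inequality, passed to the limit of infinite volume, orders the two edges of the
    -- vacuum. Equality is possible, and then the two rarefactions touch at vacuum.
    have hle : vel L + √ε * w ≤ -(vel (mirror R) + √ε * (riem γ tr tl + w)) := by
      have h3 : √ε * (w + (riem γ tr tl + w)) ≤ vel R - vel L := by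
        refine le_of_tendsto ((hw.add hw').const_mul √ε) ?_
        filter_upwards [eventually_ge_atTop tl, eventually_ge_atTop tr] with t using hlarge t
      rw [vel_mirror]
      linarith
    refine exists_isRiemannSolution_of_waves (Or.inr (Or.inr h₁)) (Or.inr (Or.inr h₂')) ?_
    rcases hle.lt_or_eq with h | h
    · exact Or.inl h
    · exact Or.inr ⟨h, h₂'.1, h₂'.2.2.1⟩

/-! ### From convergence at moving points to convergence of fans -/

/-- If the uniform statement fails, a bad `s` can be chosen for frequently many `ε`, and some
ultrafilter is concentrated on these `ε`. -/
lemma eventually_forall_of_ultrafilter {C Q : ℝ → ℝ → Prop}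
    (h : ∀ (l : Ultrafilter ℝ) (s : ℝ → ℝ), (l : Filter ℝ) ≤ 𝓝[>] 0 →
      (∀ᶠ ε in (l : Filter ℝ), C ε (s ε)) → ∀ᶠ ε in (l : Filter ℝ), Q ε (s ε)) :
    ∀ᶠ ε in 𝓝[>] (0 : ℝ), ∀ s, C ε s → Q ε s := by
  by_contra hne
  have h1 : ∃ᶠ ε in 𝓝[>] (0 : ℝ), ∃ s, C ε s ∧ ¬ Q ε s :=
    (not_eventually.1 hne).mono fun ε hε => by push Not at hε; exact hε
  classical
  set s : ℝ → ℝ := fun ε => if hs : ∃ s, C ε s ∧ ¬ Q ε s then hs.choose else 0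
  have h2 : ∃ᶠ ε in 𝓝[>] (0 : ℝ), C ε (s ε) ∧ ¬ Q ε (s ε) :=
    h1.mono fun ε hε => by simp only [s, dif_pos hε]; exact hε.choose_spec
  have hne : (𝓝[>] (0 : ℝ) ⊓ 𝓟 {ε | C ε (s ε) ∧ ¬ Q ε (s ε)}).NeBot :=
    frequently_mem_iff_neBot.1 h2
  set l := Ultrafilter.of (𝓝[>] (0 : ℝ) ⊓ 𝓟 {ε | C ε (s ε) ∧ ¬ Q ε (s ε)})
  have hl : (l : Filter ℝ) ≤ _ := Ultrafilter.of_le _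
  have h3 : ∀ᶠ ε in (l : Filter ℝ), C ε (s ε) ∧ ¬ Q ε (s ε) :=
    hl.trans inf_le_right (mem_principal_self _)
  have h4 := h l s (hl.trans inf_le_left) (h3.mono fun _ h => h.1)
  obtain ⟨ε, h5, h6⟩ := (h3.and h4).exists
  exact h5.2 h6

/-- A property that holds eventually for every positive parameter holds eventually for a parameter
that tends to zero. -/
lemma exists_tendsto_zero_of_forall_eventually {P : ℝ → ℝ → Prop}
    (hmono : ∀ δ δ' ε, δ ≤ δ' → 0 < δ → P δ ε → P δ' ε)
    (h : ∀ δ > 0, ∀ᶠ ε in 𝓝[>] (0 : ℝ), P δ ε) :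
    ∃ η : ℝ → ℝ, Tendsto η (𝓝[>] 0) (𝓝 0) ∧ ∀ᶠ ε in 𝓝[>] (0 : ℝ), 0 < η ε ∧ P (η ε) ε := by
  have hbdd : ∀ ε, BddBelow {δ | 0 < δ ∧ P δ ε} := fun ε => ⟨0, fun δ h => h.1.le⟩
  have hnn : ∀ ε, 0 ≤ sInf {δ | 0 < δ ∧ P δ ε} := fun ε => Real.sInf_nonneg fun δ h => h.1.le
  have hid : Tendsto (fun ε : ℝ => ε) (𝓝[>] 0) (𝓝 0) := nhdsWithin_le_nhds
  -- The added `ε` makes the value positive and strictly larger than the infimum, so that some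
  -- admissible `δ` lies below it.
  refine ⟨fun ε => sInf {δ | 0 < δ ∧ P δ ε} + ε, ?_, ?_⟩
  · have : Tendsto (fun ε => sInf {δ | 0 < δ ∧ P δ ε}) (𝓝[>] 0) (𝓝 0) := by
      rw [Metric.tendsto_nhds]
      intro δ hδ
      filter_upwards [h (δ / 2) (half_pos hδ)] with ε hε
      rw [Real.dist_0_eq_abs, abs_of_nonneg (hnn ε)]
      have := csInf_le (hbdd ε) ⟨half_pos hδ, hε⟩
      linarith
    simpa using this.add hid
  · filter_upwards [h 1 one_pos, self_mem_nhdsWithin] with ε h1 hε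
    have hε : 0 < ε := hε
    refine ⟨by linarith [hnn ε], ?_⟩
    obtain ⟨δ, hδ, hlt⟩ := exists_lt_of_csInf_lt (s := {δ | 0 < δ ∧ P δ ε}) ⟨1, one_pos, h1⟩
      (lt_add_of_pos_right _ hε)
    exact hmono δ _ ε hlt.le hδ.1 hδ.2

/-- A criterion for the convergence to a fan whose first wave has the speed `-∞`. -/
lemma convergesToFan_of_eventually {n : ℕ} {F : ℝ → ℝ → LimState} {W : WaveFan (n + 1)}
    {c : Fin n → ℝ} {G : ℝ → LimState} (h0 : W.speed 0 = ⊥) (hc : ∀ i : Fin n, W.speed i.succ = c i)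
    (hG : Tendsto G (𝓝[>] 0) (𝓝 (W.state 0)))
    (hF : ∀ᶠ ε in 𝓝[>] (0 : ℝ), ∃ a, ∀ s < a, F ε s = G ε)
    (H : ∀ δ > 0, ∀ᶠ ε in 𝓝[>] (0 : ℝ), ∀ s, -1 / δ ≤ s → ∀ i : Fin (n + 1),
      (∀ j : Fin n, j.castSucc < i → c j + δ ≤ s) → (∀ j : Fin n, i ≤ j.castSucc → s < c j - δ) →
      dist (F ε s) (W.state i.succ) < δ) :
    ConvergesToFan F W := by
  obtain ⟨η, hη, hηP⟩ := exists_tendsto_zero_of_forall_eventually (by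
    intro δ δ' ε hδ hpos hP s hs i h1 h2
    refine (hP s (le_trans ?_ hs) i (fun j hj => ?_) fun j hj => ?_).trans_le hδ
    · rw [neg_div, neg_div, neg_le_neg_iff]
      exact one_div_le_one_div_of_le hpos hδ
    · linarith [h1 j hj]
    · linarith [h2 j hj]) H
  obtain ⟨a, ha⟩ := hF.choice
  have hη0 : Tendsto η (𝓝[>] 0) (𝓝[>] 0) :=
    tendsto_nhdsWithin_iff.2 ⟨hη, hηP.mono fun _ h => h.1⟩
  have hbot : Tendsto (fun ε => -1 / η ε) (𝓝[>] 0) atBot := by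
    have := tendsto_neg_atTop_atBot.comp (tendsto_inv_nhdsGT_zero.comp hη0)
    refine this.congr fun ε => ?_
    simp [neg_div]
  have hbotE : Tendsto (fun ε => ((-1 / η ε : ℝ) : EReal)) (𝓝[>] 0) (𝓝 ⊥) :=
    EReal.tendsto_coe_nhds_bot_iff.2 hbot
  have hminE : Tendsto (fun ε => ((min (a ε) (-1 / η ε) : ℝ) : EReal)) (𝓝[>] 0) (𝓝 ⊥) :=
    EReal.tendsto_coe_nhds_bot_iff.2 (tendsto_atBot_mono (fun ε => min_le_right _ _) hbot)
  -- Finite-speed waves are enclosed within `c j ± η`. The first one ends at `-1 / η` and starts no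
  -- later than `a`, to the left of which the solution is exactly the left datum.
  refine ⟨Fin.cons (fun ε => min (a ε) (-1 / η ε)) fun j ε => c j - η ε,
    Fin.cons (fun ε => -1 / η ε) fun j ε => c j + η ε, ?_, ?_, ?_, ?_⟩
  · refine Fin.cases ?_ fun j => ?_
    · simpa only [Fin.cons_zero, h0] using hminE
    · simp only [Fin.cons_succ, hc]
      refine EReal.tendsto_coe.2 ?_
      simpa using hη.const_sub (c j)
  · refine Fin.cases ?_ fun j => ?_
    · simpa only [Fin.cons_zero, h0] using hbotE
    · simp only [Fin.cons_succ, hc]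
      refine EReal.tendsto_coe.2 ?_
      simpa using hη.const_add (c j)
  · refine Fin.cases ?_ fun j => ?_
    · simp
    · filter_upwards [hηP] with ε hε
      simp only [Fin.cons_succ]
      linarith [hε.1]
  · refine Fin.cases ?_ fun i => ?_
    · intro δ hδ
      filter_upwards [ha, Metric.tendsto_nhds.1 hG δ hδ] with ε h1 h2 s _ h3
      have := h3 0 (by simp)
      rw [Fin.cons_zero] at this
      rw [h1 s (this.trans_le (min_le_left _ _))]
      exact h2
    · intro δ hδ
      filter_upwards [hηP, hη.eventually_lt_const hδ] with ε h1 h2 s h3 h4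
      refine (h1.2 s ?_ i (fun j hj => ?_) fun j hj => ?_).trans h2
      · have := h3 0 (by simp)
        rwa [Fin.cons_zero] at this
      · have := h3 j.succ (by rw [← Fin.succ_castSucc]; simpa using hj)
        rwa [Fin.cons_succ] at this
      · have := h4 j.succ (by rw [← Fin.succ_castSucc]; simpa using hj)
        rwa [Fin.cons_succ] at this

/-! ### Estimates for the pressure law -/

/-- One bound is Bernoulli's inequality, the other compares `x ^ γ` with `x`; their roles are
exchanged at `γ = 1`. -/
lemma min_mul_le_one_sub_rpow {x : ℝ} (hx : 0 < x) (hx1 : x < 1) (hγ : 0 < γ) :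
    min 1 γ * (1 - x) ≤ 1 - x ^ γ ∧ 1 - x ^ γ ≤ max 1 γ * (1 - x) := by
  rcases le_total 1 γ with h | h
  · rw [min_eq_left h, max_eq_right h]
    have h1 := one_add_mul_self_le_rpow_one_add (s := x - 1) (by linarith) h
    have h2 := Real.rpow_le_rpow_of_exponent_ge hx hx1.le h
    rw [Real.rpow_one] at h2
    rw [add_sub_cancel] at h1
    exact ⟨by linarith, by linarith⟩
  · rw [min_eq_right h, max_eq_left h]
    have h1 := rpow_one_add_le_one_add_mul_self (s := x - 1) (by linarith) hγ.le h
    have h2 := Real.rpow_le_rpow_of_exponent_ge hx hx1.le h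
    rw [Real.rpow_one] at h2
    rw [add_sub_cancel] at h1
    exact ⟨by linarith, by linarith⟩

/-- By homogeneity only `t / t₀` matters. The squared mass flux is thus comparable to `ε t ^ (-γ) /
t₀`: the upper bound controls right shocks, the lower bound drives left shocks to `-∞`. -/
lemma secant_bounds (hγ : 0 < γ) {t t₀ : ℝ} (ht : 0 < t) (h : t < t₀) :
    min 1 γ * t ^ (-γ) / t₀ ≤ (t ^ (-γ) - t₀ ^ (-γ)) / (t₀ - t) ∧
      (t ^ (-γ) - t₀ ^ (-γ)) / (t₀ - t) ≤ max 1 γ * t ^ (-γ) / t₀ := by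
  have ht₀ := ht.trans h
  have hx : 0 < t / t₀ := div_pos ht ht₀
  have hx1 : t / t₀ < 1 := (div_lt_one ht₀).2 h
  have e1 : t₀ ^ (-γ) = t ^ (-γ) * (t / t₀) ^ γ := by
    rw [Real.div_rpow ht.le ht₀.le, Real.rpow_neg ht.le, Real.rpow_neg ht₀.le]
    have := (Real.rpow_pos_of_pos ht γ).ne'
    field_simp
  have e2 : (t ^ (-γ) - t₀ ^ (-γ)) / (t₀ - t)
      = t ^ (-γ) / t₀ * ((1 - (t / t₀) ^ γ) / (1 - t / t₀)) := by
    rw [e1]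
    have : t₀ - t ≠ 0 := (sub_pos.2 h).ne'
    have : 1 - t / t₀ ≠ 0 := (sub_pos.2 hx1).ne'
    field_simp
  have hpos : 0 ≤ t ^ (-γ) / t₀ := by positivity
  obtain ⟨h1, h2⟩ := min_mul_le_one_sub_rpow hx hx1 hγ
  rw [e2]
  constructor
  · calc min 1 γ * t ^ (-γ) / t₀ = t ^ (-γ) / t₀ * min 1 γ := by ring
      _ ≤ _ := mul_le_mul_of_nonneg_left ((le_div_iff₀ (sub_pos.2 hx1)).2 h1) hpos
  · calc _ ≤ t ^ (-γ) / t₀ * max 1 γ :=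
          mul_le_mul_of_nonneg_left ((div_le_iff₀ (sub_pos.2 hx1)).2 h2) hpos
      _ = _ := by ring

/-- Read one way, a velocity drop requires pressure; read the other way, a wave from a nearly
congested state at bounded pressure has a small drop. -/
lemma velDrop_le (hγ : 0 < γ) (hε : 0 < ε) {t₀ t : ℝ} (ht₀ : 0 < t₀) (ht : 0 < t) :
    velDrop γ ε t₀ t ≤ √(ε * t ^ (-γ)) * √t₀ := by
  rw [velDrop]
  split_ifs with h
  · rw [← Real.sqrt_mul (by positivity)]
    refine Real.sqrt_le_sqrt ?_
    have h1 : 0 ≤ t ^ (-γ) - t₀ ^ (-γ) :=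
      sub_nonneg.2 (Real.rpow_le_rpow_of_nonpos ht h (by linarith))
    have h2 : 0 ≤ t₀ ^ (-γ) := by positivity
    gcongr
    · linarith
    · linarith
  · exact (neg_nonpos.2 (mul_nonneg (Real.sqrt_nonneg _)
      (riem_nonneg hγ ht₀ (not_le.1 h).le))).trans (by positivity)

/-- Data depending on `ε → 0⁺` with converging velocities, whose Riemann invariants, multiplied by
`√ε`, become negligible. -/
structure TameData (ρs γ : ℝ) (l : Filter ℝ) (L : ℝ → ℝ × ℝ) (u₀ : ℝ) : Prop where
  le : l ≤ 𝓝[>] 0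
  mem : ∀ᶠ ε in l, (L ε).1 ∈ Ioo 0 ρs
  vel : Tendsto (fun ε => vel (L ε)) l (𝓝 u₀)
  bdd : ∃ C, ∀ᶠ ε in l, excess ρs (L ε).1 ≤ C
  riem : ∀ N, 0 < N → Tendsto (fun ε => √ε * riem γ (excess ρs (L ε).1) N) l (𝓝 0)

/-- The triple density, momentum, rescaled pressure of a state. -/
def limTriple (ρs γ ε : ℝ) (A : ℝ × ℝ) : LimState := (A.1, A.2, ε * pressure ρs γ A.1)

section

variable {l : Filter ℝ} {L A : ℝ → ℝ × ℝ} {s : ℝ → ℝ} {u₀ : ℝ}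

lemma TameData.mono {l' : Filter ℝ} (h : TameData ρs γ l L u₀) (hl : l' ≤ l) :
    TameData ρs γ l' L u₀ := by
  obtain ⟨C, hC⟩ := h.bdd
  exact ⟨hl.trans h.le, hl h.mem, h.vel.mono_left hl, ⟨C, hl hC⟩,
    fun N hN => (h.riem N hN).mono_left hl⟩

lemma TameData.mirror (h : TameData ρs γ l L u₀) :
    TameData ρs γ l (fun ε => mirror (L ε)) (-u₀) :=
  ⟨h.le, h.mem, by simpa only [vel_mirror] using h.vel.neg, h.bdd, h.riem⟩

lemma tendsto_id_of_le (hl : l ≤ 𝓝[>] 0) : Tendsto (fun ε : ℝ => ε) l (𝓝 0) :=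
  hl.trans nhdsWithin_le_nhds

lemma eventually_pos_of_le (hl : l ≤ 𝓝[>] 0) : ∀ᶠ ε in l, (0 : ℝ) < ε :=
  hl self_mem_nhdsWithin

lemma tendsto_sqrt_of_le (hl : l ≤ 𝓝[>] 0) : Tendsto (fun ε : ℝ => √ε) l (𝓝 0) := by
  simpa using (tendsto_id_of_le hl).sqrt

lemma TameData.lt_speed (h : TameData ρs γ l L u₀) {δ N : ℝ} (hδ : 0 < δ) (hN : 0 < N) :
    ∀ᶠ ε in l, u₀ - δ < Congestion.vel (L ε) + √ε * (Congestion.riem γ (excess ρs (L ε).1) N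
      - sound γ N * (N + 1 / ρs)) := by
  have h1 := h.vel.add ((h.riem N hN).sub
    ((tendsto_sqrt_of_le h.le).mul_const (sound γ N * (N + 1 / ρs))))
  rw [zero_mul, sub_zero, add_zero] at h1
  filter_upwards [h1.eventually_const_lt (sub_lt_self u₀ hδ)] with ε hε
  linarith

lemma TameData.vel_add_riem_lt (h : TameData ρs γ l L u₀) {δ N : ℝ} (hδ : 0 < δ) (hN : 0 < N) :
    ∀ᶠ ε in l, Congestion.vel (L ε) + √ε * Congestion.riem γ (excess ρs (L ε).1) N < u₀ + δ := by
  have h1 := h.vel.add (h.riem N hN)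
  rw [add_zero] at h1
  exact h1.eventually_lt_const (lt_add_of_pos_right u₀ hδ)

/-- At a fixed excess volume `N` the characteristic speed is eventually above `u₀ - δ`; by
monotonicity slower points have excess volume below `N`. -/
lemma tendsto_excess_zero (hγ : 0 < γ) (hρs : 0 < ρs) (h : TameData ρs γ l L u₀)
    (hA : ∀ᶠ ε in l, OnRarefaction ρs γ ε (L ε) (A ε) (s ε)) {δ : ℝ} (hδ : 0 < δ)
    (hs : ∀ᶠ ε in l, s ε ≤ u₀ - δ) : Tendsto (fun ε => excess ρs (A ε).1) l (𝓝 0) := by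
  refine tendsto_order.2 ⟨fun b hb => ?_, fun N hN => ?_⟩
  · filter_upwards [hA] with ε hε using hb.trans (excess_pos hε.mem)
  · filter_upwards [hA, hs, h.mem, h.lt_speed hδ hN] with ε h1 h2 h3 h4
    by_contra h5
    have h6 := riem_sub_sound_le hγ hρs (excess_pos h3) hN (not_lt.1 h5)
    have h7 := mul_le_mul_of_nonneg_left h6 (Real.sqrt_nonneg ε)
    have h8 := h1.speed_eq'
    linarith

lemma tendsto_vel_of_onRarefaction (hγ : 0 < γ) (h : TameData ρs γ l L u₀)
    (hA : ∀ᶠ ε in l, OnRarefaction ρs γ ε (L ε) (A ε) (s ε)) {C : ℝ} (hC : 0 < C)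
    (hAC : ∀ᶠ ε in l, excess ρs (A ε).1 ≤ C) :
    Tendsto (fun ε => Congestion.vel (A ε)) l (𝓝 u₀) := by
  have h1 := h.vel.add (h.riem C hC)
  rw [add_zero] at h1
  refine tendsto_of_tendsto_of_tendsto_of_le_of_le' h.vel h1 ?_ ?_
  · filter_upwards [hA, h.mem] with ε h2 h3
    rw [h2.vel_eq]
    have := mul_nonneg (Real.sqrt_nonneg ε) (riem_nonneg hγ (excess_pos h3) h2.le)
    linarith
  · filter_upwards [hA, h.mem, hAC] with ε h2 h3 h4
    rw [h2.vel_eq]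
    have := mul_le_mul_of_nonneg_left (riem_le_riem hγ (excess_pos h3) (excess_pos h2.mem) h4)
      (Real.sqrt_nonneg ε)
    linarith

/-- The declustering mechanism. Since `√ε c / ρ = u - s` is bounded above, so is `√ε c`, and `ε t ^
(-γ) = t (√ε c)² / γ` vanishes with `t`. -/
lemma tendsto_pressure_zero_of_onRarefaction (hγ : 0 < γ) (hρs : 0 < ρs) (hl : l ≤ 𝓝[>] 0)
    (hA : ∀ᶠ ε in l, OnRarefaction ρs γ ε (L ε) (A ε) (s ε)) {K : ℝ}
    (hs : ∀ᶠ ε in l, -K ≤ s ε) {u : ℝ} (hv : Tendsto (fun ε => Congestion.vel (A ε)) l (𝓝 u))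
    (ht : Tendsto (fun ε => excess ρs (A ε).1) l (𝓝 0)) :
    Tendsto (fun ε => ε * excess ρs (A ε).1 ^ (-γ)) l (𝓝 0) := by
  have h1 := (ht.mul_const (((K + (u + 1)) * ρs) ^ 2)).mul_const (1 / γ)
  rw [zero_mul, zero_mul] at h1
  refine squeeze_zero' ?_ ?_ h1
  · filter_upwards [hA, eventually_pos_of_le hl] with ε h2 h3
    have := excess_pos h2.mem
    positivity
  · filter_upwards [hA, eventually_pos_of_le hl, hs,
      hv.eventually_lt_const (lt_add_one u)] with ε h2 h3 h4 h5
    have ht := excess_pos h2.mem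
    have h6 := h2.speed_eq
    have hc := sound_pos hγ ht
    rw [div_eq_mul_one_div, one_div_eq_excess_add ρs] at h6
    have h7 : √ε * sound γ (excess ρs (A ε).1) * (1 / ρs) ≤ K + (u + 1) := by
      have : 0 ≤ √ε * sound γ (excess ρs (A ε).1) * excess ρs (A ε).1 := by positivity
      linarith
    have h8 : √ε * sound γ (excess ρs (A ε).1) ≤ (K + (u + 1)) * ρs := by
      rwa [mul_one_div, div_le_iff₀ hρs] at h7
    have h9 := pow_le_pow_left₀ (by positivity) h8 2
    rw [mul_pow, Real.sq_sqrt h3.le, sound_sq hγ ht] at h9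
    calc ε * excess ρs (A ε).1 ^ (-γ)
        = excess ρs (A ε).1 * (ε * (γ * excess ρs (A ε).1 ^ (-γ) / excess ρs (A ε).1))
          * (1 / γ) := by field_simp
      _ ≤ _ := by gcongr

/-- At bounded excess volume the velocity is below `u₀ + δ`, and the characteristic speed does not
exceed the velocity. -/
lemma tendsto_excess_atTop (hγ : 0 < γ) (h : TameData ρs γ l L u₀)
    (hA : ∀ᶠ ε in l, OnRarefaction ρs γ ε (L ε) (A ε) (s ε)) {δ : ℝ} (hδ : 0 < δ)
    (hs : ∀ᶠ ε in l, u₀ + δ ≤ s ε) : Tendsto (fun ε => excess ρs (A ε).1) l atTop := by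
  refine tendsto_atTop.2 fun N => ?_
  have hN : 0 < max N 1 := lt_max_of_lt_right one_pos
  filter_upwards [hA, hs, h.mem, h.vel_add_riem_lt hδ hN] with ε h1 h2 h3 h4
  refine (le_max_left N 1).trans ?_
  by_contra h5
  have h6 := mul_le_mul_of_nonneg_left (riem_le_riem hγ (excess_pos h3) (excess_pos h1.mem)
    (not_le.1 h5).le) (Real.sqrt_nonneg ε)
  have h7 := h1.speed_eq
  have h8 := h1.vel_eq
  have h9 : 0 ≤ √ε * (sound γ (excess ρs (A ε).1) / (A ε).1) :=
    mul_nonneg (Real.sqrt_nonneg ε) (div_nonneg (sound_pos hγ (excess_pos h1.mem)).le h1.mem.1.le)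
  linarith

lemma tendsto_dens_zero (ht : Tendsto (fun ε => excess ρs (A ε).1) l atTop) :
    Tendsto (fun ε => (A ε).1) l (𝓝 0) := by
  refine (tendsto_inv_atTop_zero.comp (tendsto_atTop_add_const_right _ (1 / ρs) ht)).congr
    fun ε => ?_
  simp [excess]

lemma tendsto_mom_zero_of_onRarefaction (hγ : 0 < γ) (hl : l ≤ 𝓝[>] 0)
    (hA : ∀ᶠ ε in l, OnRarefaction ρs γ ε (L ε) (A ε) (s ε)) {K : ℝ}
    (hs : ∀ᶠ ε in l, |s ε| ≤ K) (ht : Tendsto (fun ε => excess ρs (A ε).1) l atTop) :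
    Tendsto (fun ε => (A ε).2) l (𝓝 0) := by
  have h1 := tendsto_dens_zero ht
  have h2 : Tendsto (fun ε => s ε * (A ε).1) l (𝓝 0) := by
    have h3 := h1.abs.const_mul K
    rw [abs_zero, mul_zero] at h3
    refine squeeze_zero_norm' ?_ h3
    filter_upwards [hs] with ε hε
    rw [norm_mul, Real.norm_eq_abs, Real.norm_eq_abs]
    gcongr
  have h4 := h2.add ((tendsto_sqrt_of_le hl).mul ((tendsto_sound_atTop hγ).comp ht))
  rw [mul_zero, add_zero] at h4
  refine h4.congr' ?_
  filter_upwards [hA] with ε hε using hε.mom_eq.symm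

lemma tendsto_limTriple (hρs : 0 < ρs) (hA : ∀ᶠ ε in l, (A ε).1 ∈ Ioo 0 ρs) {t u p : ℝ}
    (ht0 : 0 ≤ t) (ht : Tendsto (fun ε => excess ρs (A ε).1) l (𝓝 t))
    (hv : Tendsto (fun ε => Congestion.vel (A ε)) l (𝓝 u))
    (hp : Tendsto (fun ε => ε * excess ρs (A ε).1 ^ (-γ)) l (𝓝 p)) :
    Tendsto (fun ε => limTriple ρs γ ε (A ε)) l
      (𝓝 (1 / (t + 1 / ρs), 1 / (t + 1 / ρs) * u, p)) := by
  have h0 : t + 1 / ρs ≠ 0 := by positivity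
  have h1 : Tendsto (fun ε => (A ε).1) l (𝓝 (1 / (t + 1 / ρs))) :=
    ((tendsto_const_nhds (x := (1 : ℝ))).div (ht.add_const (1 / ρs)) h0).congr
      fun ε => (dens_eq ρs (A ε).1).symm
  refine h1.prodMk_nhds (Tendsto.prodMk_nhds ?_ ?_)
  · refine (h1.mul hv).congr' ?_
    filter_upwards [hA] with ε hε using (snd_eq_mul_vel hε.1.ne').symm
  · refine hp.congr' ?_
    filter_upwards [hA] with ε hε
    rw [pressure_eq hε]

lemma tendsto_limTriple_congested (hρs : 0 < ρs) (hA : ∀ᶠ ε in l, (A ε).1 ∈ Ioo 0 ρs) {u p : ℝ}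
    (ht : Tendsto (fun ε => excess ρs (A ε).1) l (𝓝 0))
    (hv : Tendsto (fun ε => Congestion.vel (A ε)) l (𝓝 u))
    (hp : Tendsto (fun ε => ε * excess ρs (A ε).1 ^ (-γ)) l (𝓝 p)) :
    Tendsto (fun ε => limTriple ρs γ ε (A ε)) l (𝓝 (ρs, ρs * u, p)) := by
  have := tendsto_limTriple hρs hA le_rfl ht hv hp
  rwa [zero_add, one_div_one_div] at this

lemma tendsto_limTriple_vacuum (hγ : 0 < γ) (hl : l ≤ 𝓝[>] 0)
    (hA : ∀ᶠ ε in l, (A ε).1 ∈ Ioo 0 ρs)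
    (ht : Tendsto (fun ε => excess ρs (A ε).1) l atTop)
    (hq : Tendsto (fun ε => (A ε).2) l (𝓝 0)) :
    Tendsto (fun ε => limTriple ρs γ ε (A ε)) l (𝓝 (0, 0, 0)) := by
  refine (tendsto_dens_zero ht).prodMk_nhds (hq.prodMk_nhds ?_)
  have := (tendsto_id_of_le hl).mul ((tendsto_rpow_neg_atTop hγ).comp ht)
  rw [mul_zero] at this
  refine this.congr' ?_
  filter_upwards [hA] with ε hε
  rw [pressure_eq hε, Function.comp_apply]

/-- A congested state with bounded rescaled pressure is tame. -/
lemma tameData_of_congested (hγ : 0 < γ) (hl : l ≤ 𝓝[>] 0) (hL : ∀ᶠ ε in l, (L ε).1 ∈ Ioo 0 ρs)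
    (hv : Tendsto (fun ε => Congestion.vel (L ε)) l (𝓝 u₀))
    (ht : Tendsto (fun ε => excess ρs (L ε).1) l (𝓝 0)) {p : ℝ}
    (hp : Tendsto (fun ε => ε * excess ρs (L ε).1 ^ (-γ)) l (𝓝 p)) :
    TameData ρs γ l L u₀ := by
  refine ⟨hl, hL, hv, ⟨1, (ht.eventually_lt_const one_pos).mono fun _ h => h.le⟩, fun N hN => ?_⟩
  have hst : Tendsto (fun ε => √(excess ρs (L ε).1)) l (𝓝 0) := by
    simpa using ht.sqrt
  have hsst : Tendsto (fun ε => √(√(excess ρs (L ε).1))) l (𝓝 0) := by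
    simpa using hst.sqrt
  have hsp : Tendsto (fun ε => √(ε * excess ρs (L ε).1 ^ (-γ))) l (𝓝 √p) :=
    (Real.continuous_sqrt.tendsto p).comp hp
  have h1 := (hsp.mul hsst).const_mul (2 * √γ)
  have h2 := ((Real.continuous_sqrt.tendsto _).comp ((tendsto_sqrt_of_le hl).mul hsp)).const_mul
    (2 * √γ * √N)
  have h3 := h1.add h2
  simp only [mul_zero, zero_mul, Real.sqrt_zero, add_zero] at h3
  refine squeeze_zero' ?_ ?_ h3
  · filter_upwards [hL, ht.eventually_lt_const hN] with ε hε h4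
    exact mul_nonneg (Real.sqrt_nonneg ε) (riem_nonneg hγ (excess_pos hε) h4.le)
  · filter_upwards [hL, eventually_pos_of_le hl, ht.eventually_lt_const one_pos,
      hst.eventually_lt_const hN] with ε hε hpos h5 h6
    have htp := excess_pos hε
    set t := excess ρs (L ε).1
    have hstp : 0 < √t := Real.sqrt_pos.2 htp
    have h7 : t ≤ √t := Real.le_sqrt_of_sq_le (by nlinarith)
    -- Splitting at `√t` balances the estimate. Up to constants, the first piece is at most `√(ε p)
    -- t ^ (1/4)`, and the second is at most `ε ^ (1/4) (ε p) ^ (1/4)`.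
    rw [← riem_add (γ := γ) htp hstp hN, mul_add]
    have e1 : t ^ (-γ / 2) = √(t ^ (-γ)) := by
      rw [Real.sqrt_eq_rpow, ← Real.rpow_mul htp.le]; congr 1; ring
    have e2 : (√t) ^ (-γ / 2) = √(t ^ (-γ / 2)) := by
      rw [Real.sqrt_eq_rpow, Real.sqrt_eq_rpow, ← Real.rpow_mul htp.le, ← Real.rpow_mul htp.le]
      congr 1; ring
    have h8 := mul_le_mul_of_nonneg_left (riem_le hγ htp h7) (Real.sqrt_nonneg ε)
    have h9 := mul_le_mul_of_nonneg_left (riem_le hγ hstp h6.le) (Real.sqrt_nonneg ε)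
    rw [e1] at h8
    rw [e2, e1] at h9
    refine add_le_add (h8.trans_eq ?_) (h9.trans_eq ?_)
    · rw [Real.sqrt_mul hpos.le]; ring
    · rw [Function.comp_apply, Real.sqrt_mul (Real.sqrt_nonneg ε), Real.sqrt_mul hpos.le,
        Real.sqrt_mul (Real.sqrt_nonneg ε)]
      have : √ε = √√ε * √√ε := (Real.mul_self_sqrt (Real.sqrt_nonneg ε)).symm
      nth_rw 1 [this]
      ring

/-- A state that stays away from vacuum and congestion is tame. -/
lemma tameData_of_tendsto (hl : l ≤ 𝓝[>] 0) (hL : ∀ᶠ ε in l, (L ε).1 ∈ Ioo 0 ρs)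
    (hv : Tendsto (fun ε => Congestion.vel (L ε)) l (𝓝 u₀)) {t : ℝ} (ht0 : 0 < t)
    (ht : Tendsto (fun ε => excess ρs (L ε).1) l (𝓝 t)) : TameData ρs γ l L u₀ := by
  refine ⟨hl, hL, hv, ⟨t + 1, (ht.eventually_lt_const (lt_add_one t)).mono fun _ h => h.le⟩,
    fun N hN => ?_⟩
  have h1 : Tendsto (fun ε => Congestion.riem γ N (excess ρs (L ε).1)) l
      (𝓝 (Congestion.riem γ N t)) :=
    ((continuousOn_riem hN).continuousAt (Ioi_mem_nhds ht0)).tendsto.comp ht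
  have h2 := (tendsto_sqrt_of_le hl).mul h1.neg
  rw [zero_mul] at h2
  refine h2.congr' ?_
  filter_upwards [hL] with ε hε
  have := riem_add (γ := γ) hN (excess_pos hε) hN
  rw [riem_self] at this
  congr 1
  linarith

end

/-! ### Riemann solutions along an ultrafilter and their intermediate state -/

/-- A family of Riemann solutions indexed by `ε`, with tame data, congested on the left and
uncongested on the right. -/
structure FanData (ρs γ : ℝ) (l : Ultrafilter ℝ) (L R M : ℝ → ℝ × ℝ) (a₁ b₁ a₂ b₂ : ℝ → ℝ)
    (U : ℝ → ℝ → ℝ × ℝ) (ul ur tr : ℝ) : Prop where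
  hγ : 0 < γ
  hρs : 0 < ρs
  hL : TameData ρs γ l L ul
  hR : TameData ρs γ l R ur
  tl : Tendsto (fun ε => excess ρs (L ε).1) l (𝓝 0)
  tr_pos : 0 < tr
  tr : Tendsto (fun ε => excess ρs (R ε).1) l (𝓝 tr)
  le : ∀ᶠ ε in (l : Filter ℝ), b₁ ε ≤ a₂ ε
  w₁ : ∀ᶠ ε in (l : Filter ℝ), IsElementaryWave ρs γ ε .one (L ε) (M ε) (a₁ ε) (b₁ ε) (U ε)
  w₂ : ∀ᶠ ε in (l : Filter ℝ), IsElementaryWave ρs γ ε .one (mirror (R ε)) (mirror (M ε))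
    (-b₂ ε) (-a₂ ε) (fun s => mirror (U ε (-s)))
  left : ∀ᶠ ε in (l : Filter ℝ), ∀ s, s < a₁ ε → U ε s = L ε
  mid : ∀ᶠ ε in (l : Filter ℝ), ∀ s, b₁ ε ≤ s → s < a₂ ε → U ε s = M ε
  right : ∀ᶠ ε in (l : Filter ℝ), ∀ s, b₂ ε ≤ s → U ε s = R ε

/-- The relations satisfied by an intermediate state with positive density. -/
structure MiddleState (ρs γ ε : ℝ) (L R M : ℝ × ℝ) (b₁ a₂ : ℝ) : Prop where
  mem : M.1 ∈ Ioo 0 ρs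
  left : vel M = vel L - velDrop γ ε (excess ρs L.1) (excess ρs M.1)
  right : vel M = vel R + velDrop γ ε (excess ρs R.1) (excess ρs M.1)
  left_speed : M = L ∨ b₁ ≤ vel M
  right_speed : M = R ∨ vel M ≤ a₂

lemma IsRarefaction.onRarefaction_of_mem_Ico {ε : ℝ} (hγ : 0 < γ) (hρs : 0 < ρs) (hε : 0 < ε)
    {L M : ℝ × ℝ} {a b : ℝ} {U : ℝ → ℝ × ℝ} (h : IsRarefaction ρs γ ε .one L M a b U)
    (hL : L.1 ∈ Ioo 0 ρs) {s : ℝ} (hs : s ∈ Ico a b) : OnRarefaction ρs γ ε L (U s) s := by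
  refine h.onRarefaction hγ hρs hε hL s (Ico_subset_Icc_self hs) ?_
  rcases hs.1.eq_or_lt with rfl | h'
  · rw [h.2.2.1]; exact hL
  · exact (h.2.2.2.2.1 s ⟨h', hs.2⟩).1

lemma IsRarefaction.onRarefaction_left {ε : ℝ} (hγ : 0 < γ) (hρs : 0 < ρs) (hε : 0 < ε)
    {L M : ℝ × ℝ} {a b : ℝ} {U : ℝ → ℝ × ℝ} (h : IsRarefaction ρs γ ε .one L M a b U)
    (hL : L.1 ∈ Ioo 0 ρs) : OnRarefaction ρs γ ε L L a := by
  have := h.onRarefaction_of_mem_Ico hγ hρs hε hL (left_mem_Ico.2 h.1)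
  rwa [h.2.2.1] at this

lemma mirror_eq_mirror_iff {A B : ℝ × ℝ} : mirror A = mirror B ↔ A = B :=
  ⟨fun h => by rw [← mirror_mirror A, h, mirror_mirror], fun h => by rw [h]⟩

/-- Ultrafilters commute with disjunctions, so the kind of the wave may be fixed. -/
lemma eventually_wave_cases {l : Ultrafilter ℝ} {A B : ℝ → ℝ × ℝ} {a b : ℝ → ℝ}
    {U : ℝ → ℝ → ℝ × ℝ}
    (h : ∀ᶠ ε in (l : Filter ℝ), IsElementaryWave ρs γ ε .one (A ε) (B ε) (a ε) (b ε) (U ε)) :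
    (∀ᶠ ε in (l : Filter ℝ), a ε = b ε ∧ A ε = B ε) ∨
      (∀ᶠ ε in (l : Filter ℝ), a ε = b ε ∧ IsEntropicShock ρs γ ε .one (A ε) (B ε) (a ε)) ∨
      ∀ᶠ ε in (l : Filter ℝ), IsRarefaction ρs γ ε .one (A ε) (B ε) (a ε) (b ε) (U ε) := by
  rwa [← Ultrafilter.eventually_or, ← Ultrafilter.eventually_or]

namespace FanData

variable {l : Ultrafilter ℝ} {L R M : ℝ → ℝ × ℝ} {a₁ b₁ a₂ b₂ : ℝ → ℝ}
    {U : ℝ → ℝ → ℝ × ℝ} {ul ur tr : ℝ}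

lemma pos (D : FanData ρs γ l L R M a₁ b₁ a₂ b₂ U ul ur tr) :
    ∀ᶠ ε in (l : Filter ℝ), (0 : ℝ) < ε := eventually_pos_of_le D.hL.le

/-- Vacuum seen from one side is vacuum from the other, since the densities agree. It then has
asymptotically known edges; the excess volume `1` used to locate them is arbitrary. -/
lemma middle_cases (D : FanData ρs γ l L R M a₁ b₁ a₂ b₂ U ul ur tr) :
    (∀ᶠ ε in (l : Filter ℝ), MiddleState ρs γ ε (L ε) (R ε) (M ε) (b₁ ε) (a₂ ε)) ∨
      ((∀ᶠ ε in (l : Filter ℝ), M ε = (0, 0)) ∧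
        (∀ δ > 0, ∀ᶠ ε in (l : Filter ℝ), ul - δ < b₁ ε) ∧
        ∀ δ > 0, ∀ᶠ ε in (l : Filter ℝ), a₂ ε < ur + δ) := by
  have key : ∀ᶠ ε in (l : Filter ℝ), MiddleState ρs γ ε (L ε) (R ε) (M ε) (b₁ ε) (a₂ ε) ∨
      (M ε = (0, 0) ∧ (vel (L ε) + √ε * (riem γ (excess ρs (L ε).1) 1
        - sound γ 1 * (1 + 1 / ρs)) ≤ b₁ ε) ∧
        (vel (mirror (R ε)) + √ε * (riem γ (excess ρs (mirror (R ε)).1) 1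
        - sound γ 1 * (1 + 1 / ρs)) ≤ -a₂ ε)) := by
    filter_upwards [D.w₁, D.w₂, D.hL.mem, D.hR.mem, D.pos] with ε h1 h2 h3 h4 h5
    rcases h1.vel_eq D.hγ D.hρs h5 h3 with ⟨e1, e2, e3⟩ | ⟨e1, e2⟩ <;>
      rcases h2.vel_eq D.hγ D.hρs h5 h4 with ⟨f1, f2, f3⟩ | ⟨f1, f2⟩
    · left
      simp only [vel_mirror, mirror_eq_mirror_iff] at f2 f3
      exact ⟨e1, e2, by simp only [mirror] at f2; linarith, e3, f3.imp_right fun h => by linarith⟩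
    · have : (M ε).1 = 0 := congrArg Prod.fst f1
      exact absurd e1.1 (by rw [this]; exact lt_irrefl 0)
    · rw [e1] at f1
      exact absurd f1.1 (lt_irrefl 0)
    · exact Or.inr ⟨e1, e2 1 one_pos, f2 1 one_pos⟩
  rcases Ultrafilter.eventually_or.1 key with h | h
  · exact Or.inl h
  · refine Or.inr ⟨h.mono fun _ h => h.1, fun δ hδ => ?_, fun δ hδ => ?_⟩
    · filter_upwards [h, D.hL.lt_speed hδ one_pos] with ε h1 h2 using h2.trans_le h1.2.1
    · filter_upwards [h, D.hR.mirror.lt_speed hδ one_pos] with ε h1 h2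
      linarith [h1.2.2]

lemma middle_of_dens_ne_zero (D : FanData ρs γ l L R M a₁ b₁ a₂ b₂ U ul ur tr)
    (h : ∀ᶠ ε in (l : Filter ℝ), (M ε).1 ≠ 0) :
    ∀ᶠ ε in (l : Filter ℝ), MiddleState ρs γ ε (L ε) (R ε) (M ε) (b₁ ε) (a₂ ε) := by
  rcases D.middle_cases with h' | ⟨h', -, -⟩
  · exact h'
  · filter_upwards [h, h'] with ε h1 h2
    exact absurd (congrArg Prod.fst h2) h1

lemma excess_ne (D : FanData ρs γ l L R M a₁ b₁ a₂ b₂ U ul ur tr) {A : ℝ → ℝ × ℝ}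
    (h : Tendsto (fun ε => excess ρs (A ε).1) l (𝓝 0)) : ∀ᶠ ε in (l : Filter ℝ), A ε ≠ R ε := by
  filter_upwards [h.eventually_lt_const (half_pos D.tr_pos),
    D.tr.eventually_const_lt (half_lt_self D.tr_pos)] with ε h1 h2 h3
  rw [h3] at h1
  linarith

lemma tendsto_excess_of_le (D : FanData ρs γ l L R M a₁ b₁ a₂ b₂ U ul ur tr)
    (hM : ∀ᶠ ε in (l : Filter ℝ), MiddleState ρs γ ε (L ε) (R ε) (M ε) (b₁ ε) (a₂ ε))
    (hle : ∀ᶠ ε in (l : Filter ℝ), excess ρs (M ε).1 ≤ excess ρs (L ε).1) :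
    Tendsto (fun ε => excess ρs (M ε).1) l (𝓝 0) :=
  squeeze_zero' (hM.mono fun _ h => (excess_pos h.mem).le) hle D.tl

lemma tendsto_velDrop_of_le (D : FanData ρs γ l L R M a₁ b₁ a₂ b₂ U ul ur tr)
    (hM : ∀ᶠ ε in (l : Filter ℝ), MiddleState ρs γ ε (L ε) (R ε) (M ε) (b₁ ε) (a₂ ε))
    (hle : ∀ᶠ ε in (l : Filter ℝ), excess ρs (M ε).1 ≤ excess ρs (L ε).1) {B : ℝ}
    (hp : ∀ᶠ ε in (l : Filter ℝ), ε * excess ρs (M ε).1 ^ (-γ) ≤ B) :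
    Tendsto (fun ε => velDrop γ ε (excess ρs (L ε).1) (excess ρs (M ε).1)) l (𝓝 0) := by
  have h1 := D.tl.sqrt.const_mul √B
  rw [Real.sqrt_zero, mul_zero] at h1
  refine squeeze_zero' ?_ ?_ h1
  · filter_upwards [hle] with ε h
    rw [velDrop, if_pos h]
    exact Real.sqrt_nonneg _
  · filter_upwards [hM, D.hL.mem, D.pos, hp] with ε h2 h3 h4 h5
    refine (velDrop_le D.hγ h4 (excess_pos h3) (excess_pos h2.mem)).trans ?_
    gcongr

lemma tendsto_vel_of_velDrop (D : FanData ρs γ l L R M a₁ b₁ a₂ b₂ U ul ur tr)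
    (hM : ∀ᶠ ε in (l : Filter ℝ), MiddleState ρs γ ε (L ε) (R ε) (M ε) (b₁ ε) (a₂ ε))
    (h : Tendsto (fun ε => velDrop γ ε (excess ρs (L ε).1) (excess ρs (M ε).1)) l (𝓝 0)) :
    Tendsto (fun ε => vel (M ε)) l (𝓝 ul) := by
  have h1 := D.hL.vel.sub h
  rw [sub_zero] at h1
  exact h1.congr' (hM.mono fun ε h => h.left.symm)

lemma tendsto_pressure_right (D : FanData ρs γ l L R M a₁ b₁ a₂ b₂ U ul ur tr) :
    Tendsto (fun ε => ε * excess ρs (R ε).1 ^ (-γ)) l (𝓝 0) := by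
  have := (tendsto_id_of_le D.hL.le).mul
    (D.tr.rpow_const (p := -γ) (Or.inl D.tr_pos.ne'))
  rwa [zero_mul] at this

lemma tendsto_right_state (D : FanData ρs γ l L R M a₁ b₁ a₂ b₂ U ul ur tr) :
    Tendsto (fun ε => limTriple ρs γ ε (R ε)) l
      (𝓝 (1 / (tr + 1 / ρs), 1 / (tr + 1 / ρs) * ur, 0)) :=
  tendsto_limTriple D.hρs D.hR.mem D.tr_pos.le D.tr D.hR.vel D.tendsto_pressure_right

/-- A large intermediate pressure would force a large compression towards the right state. -/
lemma pressure_le (hγ : 0 < γ) {ε t₀ t T : ℝ} (hε : 0 < ε) (ht : 0 < t) (hT : 0 < T)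
    (h : t + T ≤ t₀) :
    ε * t ^ (-γ) ≤ ε * t₀ ^ (-γ) + velDrop γ ε t₀ t ^ 2 / T := by
  have h1 : 0 ≤ t ^ (-γ) - t₀ ^ (-γ) :=
    sub_nonneg.2 (Real.rpow_le_rpow_of_nonpos ht (by linarith) (by linarith))
  have h2 : 0 ≤ ε * (t ^ (-γ) - t₀ ^ (-γ)) := by positivity
  rw [velDrop, if_pos (by linarith), Real.sq_sqrt (mul_nonneg h2 (by linarith))]
  have h3 : ε * (t ^ (-γ) - t₀ ^ (-γ)) ≤ ε * (t ^ (-γ) - t₀ ^ (-γ)) * (t₀ - t) / T := by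
    rw [le_div_iff₀ hT]
    exact mul_le_mul_of_nonneg_left (by linarith) h2
  linarith

/-! ### Separating velocities -/

/-- If the intermediate excess volume is at least `tr / 2`, the pressure is `O(ε)`. Otherwise the
second wave compresses the volume by at least `tr / 4`, so `pressure_le` bounds the pressure through
the right drop, and tameness on the left bounds that drop by `ul - ur + o(1)`. -/
lemma tendsto_pressure_zero (D : FanData ρs γ l L R M a₁ b₁ a₂ b₂ U ul ur tr) (hu : ul ≤ ur)
    (hM : ∀ᶠ ε in (l : Filter ℝ), MiddleState ρs γ ε (L ε) (R ε) (M ε) (b₁ ε) (a₂ ε)) :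
    Tendsto (fun ε => ε * excess ρs (M ε).1 ^ (-γ)) l (𝓝 0) := by
  have hγ := D.hγ
  have htr := D.tr_pos
  have hnn : ∀ᶠ ε in (l : Filter ℝ), 0 ≤ ε * excess ρs (M ε).1 ^ (-γ) := by
    filter_upwards [hM, D.pos] with ε h1 h2
    have := excess_pos h1.mem
    positivity
  rcases Ultrafilter.eventually_or.1 (Eventually.of_forall (f := (l : Filter ℝ))
    fun ε => le_or_gt (tr / 2) (excess ρs (M ε).1)) with h | h
  · have h1 := (tendsto_id_of_le D.hL.le).mul_const ((tr / 2) ^ (-γ))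
    rw [zero_mul] at h1
    refine squeeze_zero' hnn ?_ h1
    filter_upwards [h, D.pos] with ε h2 h3
    exact mul_le_mul_of_nonneg_left
      (Real.rpow_le_rpow_of_nonpos (by positivity) h2 (by linarith)) h3.le
  -- The positive part is needed because `ul - ur` may be negative; only an upper bound on a
  -- nonnegative drop is used.
  · have hX : Tendsto (fun ε => max (vel (L ε) - vel (R ε)
        + √ε * riem γ (excess ρs (L ε).1) (tr / 2)) 0) l (𝓝 0) := by
      have h1 := ((D.hL.vel.sub D.hR.vel).add (D.hL.riem _ (half_pos htr))).max
        (tendsto_const_nhds (x := (0 : ℝ)))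
      rwa [add_zero, max_eq_right (by linarith)] at h1
    have h2 := D.tendsto_pressure_right.add ((hX.pow 2).div_const (tr / 4))
    simp only [ne_eq, OfNat.ofNat_ne_zero, not_false_eq_true, zero_pow, zero_div, add_zero] at h2
    refine squeeze_zero' hnn ?_ h2
    filter_upwards [h, hM, D.pos, D.hL.mem, D.tl.eventually_lt_const (half_pos htr),
      D.tr.eventually_const_lt (show 3 * tr / 4 < tr by linarith)] with ε h3 h4 h5 h6 h7 h8
    refine (pressure_le hγ h5 (excess_pos h4.mem) (show 0 < tr / 4 by positivity)
      (show _ ≤ excess ρs (R ε).1 by linarith)).trans ?_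
    gcongr
    · rw [velDrop, if_pos (by linarith)]; exact Real.sqrt_nonneg _
    · have h9 := velDrop_ge (ε := ε) hγ (excess_pos h6) (excess_pos h4.mem) h3.le h7.le
      refine le_trans ?_ (le_max_left _ _)
      linarith [h4.left, h4.right]

lemma lt_right_speed (D : FanData ρs γ l L R M a₁ b₁ a₂ b₂ U ul ur tr)
    (hM : ∀ᶠ ε in (l : Filter ℝ), MiddleState ρs γ ε (L ε) (R ε) (M ε) (b₁ ε) (a₂ ε))
    (ht : Tendsto (fun ε => excess ρs (M ε).1) l (𝓝 0))
    (hv : Tendsto (fun ε => vel (M ε)) l (𝓝 ul)) {s : ℝ → ℝ} {δ : ℝ} (hδ : 0 < δ)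
    (hs : ∀ᶠ ε in (l : Filter ℝ), s ε < ul - δ) : ∀ᶠ ε in (l : Filter ℝ), s ε < a₂ ε := by
  filter_upwards [hM, D.excess_ne ht, hs, hv.eventually_const_lt (sub_lt_self ul hδ)]
    with ε h1 h2 h3 h4
  rcases h1.right_speed with h5 | h5
  · exact absurd h5 h2
  · linarith

lemma tendsto_left_zone (D : FanData ρs γ l L R M a₁ b₁ a₂ b₂ U ul ur tr) (hu : ul ≤ ur)
    {s : ℝ → ℝ} {K δ : ℝ} (hδ : 0 < δ) (hs₁ : ∀ᶠ ε in (l : Filter ℝ), -K ≤ s ε)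
    (hs₂ : ∀ᶠ ε in (l : Filter ℝ), s ε < ul - δ) :
    Tendsto (fun ε => limTriple ρs γ ε (U ε (s ε))) l (𝓝 (ρs, ρs * ul, 0)) := by
  have hγ := D.hγ
  have hρs := D.hρs
  have htri := Eventually.of_forall (f := (l : Filter ℝ)) fun ε => lt_or_ge (s ε) (a₁ ε)
  have htri' := Eventually.of_forall (f := (l : Filter ℝ)) fun ε => lt_or_ge (s ε) (b₁ ε)
  have hMlim : ∀ (hM : ∀ᶠ ε in (l : Filter ℝ),
      MiddleState ρs γ ε (L ε) (R ε) (M ε) (b₁ ε) (a₂ ε)),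
      Tendsto (fun ε => excess ρs (M ε).1) l (𝓝 0) → Tendsto (fun ε => vel (M ε)) l (𝓝 ul) →
      Tendsto (fun ε => limTriple ρs γ ε (M ε)) l (𝓝 (ρs, ρs * ul, 0)) := fun hM ht hv =>
    tendsto_limTriple_congested hρs (hM.mono fun _ h => h.mem) ht hv (D.tendsto_pressure_zero hu hM)
  rcases eventually_wave_cases D.w₁ with h₁ | h₁ | h₁
  · have hM := D.middle_of_dens_ne_zero (by
      filter_upwards [h₁, D.hL.mem] with ε h1 h2
      rw [← h1.2]; exact h2.1.ne')
    have ht := D.tendsto_excess_of_le hM (h₁.mono fun ε h => by rw [h.2])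
    have hv : Tendsto (fun ε => vel (M ε)) l (𝓝 ul) :=
      D.hL.vel.congr' (h₁.mono fun ε h => by rw [h.2])
    refine (hMlim hM ht hv).congr' ?_
    filter_upwards [D.lt_right_speed hM ht hv hδ hs₂, D.left, D.mid, h₁] with ε h1 h2 h3 h4
    rcases lt_or_ge (s ε) (a₁ ε) with h5 | h5
    · rw [h2 _ h5, h4.2]
    · rw [h3 _ (h4.1 ▸ h5) h1]
  · have hlt : ∀ᶠ ε in (l : Filter ℝ), excess ρs (M ε).1 < excess ρs (L ε).1 :=
      h₁.mono fun ε h => h.2.data.2.1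
    have hM := D.middle_of_dens_ne_zero (h₁.mono fun ε h => h.2.data.1.1.ne')
    have hle := hlt.mono fun ε h => h.le
    have ht := D.tendsto_excess_of_le hM hle
    have hp := D.tendsto_pressure_zero hu hM
    have hv := D.tendsto_vel_of_velDrop hM (D.tendsto_velDrop_of_le hM hle
      ((hp.eventually_lt_const one_pos).mono fun ε h => h.le))
    -- The shock raises the pressure, so the left pressure vanishes together with the intermediate
    -- one.
    have hpL : Tendsto (fun ε => ε * excess ρs (L ε).1 ^ (-γ)) l (𝓝 0) := by
      refine squeeze_zero' ?_ ?_ hp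
      · filter_upwards [D.pos, D.hL.mem] with ε h1 h2
        have := excess_pos h2
        positivity
      · filter_upwards [D.pos, hM, hle] with ε h1 h2 h3
        exact mul_le_mul_of_nonneg_left
          (Real.rpow_le_rpow_of_nonpos (excess_pos h2.mem) h3 (by linarith)) h1.le
    rcases Ultrafilter.eventually_or.1 htri with h | h
    · refine (tendsto_limTriple_congested hρs D.hL.mem D.tl D.hL.vel hpL).congr' ?_
      filter_upwards [h, D.left] with ε h1 h2
      rw [h2 _ h1]
    · refine (hMlim hM ht hv).congr' ?_
      filter_upwards [h, D.lt_right_speed hM ht hv hδ hs₂, D.mid, h₁] with ε h1 h2 h3 h4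
      rw [h3 _ (h4.1 ▸ h1) h2]
  · rcases Ultrafilter.eventually_or.1 htri with h | h
    · have hOn : ∀ᶠ ε in (l : Filter ℝ), OnRarefaction ρs γ ε (L ε) (L ε) (a₁ ε) := by
        filter_upwards [h₁, D.pos, D.hL.mem] with ε h1 h2 h3 using h1.onRarefaction_left hγ hρs h2 h3
      have hK : ∀ᶠ ε in (l : Filter ℝ), -K ≤ a₁ ε := by
        filter_upwards [h, hs₁] with ε h1 h2 using h2.trans h1.le
      refine (tendsto_limTriple_congested hρs D.hL.mem D.tl D.hL.vel
        (tendsto_pressure_zero_of_onRarefaction hγ hρs D.hL.le hOn hK D.hL.vel D.tl)).congr' ?_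
      filter_upwards [h, D.left] with ε h1 h2
      rw [h2 _ h1]
    rcases Ultrafilter.eventually_or.1 htri' with h' | h'
    · have hOn : ∀ᶠ ε in (l : Filter ℝ), OnRarefaction ρs γ ε (L ε) (U ε (s ε)) (s ε) := by
        filter_upwards [h₁, D.pos, D.hL.mem, h, h'] with ε h1 h2 h3 h4 h5
          using h1.onRarefaction_of_mem_Ico hγ hρs h2 h3 ⟨h4, h5⟩
      have ht := tendsto_excess_zero hγ hρs D.hL hOn hδ (hs₂.mono fun ε h => h.le)
      have hv := tendsto_vel_of_onRarefaction hγ D.hL hOn one_pos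
        ((ht.eventually_lt_const one_pos).mono fun ε h => h.le)
      exact tendsto_limTriple_congested hρs (hOn.mono fun ε h => h.mem) ht hv
        (tendsto_pressure_zero_of_onRarefaction hγ hρs D.hL.le hOn hs₁ hv ht)
    · rcases D.middle_cases with hM | ⟨-, hb, -⟩
      · have hOn : ∀ᶠ ε in (l : Filter ℝ), OnRarefaction ρs γ ε (L ε) (M ε) (b₁ ε) := by
          filter_upwards [h₁, D.pos, D.hL.mem, hM] with ε h1 h2 h3 h4
          rcases h1.cases hγ hρs h2 h3 with h5 | ⟨h5, -⟩
          · exact h5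
          · have := h4.mem.1
            rw [h5] at this
            exact absurd this (lt_irrefl 0)
        have hbs : ∀ᶠ ε in (l : Filter ℝ), b₁ ε ≤ ul - δ := by
          filter_upwards [h', hs₂] with ε h1 h2 using h1.trans h2.le
        have ht := tendsto_excess_zero hγ hρs D.hL hOn hδ hbs
        have hv := tendsto_vel_of_onRarefaction hγ D.hL hOn one_pos
          ((ht.eventually_lt_const one_pos).mono fun ε h => h.le)
        refine (hMlim hM ht hv).congr' ?_
        filter_upwards [h', D.lt_right_speed hM ht hv hδ hs₂, D.mid] with ε h1 h2 h3
        rw [h3 _ h1 h2]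
      -- A rarefaction to vacuum extends beyond `ul - δ`, so it cannot end before `s`.
      · obtain ⟨ε, h1, h2, h3⟩ := (h'.and (hs₂.and (hb δ hδ))).exists
        linarith

/-- In the part of the fan that moves faster than the right state, the solution is constant. -/
lemma eventually_eq_right (D : FanData ρs γ l L R M a₁ b₁ a₂ b₂ U ul ur tr) (hu : ul ≤ ur)
    {s : ℝ → ℝ} {δ : ℝ} (hδ : 0 < δ) (hs : ∀ᶠ ε in (l : Filter ℝ), ur + δ ≤ s ε) :
    ∀ᶠ ε in (l : Filter ℝ), U ε (s ε) = R ε := by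
  have hγ := D.hγ
  have hρs := D.hρs
  have hdens : Tendsto (fun ε => (R ε).1) l (𝓝 (1 / (tr + 1 / ρs))) := by
    have := D.tendsto_right_state
    exact (continuous_fst.tendsto _).comp this
  have hdens0 : 1 / (tr + 1 / ρs) ≠ 0 := by have := D.tr_pos; positivity
  have hmemR := D.hR.mirror.mem
  rcases eventually_wave_cases D.w₂ with h₂ | h₂ | h₂
  · have hMR : ∀ᶠ ε in (l : Filter ℝ), M ε = R ε :=
      h₂.mono fun ε h => (mirror_eq_mirror_iff.1 h.2).symm
    have hM := D.middle_of_dens_ne_zero (by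
      filter_upwards [hMR, D.hR.mem] with ε h1 h2
      rw [h1]; exact h2.1.ne')
    -- An absent second wave can sit anywhere, so `s` may precede it; it suffices that `s` has
    -- passed the first wave, which is present because `L ≠ R`.
    filter_upwards [hMR, hM, D.excess_ne D.tl, h₂, D.right, D.mid, hs,
      D.hR.vel.eventually_lt_const (lt_add_of_pos_right ur hδ)] with ε h1 h2 h3 h4 h5 h6 h7 h8
    rcases lt_or_ge (s ε) (a₂ ε) with h9 | h9
    · rw [h6 _ ?_ h9, h1]
      rcases h2.left_speed with h10 | h10
      · exact absurd (h10.symm.trans h1) h3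
      · rw [h1] at h10
        linarith
    · exact h5 _ (by linarith [h4.1])
  · have hM := D.middle_of_dens_ne_zero (h₂.mono fun ε h => h.2.data.1.1.ne')
    -- The shock speed is `u_R + j / ρ_R`, and `secant_bounds` makes the mass flux `j` vanish with
    -- the intermediate pressure.
    have hlim : Tendsto (fun ε => vel (R ε) + √(max 1 γ * (ε * excess ρs (M ε).1 ^ (-γ))
        / excess ρs (R ε).1) / (R ε).1) l (𝓝 ur) := by
      have h1 := D.hR.vel.add (((((D.tendsto_pressure_zero hu hM).const_mul (max 1 γ)).div D.tr
        D.tr_pos.ne').sqrt).div hdens hdens0)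
      simpa using h1
    filter_upwards [h₂, hM, D.hR.mem, D.pos, D.right, hs,
      hlim.eventually_lt_const (lt_add_of_pos_right ur hδ)] with ε h1 h2 h3 h4 h5 h6 h7
    obtain ⟨-, f1, -, f2, -⟩ := h1.2.data
    rw [vel_mirror] at f2
    simp only [mirror] at f1 f2
    refine h5 _ ?_
    have h8 : massFlux γ ε (excess ρs (R ε).1) (excess ρs (M ε).1)
        ≤ √(max 1 γ * (ε * excess ρs (M ε).1 ^ (-γ)) / excess ρs (R ε).1) := by
      rw [massFlux]
      refine Real.sqrt_le_sqrt ?_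
      calc _ = ε * ((excess ρs (M ε).1 ^ (-γ) - excess ρs (R ε).1 ^ (-γ))
              / (excess ρs (R ε).1 - excess ρs (M ε).1)) := by rw [mul_div_assoc]
        _ ≤ ε * (max 1 γ * excess ρs (M ε).1 ^ (-γ) / excess ρs (R ε).1) :=
            mul_le_mul_of_nonneg_left (secant_bounds hγ (excess_pos h2.mem) f1).2 h4.le
        _ = _ := by ring
    have h9 := div_le_div_of_nonneg_right h8 h3.1.le
    linarith
  · have hlim : Tendsto (fun ε => vel (R ε) + √ε * (sound γ (excess ρs (R ε).1) / (R ε).1)) l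
        (𝓝 ur) := by
      have h1 := D.hR.vel.add ((tendsto_sqrt_of_le D.hL.le).mul
        (((continuousOn_sound (γ := γ)).continuousAt (Ioi_mem_nhds D.tr_pos)).tendsto.comp D.tr
          |>.div hdens hdens0))
      simpa using h1
    filter_upwards [h₂, D.hR.mem, D.pos, D.right, hs,
      hlim.eventually_lt_const (lt_add_of_pos_right ur hδ)] with ε h1 h2 h3 h4 h5 h6
    have h7 := (h1.onRarefaction_left hγ hρs h3 h2).speed_eq
    rw [vel_mirror] at h7
    simp only [mirror] at h7
    exact h4 _ (by linarith)

/-- At bounded excess volume each drop is at least `-o(1)`, while their sum tends to `ul - ur < 0`.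
-/
lemma tendsto_excess_middle (D : FanData ρs γ l L R M a₁ b₁ a₂ b₂ U ul ur tr) (hu : ul < ur)
    (hM : ∀ᶠ ε in (l : Filter ℝ), MiddleState ρs γ ε (L ε) (R ε) (M ε) (b₁ ε) (a₂ ε)) :
    Tendsto (fun ε => excess ρs (M ε).1) l atTop := by
  obtain ⟨C, hC⟩ := D.hL.bdd
  obtain ⟨C', hC'⟩ := D.hR.bdd
  refine tendsto_atTop.2 fun N => ?_
  by_contra hne
  have hlt : ∀ᶠ ε in (l : Filter ℝ), excess ρs (M ε).1 < N :=
    (Ultrafilter.eventually_not.2 hne).mono fun ε h => not_le.1 h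
  set N' := max (max N 1) (max C C')
  have hN' : 0 < N' := lt_max_of_lt_left (lt_max_of_lt_right one_pos)
  have h1 := (D.hL.riem N' hN').add (D.hR.riem N' hN')
  rw [add_zero] at h1
  have h2 := le_of_tendsto_of_tendsto (D.hR.vel.sub D.hL.vel) h1 (by
    filter_upwards [hlt, hC, hC', hM, D.hL.mem, D.hR.mem] with ε h2 h3 h4 h5 h6 h7
    have h8 : excess ρs (M ε).1 ≤ N' :=
      h2.le.trans ((le_max_left _ _).trans (le_max_left _ _))
    have h9 := velDrop_ge (ε := ε) D.hγ (excess_pos h6) (excess_pos h5.mem) h8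
      (h3.trans ((le_max_left _ _).trans (le_max_right _ _)))
    have h10 := velDrop_ge (ε := ε) D.hγ (excess_pos h7) (excess_pos h5.mem) h8
      (h4.trans ((le_max_right _ _).trans (le_max_right _ _)))
    linarith [h5.left, h5.right])
  linarith

lemma eventually_isRarefaction (D : FanData ρs γ l L R M a₁ b₁ a₂ b₂ U ul ur tr) (hu : ul < ur) :
    (∀ᶠ ε in (l : Filter ℝ), IsRarefaction ρs γ ε .one (L ε) (M ε) (a₁ ε) (b₁ ε) (U ε)) ∧
    ∀ᶠ ε in (l : Filter ℝ), IsRarefaction ρs γ ε .one (mirror (R ε)) (mirror (M ε))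
      (-b₂ ε) (-a₂ ε) (fun s => mirror (U ε (-s))) := by
  obtain ⟨C, hC⟩ := D.hL.bdd
  obtain ⟨C', hC'⟩ := D.hR.bdd
  have key : ∀ᶠ ε in (l : Filter ℝ), (M ε).1 ∈ Ioo 0 ρs →
      excess ρs (L ε).1 < excess ρs (M ε).1 ∧ excess ρs (R ε).1 < excess ρs (M ε).1 := by
    rcases D.middle_cases with hM | ⟨hM, -, -⟩
    · have h1 := D.tendsto_excess_middle hu hM
      filter_upwards [h1.eventually_gt_atTop C, h1.eventually_gt_atTop C', hC, hC']
        with ε h2 h3 h4 h5 _ using ⟨h4.trans_lt h2, h5.trans_lt h3⟩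
    · filter_upwards [hM] with ε h1 h2
      rw [h1] at h2
      exact absurd h2.1 (lt_irrefl 0)
  constructor
  · filter_upwards [key, D.w₁, D.hL.mem] with ε h1 h2 h3
    rcases h2 with h2 | h2 | h2
    · rw [← h2.2] at h1
      exact absurd (h1 h3).1 (lt_irrefl _)
    · obtain ⟨h4, h5, -⟩ := h2.2.data
      exact absurd (h1 h4).1 h5.not_gt
    · exact h2
  · filter_upwards [key, D.w₂, D.hR.mem] with ε h1 h2 h3
    rcases h2 with h2 | h2 | h2
    · rw [← mirror_eq_mirror_iff.1 h2.2] at h1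
      exact absurd (h1 h3).2 (lt_irrefl _)
    · obtain ⟨h4, h5, -⟩ := h2.2.data
      exact absurd (h1 h4).2 h5.not_gt
    · exact h2

/-- Both waves are rarefactions, which confines the intermediate velocity between those of the data;
the momentum then vanishes with the density. -/
lemma tendsto_middle_state (D : FanData ρs γ l L R M a₁ b₁ a₂ b₂ U ul ur tr) (hu : ul < ur) :
    Tendsto (fun ε => limTriple ρs γ ε (M ε)) l (𝓝 (0, 0, 0)) := by
  rcases D.middle_cases with hM | ⟨hM, -, -⟩
  · have ht := D.tendsto_excess_middle hu hM
    refine tendsto_limTriple_vacuum D.hγ D.hL.le (hM.mono fun _ h => h.mem) ht ?_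
    have h1 := (tendsto_dens_zero ht).mul (D.hL.vel.abs.add D.hR.vel.abs)
    rw [zero_mul] at h1
    obtain ⟨h₁, h₂⟩ := D.eventually_isRarefaction hu
    refine squeeze_zero_norm' ?_ h1
    filter_upwards [hM, h₁, h₂, D.hL.mem, D.hR.mem, D.pos] with ε h3 h4 h5 h6 h7 h8
    have hne : M ε ≠ (0, 0) := fun h => by
      have := h3.mem.1
      rw [h] at this
      exact lt_irrefl 0 this
    rcases h4.cases D.hγ D.hρs h8 h6 with h9 | ⟨h9, -⟩
    · rcases h5.cases D.hγ D.hρs h8 h7 with h10 | ⟨h10, -⟩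
      · have e1 := h9.vel_eq
        have e2 := h10.vel_eq
        have f1 := mul_nonneg (Real.sqrt_nonneg ε) (riem_nonneg D.hγ (excess_pos h6) h9.le)
        have f2 := mul_nonneg (Real.sqrt_nonneg ε) (riem_nonneg D.hγ (excess_pos h7) h10.le)
        rw [vel_mirror, vel_mirror] at e2
        rw [snd_eq_mul_vel h3.mem.1.ne', norm_mul, Real.norm_eq_abs, Real.norm_eq_abs,
          abs_of_pos h3.mem.1]
        refine mul_le_mul_of_nonneg_left ?_ h3.mem.1.le
        simp only [mirror] at e2 f2
        have g1 := neg_abs_le (vel (L ε))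
        have g2 := le_abs_self (vel (R ε))
        have g3 := abs_nonneg (vel (L ε))
        have g4 := abs_nonneg (vel (R ε))
        exact abs_le.2 ⟨by linarith, by linarith⟩
      · exact absurd (mirror_eq_mirror_iff.1 (h10.trans (by simp [mirror]))) hne
    · exact absurd h9 hne
  · refine tendsto_const_nhds.congr' (hM.mono fun ε h => ?_)
    simp [h, limTriple, pressure]

lemma tendsto_vacuum_zone (D : FanData ρs γ l L R M a₁ b₁ a₂ b₂ U ul ur tr) (hu : ul < ur)
    {s : ℝ → ℝ} {δ : ℝ} (hδ : 0 < δ) (hs₁ : ∀ᶠ ε in (l : Filter ℝ), ul + δ ≤ s ε)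
    (hs₂ : ∀ᶠ ε in (l : Filter ℝ), s ε < ur - δ) :
    Tendsto (fun ε => limTriple ρs γ ε (U ε (s ε))) l (𝓝 (0, 0, 0)) := by
  have hγ := D.hγ
  have hρs := D.hρs
  obtain ⟨h₁, h₂⟩ := D.eventually_isRarefaction hu
  have hsK : ∀ᶠ ε in (l : Filter ℝ), |s ε| ≤ |ul| + |ur| := by
    filter_upwards [hs₁, hs₂] with ε h1 h2
    have g1 := neg_abs_le ul
    have g2 := le_abs_self ur
    have g3 := abs_nonneg ul
    have g4 := abs_nonneg ur
    exact abs_le.2 ⟨by linarith, by linarith⟩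
  have ha₁ : ∀ᶠ ε in (l : Filter ℝ), a₁ ε ≤ s ε := by
    filter_upwards [h₁, D.pos, D.hL.mem, hs₁,
      D.hL.vel.eventually_lt_const (lt_add_of_pos_right ul hδ)] with ε h1 h2 h3 h4 h5
    have h6 := (h1.onRarefaction_left hγ hρs h2 h3).speed_eq
    have h7 := mul_nonneg (Real.sqrt_nonneg ε)
      (div_nonneg (sound_pos hγ (excess_pos h3)).le h3.1.le)
    linarith
  have hb₂ : ∀ᶠ ε in (l : Filter ℝ), s ε < b₂ ε := by
    filter_upwards [h₂, D.pos, D.hR.mem, hs₂,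
      D.hR.vel.eventually_const_lt (sub_lt_self ur hδ)] with ε h1 h2 h3 h4 h5
    have h6 := (h1.onRarefaction_left hγ hρs h2 h3).speed_eq
    have h7 := mul_nonneg (Real.sqrt_nonneg ε)
      (div_nonneg (sound_pos hγ (excess_pos h3)).le h3.1.le)
    rw [vel_mirror] at h6
    simp only [mirror] at h6
    linarith
  rcases Ultrafilter.eventually_or.1 (Eventually.of_forall (f := (l : Filter ℝ))
    fun ε => lt_or_ge (s ε) (b₁ ε)) with h | h
  · have hOn : ∀ᶠ ε in (l : Filter ℝ), OnRarefaction ρs γ ε (L ε) (U ε (s ε)) (s ε) := by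
      filter_upwards [h₁, D.pos, D.hL.mem, h, ha₁] with ε h1 h2 h3 h4 h5
        using h1.onRarefaction_of_mem_Ico hγ hρs h2 h3 ⟨h5, h4⟩
    have ht := tendsto_excess_atTop hγ D.hL hOn hδ hs₁
    exact tendsto_limTriple_vacuum hγ D.hL.le (hOn.mono fun _ h => h.mem) ht
      (tendsto_mom_zero_of_onRarefaction hγ D.hL.le hOn hsK ht)
  rcases Ultrafilter.eventually_or.1 (Eventually.of_forall (f := (l : Filter ℝ))
    fun ε => le_or_gt (s ε) (a₂ ε)) with h' | h'
  · refine (D.tendsto_middle_state hu).congr' ?_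
    filter_upwards [h, h', D.mid, h₂] with ε h1 h2 h3 h4
    -- At `s = a₂` the profile already belongs to the second wave, whose initial value is `M`.
    rcases h2.lt_or_eq with h5 | h5
    · rw [h3 _ h1 h5]
    · have h6 := h4.2.2.2.1
      simp only [neg_neg] at h6
      rw [h5, mirror_eq_mirror_iff.1 h6]
  · have hOn : ∀ᶠ ε in (l : Filter ℝ),
        OnRarefaction ρs γ ε (mirror (R ε)) (mirror (U ε (s ε))) (-s ε) := by
      filter_upwards [h₂, D.pos, D.hR.mem, h', hb₂] with ε h1 h2 h3 h4 h5
      have := h1.onRarefaction_of_mem_Ico hγ hρs h2 h3 (s := -s ε)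
        ⟨by linarith, by linarith⟩
      rwa [neg_neg] at this
    have ht := tendsto_excess_atTop hγ D.hR.mirror hOn hδ (by
      filter_upwards [hs₂] with ε h1
      linarith)
    have hq := (tendsto_mom_zero_of_onRarefaction hγ D.hL.le hOn (K := |ul| + |ur|)
      (by simpa only [abs_neg] using hsK) ht).neg
    simp only [mirror, neg_neg, neg_zero] at hq
    exact tendsto_limTriple_vacuum hγ D.hL.le (hOn.mono fun _ h => h.mem) ht hq

/-! ### Approaching velocities -/

/-- A vacuum would have its left edge near or beyond `ul` and its right edge near or below `ur`,
against the order of the waves. -/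
lemma eventually_middleState (D : FanData ρs γ l L R M a₁ b₁ a₂ b₂ U ul ur tr) (hu : ur < ul) :
    ∀ᶠ ε in (l : Filter ℝ), MiddleState ρs γ ε (L ε) (R ε) (M ε) (b₁ ε) (a₂ ε) := by
  rcases D.middle_cases with h | ⟨-, h1, h2⟩
  · exact h
  · have hδ : 0 < (ul - ur) / 2 := by linarith
    filter_upwards [D.le, h1 _ hδ, h2 _ hδ] with ε h3 h4 h5
    linarith

/-- The two drops add up to nearly `ul - ur`, and each is at most `√(ε p)` times the root of the
excess volume of its datum. -/
lemma exists_le_pressure (D : FanData ρs γ l L R M a₁ b₁ a₂ b₂ U ul ur tr) (hu : ur < ul) :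
    ∃ c > 0, ∀ᶠ ε in (l : Filter ℝ), c ≤ ε * excess ρs (M ε).1 ^ (-γ) := by
  have hB := D.tl.sqrt.add D.tr.sqrt
  rw [Real.sqrt_zero, zero_add] at hB
  have hB0 : 0 < √tr + 1 := by positivity
  have hd : 0 < (ul - ur) / 2 := by linarith
  refine ⟨((ul - ur) / 2 / (√tr + 1)) ^ 2, by positivity, ?_⟩
  filter_upwards [D.eventually_middleState hu, D.pos, D.hL.mem, D.hR.mem,
    hB.eventually_lt_const (lt_add_one _),
    (D.hL.vel.sub D.hR.vel).eventually_const_lt (show (ul - ur) / 2 < ul - ur by linarith)]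
    with ε h1 h2 h3 h4 h5 h6
  have ht := excess_pos h1.mem
  have h7 := velDrop_le D.hγ h2 (excess_pos h3) ht
  have h8 := velDrop_le D.hγ h2 (excess_pos h4) ht
  have h9 : (ul - ur) / 2 ≤ √(ε * excess ρs (M ε).1 ^ (-γ)) * (√tr + 1) := by
    have := mul_le_mul_of_nonneg_left h5.le (Real.sqrt_nonneg (ε * excess ρs (M ε).1 ^ (-γ)))
    linarith [h1.left, h1.right]
  rw [← div_le_iff₀ hB0] at h9
  have h10 := pow_le_pow_left₀ (by positivity) h9 2
  rwa [Real.sq_sqrt (by positivity)] at h10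

lemma tendsto_excess_zero (D : FanData ρs γ l L R M a₁ b₁ a₂ b₂ U ul ur tr) (hu : ur < ul) :
    Tendsto (fun ε => excess ρs (M ε).1) l (𝓝 0) := by
  obtain ⟨c, hc, h⟩ := D.exists_le_pressure hu
  refine tendsto_order.2 ⟨fun b hb => ?_, fun N hN => ?_⟩
  · filter_upwards [D.eventually_middleState hu] with ε h1 using hb.trans (excess_pos h1.mem)
  · have h1 := (tendsto_id_of_le D.hL.le).mul_const (N ^ (-γ))
    rw [zero_mul] at h1
    filter_upwards [h, h1.eventually_lt_const hc, D.pos] with ε h2 h3 h4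
    by_contra h5
    have := mul_le_mul_of_nonneg_left (Real.rpow_le_rpow_of_nonpos hN (not_lt.1 h5)
      (show -γ ≤ 0 by linarith [D.hγ])) h4.le
    linarith

/-- For a compressive first wave the left drop is nonnegative, so the right drop is bounded, hence
so is the pressure by `pressure_le`; then the vanishing left excess volume kills the left drop. For
a rarefaction tameness suffices. -/
lemma tendsto_velDrop_left (D : FanData ρs γ l L R M a₁ b₁ a₂ b₂ U ul ur tr) (hu : ur < ul) :
    Tendsto (fun ε => velDrop γ ε (excess ρs (L ε).1) (excess ρs (M ε).1)) l (𝓝 0) := by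
  have hM := D.eventually_middleState hu
  have htr := D.tr_pos
  have ht := D.tendsto_excess_zero hu
  rcases Ultrafilter.eventually_or.1 (Eventually.of_forall (f := (l : Filter ℝ))
    fun ε => le_or_gt (excess ρs (M ε).1) (excess ρs (L ε).1)) with h | h
  · have hX := D.tendsto_pressure_right.add
      (((D.hL.vel.sub D.hR.vel).pow 2).div_const (tr / 2))
    refine D.tendsto_velDrop_of_le hM h (B := 0 + (ul - ur) ^ 2 / (tr / 2) + 1) ?_
    filter_upwards [h, hM, D.pos, hX.eventually_lt_const (lt_add_one _),
      ht.eventually_lt_const (show 0 < tr / 4 by linarith),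
      D.tr.eventually_const_lt (show 3 * tr / 4 < tr by linarith)] with ε h1 h2 h3 h4 h5 h6
    refine (pressure_le D.hγ h3 (excess_pos h2.mem) (half_pos htr)
      (show _ ≤ excess ρs (R ε).1 by linarith)).trans (le_trans ?_ h4.le)
    have h7 : 0 ≤ velDrop γ ε (excess ρs (L ε).1) (excess ρs (M ε).1) := by
      rw [velDrop, if_pos h1]; exact Real.sqrt_nonneg _
    have h8 : 0 ≤ velDrop γ ε (excess ρs (R ε).1) (excess ρs (M ε).1) := by
      rw [velDrop, if_pos (by linarith)]; exact Real.sqrt_nonneg _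
    gcongr
    linarith [h2.left, h2.right]
  · have h1 := (D.hL.riem 1 one_pos).neg
    rw [neg_zero] at h1
    refine tendsto_of_tendsto_of_tendsto_of_le_of_le' h1 tendsto_const_nhds ?_ ?_
    · filter_upwards [hM, D.hL.mem, ht.eventually_lt_const one_pos,
        D.tl.eventually_lt_const one_pos] with ε h2 h3 h4 h5
      exact velDrop_ge D.hγ (excess_pos h3) (excess_pos h2.mem) h4.le h5.le
    · filter_upwards [h, D.hL.mem] with ε h2 h3
      rw [velDrop, if_neg h2.not_ge, neg_nonpos]
      exact mul_nonneg (Real.sqrt_nonneg _) (riem_nonneg D.hγ (excess_pos h3) h2.le)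

/-- The squared right drop is the pressure jump times the volume jump, which tends to `tr`. -/
lemma tendsto_pressure_jump (D : FanData ρs γ l L R M a₁ b₁ a₂ b₂ U ul ur tr) (hu : ur < ul) :
    Tendsto (fun ε => ε * (excess ρs (M ε).1 ^ (-γ) - excess ρs (R ε).1 ^ (-γ))) l
      (𝓝 ((ul - ur) ^ 2 / tr)) := by
  have htr := D.tr_pos
  have ht := D.tendsto_excess_zero hu
  have h1 := (((D.hL.vel.sub D.hR.vel).sub (D.tendsto_velDrop_left hu)).pow 2).div
    (D.tr.sub ht) (by rw [sub_zero]; exact htr.ne')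
  rw [sub_zero, sub_zero] at h1
  refine h1.congr' ?_
  filter_upwards [D.eventually_middleState hu, D.pos,
      ht.eventually_lt_const (half_pos htr),
      D.tr.eventually_const_lt (half_lt_self htr)] with ε h2 h3 h4 h5
  have hlt : excess ρs (M ε).1 < excess ρs (R ε).1 := h4.trans h5
  have hpos : excess ρs (R ε).1 - excess ρs (M ε).1 ≠ 0 := (sub_pos.2 hlt).ne'
  have h6 : vel (L ε) - vel (R ε) - velDrop γ ε (excess ρs (L ε).1) (excess ρs (M ε).1)
      = velDrop γ ε (excess ρs (R ε).1) (excess ρs (M ε).1) := by linarith [h2.left, h2.right]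
  rw [Pi.div_apply, h6, velDrop, if_pos hlt.le, Real.sq_sqrt]
  · field_simp
  · exact mul_nonneg (mul_nonneg h3.le (sub_nonneg.2 (Real.rpow_le_rpow_of_nonpos
      (excess_pos h2.mem) hlt.le (by linarith [D.hγ])))) (sub_pos.2 hlt).le

lemma tendsto_pressure_middle (D : FanData ρs γ l L R M a₁ b₁ a₂ b₂ U ul ur tr) (hu : ur < ul) :
    Tendsto (fun ε => ε * excess ρs (M ε).1 ^ (-γ)) l (𝓝 ((ul - ur) ^ 2 / tr)) := by
  have h := (D.tendsto_pressure_jump hu).add D.tendsto_pressure_right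
  rw [add_zero] at h
  exact h.congr fun ε => by ring

lemma tendsto_vel_middle (D : FanData ρs γ l L R M a₁ b₁ a₂ b₂ U ul ur tr) (hu : ur < ul) :
    Tendsto (fun ε => vel (M ε)) l (𝓝 ul) :=
  D.tendsto_vel_of_velDrop (D.eventually_middleState hu) (D.tendsto_velDrop_left hu)

/-- The second wave is a shock of converging speed. -/
lemma tendsto_right_shock_speed (D : FanData ρs γ l L R M a₁ b₁ a₂ b₂ U ul ur tr)
    (hu : ur < ul) :
    (∀ᶠ ε in (l : Filter ℝ), a₂ ε = b₂ ε) ∧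
      Tendsto b₂ l (𝓝 (ur + (ul - ur) / tr * (tr + 1 / ρs))) := by
  have hM := D.eventually_middleState hu
  have ht := D.tendsto_excess_zero hu
  have htr := D.tr_pos
  have hlt : ∀ᶠ ε in (l : Filter ℝ), excess ρs (M ε).1 < excess ρs (R ε).1 := by
    filter_upwards [ht.eventually_lt_const (half_pos htr),
      D.tr.eventually_const_lt (half_lt_self htr)] with ε h1 h2 using h1.trans h2
  have hsh : ∀ᶠ ε in (l : Filter ℝ),
      -b₂ ε = -a₂ ε ∧ IsEntropicShock ρs γ ε .one (mirror (R ε)) (mirror (M ε)) (-b₂ ε) := by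
    filter_upwards [hM, hlt, D.w₂, D.hR.mem, D.pos] with ε h1 h2 h3 h4 h5
    rcases h3 with h3 | h3 | h3
    · rw [mirror_eq_mirror_iff.1 h3.2] at h2
      exact absurd h2 (lt_irrefl _)
    · exact h3
    · rcases h3.cases D.hγ D.hρs h5 h4 with h6 | ⟨h6, -⟩
      · exact absurd h6.le h2.not_ge
      · have h7 : (M ε).1 = 0 := congrArg Prod.fst h6
        exact absurd h7 h1.mem.1.ne'
  refine ⟨hsh.mono fun ε h => by linarith [h.1], ?_⟩
  have h1 := ((D.tendsto_pressure_jump hu).div (D.tr.sub ht)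
    (by rw [sub_zero]; exact htr.ne')).sqrt
  have h2 : √((ul - ur) ^ 2 / tr / (tr - 0)) = (ul - ur) / tr := by
    rw [sub_zero, div_div, ← sq, ← div_pow, Real.sqrt_sq (div_nonneg (by linarith) htr.le)]
  rw [h2] at h1
  have h3 := D.hR.vel.add (h1.mul (D.tr.add_const (1 / ρs)))
  refine h3.congr' ?_
  filter_upwards [hsh] with ε h4
  obtain ⟨-, -, -, h5, -⟩ := h4.2.data
  rw [vel_mirror, div_eq_mul_one_div, one_div_eq_excess_add ρs] at h5
  simp only [mirror, massFlux] at h5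
  simp only [Pi.div_apply]
  linarith

/-- The first wave is absent or its speed tends to `-∞`. -/
lemma eventually_left_speed (D : FanData ρs γ l L R M a₁ b₁ a₂ b₂ U ul ur tr) (hu : ur < ul)
    (K : ℝ) : ∀ᶠ ε in (l : Filter ℝ), a₁ ε = b₁ ε ∧ L ε = M ε ∨ b₁ ε ≤ -K := by
  have hγ := D.hγ
  have hρs := D.hρs
  have hM := D.eventually_middleState hu
  have ht := D.tendsto_excess_zero hu
  obtain ⟨c, hc, hp⟩ := D.exists_le_pressure hu
  rcases eventually_wave_cases D.w₁ with h₁ | h₁ | h₁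
  · exact h₁.mono fun ε h => Or.inl h
  -- With pressure at least `c`, the squared mass flux is at least `min 1 γ * c` over the left
  -- excess volume, which tends to zero.
  · have hlim : Tendsto (fun ε => vel (L ε) - √(min 1 γ * c / excess ρs (L ε).1) * (1 / ρs)) l
        atBot := by
      have h0 : Tendsto (fun ε => excess ρs (L ε).1) l (𝓝[>] 0) :=
        tendsto_nhdsWithin_iff.2 ⟨D.tl, D.hL.mem.mono fun ε h => excess_pos h⟩
      have hmc : 0 < min 1 γ * c := mul_pos (lt_min one_pos hγ) hc
      have h1 := (tendsto_inv_nhdsGT_zero.comp h0).const_mul_atTop hmc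
      have h2 := (Real.tendsto_sqrt_atTop.comp h1).atTop_mul_const (one_div_pos.2 hρs)
      exact (D.hL.vel.add_atBot (tendsto_neg_atTop_atBot.comp h2)).congr fun ε => by
        simp [sub_eq_add_neg, div_eq_mul_inv]
    filter_upwards [h₁, hM, hp, D.pos, D.hL.mem, hlim.eventually_le_atBot (-K)]
      with ε h1 h2 h3 h4 h5 h6
    right
    obtain ⟨-, f1, -, f2, -⟩ := h1.2.data
    rw [div_eq_mul_one_div, one_div_eq_excess_add ρs] at f2
    have f3 := (secant_bounds hγ (excess_pos h2.mem) f1).1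
    have f4 : √(min 1 γ * c / excess ρs (L ε).1)
        ≤ massFlux γ ε (excess ρs (L ε).1) (excess ρs (M ε).1) := by
      rw [massFlux]
      refine Real.sqrt_le_sqrt ?_
      have hmin : 0 < min 1 γ := lt_min one_pos hγ
      calc min 1 γ * c / excess ρs (L ε).1
          ≤ min 1 γ * (ε * excess ρs (M ε).1 ^ (-γ)) / excess ρs (L ε).1 := by
            have := excess_pos h5
            gcongr
        _ = ε * (min 1 γ * excess ρs (M ε).1 ^ (-γ) / excess ρs (L ε).1) := by ring
        _ ≤ ε * ((excess ρs (M ε).1 ^ (-γ) - excess ρs (L ε).1 ^ (-γ))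
              / (excess ρs (L ε).1 - excess ρs (M ε).1)) := mul_le_mul_of_nonneg_left f3 h4.le
        _ = _ := by rw [mul_div_assoc]
    have f5 : √(min 1 γ * c / excess ρs (L ε).1) * (1 / ρs)
        ≤ massFlux γ ε (excess ρs (L ε).1) (excess ρs (M ε).1)
          * (excess ρs (L ε).1 + 1 / ρs) := by
      have h7 := excess_pos h5
      have h8 : 0 < 1 / ρs := one_div_pos.2 hρs
      exact mul_le_mul f4 (by linarith) h8.le ((Real.sqrt_nonneg _).trans f4)
    linarith [h1.1]
  -- A rarefaction ending at a speed bounded below would release the pressure, contradicting the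
  -- bound `c`.
  · by_contra hne
    have hlt : ∀ᶠ ε in (l : Filter ℝ), -K ≤ b₁ ε := by
      filter_upwards [Ultrafilter.eventually_not.2 hne] with ε h1
      push Not at h1
      exact h1.2.le
    have hOn : ∀ᶠ ε in (l : Filter ℝ), OnRarefaction ρs γ ε (L ε) (M ε) (b₁ ε) := by
      filter_upwards [h₁, D.pos, D.hL.mem, hM] with ε h1 h2 h3 h4
      rcases h1.cases hγ hρs h2 h3 with h5 | ⟨h5, -⟩
      · exact h5
      · exact absurd (congrArg Prod.fst h5) h4.mem.1.ne'
    have h0 := tendsto_pressure_zero_of_onRarefaction hγ hρs D.hL.le hOn hlt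
      (D.tendsto_vel_middle hu) ht
    obtain ⟨ε, h1, h2⟩ := (hp.and (h0.eventually_lt_const hc)).exists
    linarith

lemma tendsto_congested_zone (D : FanData ρs γ l L R M a₁ b₁ a₂ b₂ U ul ur tr) (hu : ur < ul)
    {s : ℝ → ℝ} {K δ : ℝ} (hδ : 0 < δ) (hs₁ : ∀ᶠ ε in (l : Filter ℝ), -K ≤ s ε)
    (hs₂ : ∀ᶠ ε in (l : Filter ℝ), s ε < ur + (ul - ur) / tr * (tr + 1 / ρs) - δ) :
    Tendsto (fun ε => limTriple ρs γ ε (U ε (s ε))) l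
      (𝓝 (ρs, ρs * ul, (ul - ur) ^ 2 / tr)) := by
  have hM := D.eventually_middleState hu
  refine (tendsto_limTriple_congested D.hρs (hM.mono fun _ h => h.mem) (D.tendsto_excess_zero hu)
    (D.tendsto_vel_middle hu) (D.tendsto_pressure_middle hu)).congr' ?_
  obtain ⟨h1, h2⟩ := D.tendsto_right_shock_speed hu
  filter_upwards [D.eventually_left_speed hu K, D.left, D.mid, h1, hs₁, hs₂,
    h2.eventually_const_lt (sub_lt_self _ hδ)] with ε h3 h4 h5 h6 h7 h8 h9
  have h10 : s ε < a₂ ε := by linarith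
  -- If the first wave is absent its position is immaterial, since the state is the same on both
  -- sides.
  rcases h3 with ⟨h3, h3'⟩ | h3
  · rcases lt_or_ge (s ε) (a₁ ε) with h | h
    · rw [h4 _ h, h3']
    · rw [h5 _ (h3 ▸ h) h10]
  · rw [h5 _ (by linarith) h10]

lemma eventually_eq_right_of_lt (D : FanData ρs γ l L R M a₁ b₁ a₂ b₂ U ul ur tr)
    (hu : ur < ul) {s : ℝ → ℝ} {δ : ℝ} (hδ : 0 < δ)
    (hs : ∀ᶠ ε in (l : Filter ℝ), ur + (ul - ur) / tr * (tr + 1 / ρs) + δ ≤ s ε) :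
    ∀ᶠ ε in (l : Filter ℝ), U ε (s ε) = R ε := by
  filter_upwards [D.right, hs,
    (D.tendsto_right_shock_speed hu).2.eventually_lt_const (lt_add_of_pos_right _ hδ)]
    with ε h1 h2 h3 using h1 _ (by linarith)

end FanData

/-- The same `δ` serves as accuracy, as distance to the waves and, through `K = 1 / δ`, as cutoff at
very negative speeds. -/
lemma convergesToFan_of_tendsto {n : ℕ} {F : ℝ → ℝ → LimState} {W : WaveFan (n + 1)}
    {c : Fin n → ℝ} {G : ℝ → LimState} (h0 : W.speed 0 = ⊥) (hc : ∀ i : Fin n, W.speed i.succ = c i)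
    (hG : Tendsto G (𝓝[>] 0) (𝓝 (W.state 0)))
    (hF : ∀ᶠ ε in 𝓝[>] (0 : ℝ), ∃ a, ∀ s < a, F ε s = G ε)
    (H : ∀ l : Ultrafilter ℝ, (l : Filter ℝ) ≤ 𝓝[>] 0 → ∀ (s : ℝ → ℝ) (K δ : ℝ), 0 < δ →
      (∀ᶠ ε in (l : Filter ℝ), -K ≤ s ε) → ∀ i : Fin (n + 1),
      (∀ j : Fin n, j.castSucc < i → ∀ᶠ ε in (l : Filter ℝ), c j + δ ≤ s ε) →
      (∀ j : Fin n, i ≤ j.castSucc → ∀ᶠ ε in (l : Filter ℝ), s ε < c j - δ) →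
      Tendsto (fun ε => F ε (s ε)) l (𝓝 (W.state i.succ))) :
    ConvergesToFan F W := by
  refine convergesToFan_of_eventually h0 hc hG hF fun δ hδ => ?_
  have key : ∀ i : Fin (n + 1), ∀ᶠ ε in 𝓝[>] (0 : ℝ), ∀ s, (-1 / δ ≤ s ∧
      (∀ j : Fin n, j.castSucc < i → c j + δ ≤ s) ∧ ∀ j : Fin n, i ≤ j.castSucc → s < c j - δ) →
      dist (F ε s) (W.state i.succ) < δ := fun i =>
    eventually_forall_of_ultrafilter
      (C := fun _ s => -1 / δ ≤ s ∧ (∀ j : Fin n, j.castSucc < i → c j + δ ≤ s) ∧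
        ∀ j : Fin n, i ≤ j.castSucc → s < c j - δ)
      (Q := fun ε s => dist (F ε s) (W.state i.succ) < δ) fun l s hl hs => by
        refine Metric.tendsto_nhds.1 (H l hl s (1 / δ) δ hδ ?_ i ?_ ?_) δ hδ
        · filter_upwards [hs] with ε h
          rw [← neg_div]; exact h.1
        · exact fun j hj => hs.mono fun ε h => h.2.1 j hj
        · exact fun j hj => hs.mono fun ε h => h.2.2 j hj
  filter_upwards [eventually_all.2 key] with ε h s hs i h1 h2 using h i s ⟨hs, h1, h2⟩

/-- The waves are chosen before the ultrafilter, since the front `a₁` of the fan has to be one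
function of `ε`. -/
lemma exists_fanData (hγ : 0 < γ) (hρs : 0 < ρs) {L R : ℝ → ℝ × ℝ} {U : ℝ → ℝ → ℝ × ℝ}
    {ul ur tr : ℝ} (hL : TameData ρs γ (𝓝[>] 0) L ul) (hR : TameData ρs γ (𝓝[>] 0) R ur)
    (tl : Tendsto (fun ε => excess ρs (L ε).1) (𝓝[>] 0) (𝓝 0)) (htr : 0 < tr)
    (hT : Tendsto (fun ε => excess ρs (R ε).1) (𝓝[>] 0) (𝓝 tr))
    (hU : ∀ᶠ ε in 𝓝[>] (0 : ℝ), IsRiemannSolution ρs γ ε (L ε) (R ε) (U ε)) :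
    ∃ (M : ℝ → ℝ × ℝ) (a₁ b₁ a₂ b₂ : ℝ → ℝ),
      (∀ᶠ ε in 𝓝[>] (0 : ℝ), ∀ s < a₁ ε, U ε s = L ε) ∧
      ∀ l : Ultrafilter ℝ, (l : Filter ℝ) ≤ 𝓝[>] 0 →
        FanData ρs γ l L R M a₁ b₁ a₂ b₂ U ul ur tr := by
  obtain ⟨M, hM⟩ := hU.choice
  obtain ⟨a₁, h1⟩ := hM.choice
  obtain ⟨b₁, h2⟩ := h1.choice
  obtain ⟨a₂, h3⟩ := h2.choice
  obtain ⟨b₂, h⟩ := h3.choice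
  refine ⟨M, a₁, b₁, a₂, b₂, h.mono fun ε h => h.2.2.2.1, fun l hl => ?_⟩
  exact
    { hγ := hγ
      hρs := hρs
      hL := hL.mono hl
      hR := hR.mono hl
      tl := tl.mono_left hl
      tr_pos := htr
      tr := hT.mono_left hl
      le := hl (h.mono fun ε h => h.1)
      w₁ := hl (h.mono fun ε h => h.2.1)
      w₂ := hl (h.mono fun ε h => h.2.2.1.mirror)
      left := hl (h.mono fun ε h => h.2.2.2.1)
      mid := hl (h.mono fun ε h => h.2.2.2.2.1)
      right := hl (h.mono fun ε h => h.2.2.2.2.2) }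

/-! ### Admissibility of the limit fans -/

lemma isLimState_congested (hρs : 0 < ρs) {q p : ℝ} (hp : 0 ≤ p) : IsLimState ρs (ρs, q, p) :=
  ⟨hρs.le, le_rfl, hp, by simp [LimState.dens], fun h => absurd h hρs.ne'⟩

lemma isLimState_free {ρ q : ℝ} (h0 : 0 < ρ) (h : ρ ≤ ρs) : IsLimState ρs (ρ, q, 0) :=
  ⟨h0.le, h, le_rfl, mul_zero _, fun h => absurd h h0.ne'⟩

lemma isLimState_vacuum (hρs : 0 < ρs) : IsLimState ρs (0, 0, 0) :=
  ⟨le_rfl, hρs.le, le_rfl, mul_zero _, fun _ => rfl⟩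

lemma isDeclustering_bot {q p : ℝ} : IsDeclustering ρs (ρs, q, p) (ρs, q, 0) ⊥ :=
  ⟨⟨Or.inl rfl, rfl, rfl, rfl⟩, fun _ => rfl, fun h => absurd h bot_ne_top⟩

/-- The expression with roots is the quotient `[q] / [ρ]`, in which the jump conditions are rational
identities. -/
lemma shock_speed_eq (hρs : 0 < ρs) {ρr ul ur : ℝ} (h0 : 0 < ρr) (h : ρr < ρs) (hu : ur < ul) :
    ur + √(ρs / ρr) * √(ρs * ρr / (ρs - ρr) * (ul - ur) ^ 2 / (ρs - ρr))
      = (ρs * ul - ρr * ur) / (ρs - ρr) := by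
  have hd : 0 < ρs - ρr := sub_pos.2 h
  have e : ρs / ρr * (ρs * ρr / (ρs - ρr) * (ul - ur) ^ 2 / (ρs - ρr))
      = (ρs * (ul - ur) / (ρs - ρr)) ^ 2 := by
    field_simp
  rw [← Real.sqrt_mul (by positivity), e,
    Real.sqrt_sq (div_nonneg (mul_nonneg hρs.le (by linarith)) hd.le)]
  field_simp
  ring

lemma isFiniteShock_congested (hρs : 0 < ρs) {ρr ul ur : ℝ} (h0 : 0 < ρr) (h : ρr < ρs)
    (hu : ur < ul) :
    IsFiniteShock (ρs, ρs * ul, ρs * ρr / (ρs - ρr) * (ul - ur) ^ 2) (ρr, ρr * ur, 0)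
      (((ρs * ul - ρr * ur) / (ρs - ρr) : ℝ) : EReal) := by
  have hd : ρs - ρr ≠ 0 := (sub_pos.2 h).ne'
  refine ⟨_, rfl, hρs, h0, ?_, ?_, ?_⟩
  · simp only [LimState.mom, LimState.dens]
    field_simp
    ring
  · simp only [LimState.mom, LimState.dens, LimState.pres]
    field_simp
    ring
  · simp only [LimState.mom, LimState.dens]
    rw [mul_div_cancel_left₀ _ h0.ne', mul_div_cancel_left₀ _ hρs.ne']
    exact hu

end Congestion

end

/-! ### The three regimes -/

theorem mainTheorem2 (ρs γ : ℝ) (hρs : 0 < ρs) (hγ : 0 < γ)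
    (ρl ql ρr qr : ℝ → ℝ) (ql₀ pl₀ ρr₀ qr₀ ul ur : ℝ)
    (hρl_lt : ∀ᶠ ε in 𝓝[>] (0 : ℝ), ρl ε < ρs)
    (hρl : Tendsto ρl (𝓝[>] 0) (𝓝 ρs))
    (hql : Tendsto ql (𝓝[>] 0) (𝓝 ql₀))
    (hpl : Tendsto (fun ε => ε * Congestion.pressure ρs γ (ρl ε)) (𝓝[>] 0) (𝓝 pl₀))
    (hρr : Tendsto ρr (𝓝[>] 0) (𝓝 ρr₀))
    (hqr : Tendsto qr (𝓝[>] 0) (𝓝 qr₀))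
    (hρr_pos : 0 < ρr₀) (hρr_lt : ρr₀ < ρs)
    (hul : ul = ql₀ / ρs) (hur : ur = qr₀ / ρr₀) :
    (ul < ur →
      Congestion.IsLimitOfRiemannSolutions ρs γ (fun ε => (ρl ε, ql ε)) (fun ε => (ρr ε, qr ε))
        { state := ![(ρs, ql₀, pl₀), (ρs, ql₀, 0), (0, 0, 0), (ρr₀, qr₀, 0)]
          kind := ![.declustering, .contact, .contact]
          speed := ![⊥, (ul : EReal), (ur : EReal)] : Congestion.WaveFan 3 }) ∧
    (ur < ul →
      ∀ qm pm σ : ℝ, qm = ρs * ul → pm = ρs * ρr₀ / (ρs - ρr₀) * (ul - ur) ^ 2 →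
        σ = ur + √(ρs / ρr₀) * √(pm / (ρs - ρr₀)) →
      Congestion.IsLimitOfRiemannSolutions ρs γ (fun ε => (ρl ε, ql ε)) (fun ε => (ρr ε, qr ε))
        { state := ![(ρs, ql₀, pl₀), (ρs, qm, pm), (ρr₀, qr₀, 0)]
          kind := ![.shock, .shock]
          speed := ![⊥, (σ : EReal)] : Congestion.WaveFan 2 }) ∧
    (ul = ur →
      Congestion.IsLimitOfRiemannSolutions ρs γ (fun ε => (ρl ε, ql ε)) (fun ε => (ρr ε, qr ε))
        { state := ![(ρs, ql₀, pl₀), (ρs, ql₀, 0), (ρr₀, qr₀, 0)]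
          kind := ![.declustering, .contact]
          speed := ![⊥, (ul : EReal)] : Congestion.WaveFan 2 }) := by
  open Congestion in
  have hql₀ : ql₀ = ρs * ul := by rw [hul]; field_simp
  have hqr₀ : qr₀ = ρr₀ * ur := by rw [hur]; field_simp
  have hLmem : ∀ᶠ ε in 𝓝[>] (0 : ℝ), ((fun ε => (ρl ε, ql ε)) ε).1 ∈ Ioo 0 ρs :=
    (hρl.eventually_const_lt hρs).and hρl_lt
  have hRmem : ∀ᶠ ε in 𝓝[>] (0 : ℝ), ((fun ε => (ρr ε, qr ε)) ε).1 ∈ Ioo 0 ρs :=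
    (hρr.eventually_const_lt hρr_pos).and (hρr.eventually_lt_const hρr_lt)
  have htl : Tendsto (fun ε => excess ρs (ρl ε)) (𝓝[>] 0) (𝓝 0) := by
    have h := ((hasDerivAt_excess (ρs := ρs) hρs.ne').continuousAt.tendsto).comp hρl
    rwa [excess, sub_self] at h
  have htr0 : 0 < excess ρs ρr₀ := excess_pos ⟨hρr_pos, hρr_lt⟩
  have htr : Tendsto (fun ε => excess ρs (ρr ε)) (𝓝[>] 0) (𝓝 (excess ρs ρr₀)) :=
    ((hasDerivAt_excess (ρs := ρs) hρr_pos.ne').continuousAt.tendsto).comp hρr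
  have hvl : Tendsto (fun ε => vel (ρl ε, ql ε)) (𝓝[>] 0) (𝓝 ul) := by
    rw [hul]; exact hql.div hρl hρs.ne'
  have hvr : Tendsto (fun ε => vel (ρr ε, qr ε)) (𝓝[>] 0) (𝓝 ur) := by
    rw [hur]; exact hqr.div hρr hρr_pos.ne'
  have hpl' : Tendsto (fun ε => ε * excess ρs (ρl ε) ^ (-γ)) (𝓝[>] 0) (𝓝 pl₀) :=
    hpl.congr' (hLmem.mono fun ε h => by rw [pressure_eq h])
  have hpl₀ : 0 ≤ pl₀ := by
    refine ge_of_tendsto hpl' ?_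
    filter_upwards [hLmem, self_mem_nhdsWithin] with ε h h'
    have h1 : 0 < ε := h'
    have h2 := excess_pos h
    positivity
  have hTL : TameData ρs γ (𝓝[>] 0) (fun ε => (ρl ε, ql ε)) ul :=
    tameData_of_congested hγ le_rfl hLmem hvl htl hpl'
  have hTR : TameData ρs γ (𝓝[>] 0) (fun ε => (ρr ε, qr ε)) ur :=
    tameData_of_tendsto le_rfl hRmem hvr htr0 htr
  have hG : Tendsto (fun ε => limTriple ρs γ ε (ρl ε, ql ε)) (𝓝[>] 0) (𝓝 (ρs, ql₀, pl₀)) :=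
    hρl.prodMk_nhds (hql.prodMk_nhds hpl)
  have hRlim : ∀ (l : Ultrafilter ℝ) (A : ℝ → ℝ × ℝ), (l : Filter ℝ) ≤ 𝓝[>] 0 →
      (∀ᶠ ε in (l : Filter ℝ), A ε = (ρr ε, qr ε)) →
      Tendsto (fun ε => limTriple ρs γ ε (A ε)) l (𝓝 (ρr₀, qr₀, 0)) := by
    intro l A hl hA
    have h := tendsto_limTriple (γ := γ) (p := 0) hρs (hl hRmem) htr0.le (htr.mono_left hl)
      (hvr.mono_left hl) (by
        have := (tendsto_id_of_le hl).mul
          ((htr.mono_left hl).rpow_const (p := -γ) (Or.inl htr0.ne'))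
        rwa [zero_mul] at this)
    rw [← dens_eq, ← hqr₀] at h
    exact h.congr' (hA.mono fun ε h => by simp only [h])
  have hex : ∀ᶠ ε in 𝓝[>] (0 : ℝ), ∃ U, IsRiemannSolution ρs γ ε (ρl ε, ql ε) (ρr ε, qr ε) U := by
    filter_upwards [hLmem, hRmem, self_mem_nhdsWithin] with ε h1 h2 h3
      using exists_isRiemannSolution hγ hρs h3 h1 h2
  refine ⟨fun hu => ⟨hex, fun U hU => ?_, ?_, ?_, ?_⟩, fun hu qm pm σ hqm hpm hσ => ?_,
    fun hu => ⟨hex, fun U hU => ?_, ?_, ?_, ?_⟩⟩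
  · obtain ⟨M, a₁, b₁, a₂, b₂, ha, hD⟩ := exists_fanData hγ hρs hTL hTR htl htr0 htr hU
    refine convergesToFan_of_tendsto (c := ![ul, ur]) rfl ?_ hG
      (ha.mono fun ε h => ⟨a₁ ε, fun s hs => congrArg (limTriple ρs γ ε) (h s hs)⟩) ?_
    · intro i
      fin_cases i <;> rfl
    · intro l hl s K δ hδ hK i hlo hhi
      have D := hD l hl
      match i with
      | 0 =>
        have := D.tendsto_left_zone hu.le hδ hK (hhi 0 le_rfl)
        rwa [← hql₀] at this
      | 1 => exact D.tendsto_vacuum_zone hu hδ (hlo 0 (by decide)) (hhi 1 le_rfl)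
      | 2 => exact hRlim l _ hl (D.eventually_eq_right hu.le hδ (hlo 1 (by decide)))
  · intro i
    fin_cases i
    · exact isLimState_congested hρs hpl₀
    · exact isLimState_congested hρs le_rfl
    · exact isLimState_vacuum hρs
    · exact isLimState_free hρr_pos hρr_lt.le
  · rw [Fin.strictMono_iff_lt_succ]
    intro i
    fin_cases i
    · exact EReal.bot_lt_coe ul
    · exact EReal.coe_lt_coe_iff.2 hu
  · intro i
    fin_cases i
    · exact isDeclustering_bot
    · exact ⟨ul, rfl, rfl, by rw [hql₀]; exact mul_comm _ _, (mul_zero _).symm⟩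
    · exact ⟨ur, rfl, rfl, (mul_zero _).symm, by rw [hqr₀]; exact mul_comm _ _⟩
  · have hσ' : σ = (ρs * ul - ρr₀ * ur) / (ρs - ρr₀) := by
      rw [hσ, hpm, shock_speed_eq hρs hρr_pos hρr_lt hu]
    have hd : ρs - ρr₀ ≠ 0 := (sub_pos.2 hρr_lt).ne'
    have hexc : excess ρs ρr₀ = (ρs - ρr₀) / (ρs * ρr₀) := by
      rw [excess]; field_simp
    -- The limits were computed in terms of the right excess volume; they are converted here to the
    -- densities of the statement.
    have hσ'' : ur + (ul - ur) / excess ρs ρr₀ * (excess ρs ρr₀ + 1 / ρs) = σ := by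
      rw [← one_div_eq_excess_add, hσ', hexc]; field_simp; ring
    have hpm' : (ul - ur) ^ 2 / excess ρs ρr₀ = pm := by
      rw [hexc, hpm]; field_simp
    have hpm₀ : 0 ≤ pm := by rw [← hpm']; positivity
    refine ⟨hex, fun U hU => ?_, ?_, ?_, ?_⟩
    · obtain ⟨M, a₁, b₁, a₂, b₂, ha, hD⟩ := exists_fanData hγ hρs hTL hTR htl htr0 htr hU
      refine convergesToFan_of_tendsto (c := ![σ]) rfl ?_ hG
        (ha.mono fun ε h => ⟨a₁ ε, fun s hs => congrArg (limTriple ρs γ ε) (h s hs)⟩) ?_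
      · intro i
        fin_cases i
        rfl
      · intro l hl s K δ hδ hK i hlo hhi
        have D := hD l hl
        match i with
        | 0 =>
          have := D.tendsto_congested_zone hu hδ hK (by rw [hσ'']; exact hhi 0 le_rfl)
          rwa [hpm', ← hqm] at this
        | 1 =>
          exact hRlim l _ hl (D.eventually_eq_right_of_lt hu hδ
            (by rw [hσ'']; exact hlo 0 (by decide)))
    · intro i
      fin_cases i
      · exact isLimState_congested hρs hpl₀
      · exact isLimState_congested hρs hpm₀
      · exact isLimState_free hρr_pos hρr_lt.le
    · rw [Fin.strictMono_iff_lt_succ]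
      intro i
      fin_cases i
      exact EReal.bot_lt_coe σ
    · intro i
      fin_cases i
      · exact Or.inr ⟨Or.inl rfl, rfl, rfl, hql₀.trans hqm.symm⟩
      · have h := isFiniteShock_congested hρs hρr_pos hρr_lt hu
        rw [← hσ', ← hqm, ← hpm, ← hqr₀] at h
        exact Or.inl h
  · obtain ⟨M, a₁, b₁, a₂, b₂, ha, hD⟩ := exists_fanData hγ hρs hTL hTR htl htr0 htr hU
    refine convergesToFan_of_tendsto (c := ![ul]) rfl ?_ hG
      (ha.mono fun ε h => ⟨a₁ ε, fun s hs => congrArg (limTriple ρs γ ε) (h s hs)⟩) ?_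
    · intro i
      fin_cases i
      rfl
    · intro l hl s K δ hδ hK i hlo hhi
      have D := hD l hl
      match i with
      | 0 =>
        have := D.tendsto_left_zone hu.le hδ hK (hhi 0 le_rfl)
        rwa [← hql₀] at this
      | 1 =>
        exact hRlim l _ hl (D.eventually_eq_right hu.le hδ
          (by rw [← hu]; exact hlo 0 (by decide)))
  · intro i
    fin_cases i
    · exact isLimState_congested hρs hpl₀
    · exact isLimState_congested hρs le_rfl
    · exact isLimState_free hρr_pos hρr_lt.le
  · rw [Fin.strictMono_iff_lt_succ]
    intro i
    fin_cases i
    exact EReal.bot_lt_coe ul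
  · intro i
    fin_cases i
    · exact isDeclustering_bot
    · exact ⟨ul, rfl, rfl, by rw [hql₀]; exact mul_comm _ _,
        by rw [hqr₀, hu]; exact mul_comm _ _⟩
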